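/- Let $p$ be a prime, $L$ a finite extension of $\mathbb{Q}_p$ inside $\overline{\mathbb{Q}}_p$ with ring of integers $\mathcal{O}_L$ and residue field of cardinality $q$, and let $D$ be a quaternion division algebra over $L$ with maximal order $\mathcal{O}_D$ and uniformizer $\Pi_D$. Put $K=\mathcal{O}_D^\times$, $Z=\mathcal{O}_L^\times$ and $I_1=1+\Pi_D\mathcal{O}_D$. Let $E\subset\overline{\mathbb{Q}}_p$ be a finite extension of $\mathbb{Q}_p$ (the coefficient field), with ring of integers $\mathcal{O}_E$ and residue field $k_E$, and let $R_{k_E}(K)$ be the Grothendieck group of smooth finite-dimensional representations of $K$ over $k_E$. A two-dimensional Weil–Deligne representation $(r,N)$ of the Weil group $W_L$ is a smooth representation $r$ of $W_L$ on a two-dimensional $\overline{\mathbb{Q}}_p$-vector space with a nilpotent endomorphism $N$ such that $N r(g)=q^{\nu(g)}r(g)N$, where $g$ acts on the residue field as the $\nu(g)$-th power of the geometric Frobenius. Write $(r',N')\sim(r,N)$ if $(r'|_{I_L},N')\cong(r|_{I_L},N)$, where $I_L$ is the inertia group. Let $\pi_D(r,N)$ be the smooth irreducible representation of $D^\times$ attached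 to $(r,N)$ by the local Langlands and Jacquet–Langlands correspondences, normalised so that $\mathrm{Ind}_{B(L)}^{\mathrm{GL}_2(L)}\xi_1\otimes\xi_2|\cdot|^{-1}$ corresponds to $\xi_1\oplus\xi_2$ and uniformizers to geometric Frobenius elements; it is defined when $r$ is irreducible or $N\neq0$, and is taken to be $0$ otherwise. A smooth irreducible representation $\vartheta$ of $K$ over $E$ is a $K$-type for $[r,N]$ if, for every two-dimensional Weil–Deligne representation $(r',N')$, $$\mathrm{Hom}_{E[K]}(\vartheta,\pi_D(r',N'))\neq0\iff(r',N')\sim(r,N).$$ The essential conductor of $[r,0]$ is the minimum of the Artin conductors (exponents) of the twists of $r$ by smooth characters of $W_L$. Proposition 4.7. Suppose that $r$ is irreducible (so $N=0$) with odd essential conductor $2m+1$, where $m\geq1$. Let $\vartheta$ be a $K$-type for $[r,0]$ over $E$, with $E$ large enough that every $K$-endomorphism of $\vartheta$ is a scalar in $E$. Let $\psi$ be the reduction of the central character of $\vartheta$, that is, the character $Z\to k_E^\times$ obtained by reducing the character by which $Z$ acts on $\vartheta$, extended to $ZI_1$ by being trivial on $I_1$. Then the reduction $\overline{\vartheta}\in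 R_{k_E}(K)$ of $\vartheta$, that is, the class of $\Lambda/\mathfrak{m}_E\Lambda$ for any $K$-stable $\mathcal{O}_E$-lattice $\Lambda$ in $\vartheta$, satisfies $$\overline{\vartheta}=q^{m-1}\,\mathrm{ind}_{ZI_1}^{K}\psi\quad\text{in }R_{k_E}(K).$$ In particular $\dim_E\vartheta=q^{m-1}(q+1)$. -/

import Mathlib

noncomputable section

namespace LocalType

/-! ### Subfields of `ℚ̄_p`, integers, residue fields -/

/-- Subfields of the fixed algebraic closure `ℚ̄_p`; finiteness over `ℚ_p` is always an extra
hypothesis.  The absolute value `‖·‖` on `PadicAlgCl p` is the extension of the `p`-adic one. -/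
abbrev LocalField (p : ℕ) [Fact p.Prime] := IntermediateField ℚ_[p] (PadicAlgCl p)

/-- The absolute Galois group of `ℚ_p`. -/
abbrev AbsGal (p : ℕ) [Fact p.Prime] := PadicAlgCl p ≃ₐ[ℚ_[p]] PadicAlgCl p

variable {p : ℕ} [Fact p.Prime]

/-- The ring of integers `𝒪_K`, i.e. the elements of `K` of absolute value at most `1`. -/
def integers (K : LocalField p) : ValuationSubring K :=
  ((PadicAlgCl.valued p).v.valuationSubring).comap (algebraMap K (PadicAlgCl p))

theorem mem_integers (K : LocalField p) (x : K) :
    x ∈ integers K ↔ ‖(x : PadicAlgCl p)‖ ≤ 1 := by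
  rw [integers, ValuationSubring.mem_comap, Valuation.mem_valuationSubring_iff,
    ← PadicAlgCl.valuation_coe]
  exact_mod_cast Iff.rfl

/-- The residue field `k_K`. -/
abbrev residueField (K : LocalField p) := IsLocalRing.ResidueField (integers K)

/-- The cardinality `q_K` of the residue field. -/
def resCard (K : LocalField p) : ℕ := Nat.card (residueField K)

/-- The absolute value of a uniformizer of `K`.  Thus the fractional ideal `𝔭_K ^ n` is the set of
`x ∈ K` with `‖x‖ ≤ absUnif K ^ n`. -/
def absUnif (K : LocalField p) : ℝ :=
  sSup {t : ℝ | ∃ x : K, ‖(x : PadicAlgCl p)‖ < 1 ∧ t = ‖(x : PadicAlgCl p)‖}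

/-! ### Weil groups -/

/-- `g` acts on the residue field of `ℚ̄_p` as the `n`-th power of the geometric Frobenius
`x ↦ x ^ (1 / q_K)` of `K` (for `n = a - b`: the relation `g(x) ^ (q ^ a) = x ^ (q ^ b)`). -/
def IsFrobPow (K : LocalField p) (g : AbsGal p) (n : ℤ) : Prop :=
  ∃ a b : ℕ, n = (a : ℤ) - (b : ℤ) ∧ ∀ x : PadicAlgCl p, ‖x‖ ≤ 1 →
    ‖(g x) ^ (resCard K ^ a) - x ^ (resCard K ^ b)‖ < 1

theorem norm_galois (g : AbsGal p) (x : PadicAlgCl p) : ‖g x‖ = ‖x‖ := by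
  rw [← PadicAlgCl.spectralNorm_eq, ← PadicAlgCl.spectralNorm_eq]
  exact (spectralNorm_eq_of_equiv g x).symm

theorem norm_pow_sub_pow_lt {x y : PadicAlgCl p} (hx : ‖x‖ ≤ 1) (hy : ‖y‖ ≤ 1)
    (h : ‖x - y‖ < 1) (n : ℕ) : ‖x ^ n - y ^ n‖ < 1 := by
  induction n with
  | zero => simp
  | succ n ih =>
    have e : x ^ (n + 1) - y ^ (n + 1) = x ^ n * (x - y) + (x ^ n - y ^ n) * y := by ring
    rw [e]
    refine lt_of_le_of_lt (PadicAlgCl.isNonarchimedean p _ _) (max_lt ?_ ?_)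
    · rw [norm_mul, norm_pow]
      exact lt_of_le_of_lt (mul_le_of_le_one_left (norm_nonneg _) (pow_le_one₀ (norm_nonneg _) hx)) h
    · rw [norm_mul]
      exact lt_of_le_of_lt (mul_le_of_le_one_right (norm_nonneg _) hy) ih

theorem IsFrobPow.one (K : LocalField p) : IsFrobPow K 1 0 :=
  ⟨0, 0, by simp, fun x _ => by simp⟩

theorem IsFrobPow.mul {K : LocalField p} {g h : AbsGal p} {n m : ℤ} (hg : IsFrobPow K g n)
    (hh : IsFrobPow K h m) : IsFrobPow K (g * h) (n + m) := by
  obtain ⟨a, b, rfl, H⟩ := hg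
  obtain ⟨a', b', rfl, H'⟩ := hh
  refine ⟨a + a', b + b', by push_cast; ring, fun x hx => ?_⟩
  have h1 := norm_pow_sub_pow_lt (x := (g (h x)) ^ (resCard K ^ a))
    (y := (h x) ^ (resCard K ^ b))
    (by rw [norm_pow, norm_galois, norm_galois]; exact pow_le_one₀ (norm_nonneg _) hx)
    (by rw [norm_pow, norm_galois]; exact pow_le_one₀ (norm_nonneg _) hx)
    (H (h x) (by rwa [norm_galois])) (resCard K ^ a')
  have h2 := norm_pow_sub_pow_lt (x := (h x) ^ (resCard K ^ a'))
    (y := x ^ (resCard K ^ b'))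
    (by rw [norm_pow, norm_galois]; exact pow_le_one₀ (norm_nonneg _) hx)
    (by rw [norm_pow]; exact pow_le_one₀ (norm_nonneg _) hx)
    (H' x hx) (resCard K ^ b)
  rw [← pow_mul, ← pow_mul, ← pow_add] at h1 h2
  have e : (g * h) x ^ (resCard K ^ (a + a')) - x ^ (resCard K ^ (b + b'))
      = (g (h x) ^ (resCard K ^ (a + a')) - h x ^ (resCard K ^ (b + a')))
        + (h x ^ (resCard K ^ (a' + b)) - x ^ (resCard K ^ (b + b'))) := by
    rw [add_comm b a']
    simp [AlgEquiv.mul_apply]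
  rw [e]
  refine lt_of_le_of_lt (PadicAlgCl.isNonarchimedean p _ _) (max_lt ?_ ?_)
  · simpa [pow_add] using h1
  · simpa [pow_add, mul_comm, mul_left_comm] using h2

theorem IsFrobPow.inv {K : LocalField p} {g : AbsGal p} {n : ℤ} (hg : IsFrobPow K g n) :
    IsFrobPow K g⁻¹ (-n) := by
  obtain ⟨a, b, rfl, H⟩ := hg
  refine ⟨b, a, by ring, fun x hx => ?_⟩
  have h1 := H (g⁻¹ x) (by rwa [norm_galois])
  have e : g (g⁻¹ x) = x := by rw [← AlgEquiv.mul_apply, mul_inv_cancel, AlgEquiv.one_apply]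
  rw [e] at h1
  rwa [norm_sub_rev]

/-- The Weil group `W_K`: the elements of `Gal(ℚ̄_p / K)` that act on the residue field by an
integral power of Frobenius. -/
def weilGroup (K : LocalField p) : Subgroup (AbsGal p) where
  carrier := {g | g ∈ K.fixingSubgroup ∧ ∃ n : ℤ, IsFrobPow K g n}
  mul_mem' := by
    rintro a b ⟨ha, n, hn⟩ ⟨hb, m, hm⟩
    exact ⟨mul_mem ha hb, n + m, hn.mul hm⟩
  one_mem' := ⟨one_mem _, 0, IsFrobPow.one K⟩
  inv_mem' := by
    rintro a ⟨ha, n, hn⟩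
    exact ⟨inv_mem ha, -n, hn.inv⟩

/-- `g` acts trivially on the residue field of `ℚ̄_p`; for `g ∈ W_K` this says that `g` lies in
the inertia group `I_K`. -/
def IsInertial (g : AbsGal p) : Prop := ∀ x : PadicAlgCl p, ‖x‖ ≤ 1 → ‖g x - x‖ < 1

/-- Smoothness (continuity for the discrete topology on the target) of a homomorphism on the Weil
group, whose topology makes `I_K`, with its profinite topology, an open subgroup. -/
def WeilSmooth {K : LocalField p} {M : Type*} [Monoid M] (f : weilGroup K →* M) : Prop :=
  ∃ F : LocalField p, FiniteDimensional ℚ_[p] F ∧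
    ∀ g : weilGroup K, IsInertial (g : AbsGal p) →
      (∀ x ∈ F, (g : AbsGal p) x = x) → f g = 1

/-- The twist `ρ ⊗ η` of a representation by a character. -/
def twist {k G V : Type*} [Field k] [Group G] [AddCommGroup V] [Module k V]
    (η : G →* k) (ρ : Representation k G V) : Representation k G V where
  toFun g := η g • ρ g
  map_one' := by simp
  map_mul' a b := by
    ext v
    simp [mul_smul, smul_comm (η a) (η b)]

/-! ### Artin conductors -/

/-- `F / K` is finite Galois and `I_F` acts trivially through `ρ`. -/
def IsSplittingField {K : LocalField p} {n : ℕ}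
    (ρ : Representation (PadicAlgCl p) (weilGroup K) (Fin n → PadicAlgCl p))
    (F : LocalField p) : Prop :=
  FiniteDimensional ℚ_[p] F ∧ K ≤ F ∧
    (∀ g ∈ K.fixingSubgroup, ∀ x ∈ F, (g : AbsGal p) x ∈ F) ∧
    ∀ g : weilGroup K, IsInertial (g : AbsGal p) →
      (∀ x ∈ F, (g : AbsGal p) x = x) → ρ g = 1

/-- The elements of `I_K` whose image in `Gal(F / K)` lies in the `i`-th ramification group
`G_i` (lower numbering). -/
def ramification (K F : LocalField p) (i : ℕ) : Set (weilGroup K) :=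
  {g | IsInertial (g : AbsGal p) ∧ ∀ x ∈ F, ‖x‖ ≤ 1 →
    ‖(g : AbsGal p) x - x‖ ≤ absUnif F ^ (i + 1)}

/-- The order of the `i`-th ramification group of `F / K`. -/
def ramCard (K F : LocalField p) (i : ℕ) : ℕ :=
  Nat.card {σ : F → PadicAlgCl p | ∃ g ∈ ramification K F i,
    ∀ x : F, σ x = (g : AbsGal p) (x : PadicAlgCl p)}

/-- The vectors fixed by the `i`-th ramification group of `F / K`. -/
def ramFixed {K : LocalField p} {n : ℕ}
    (ρ : Representation (PadicAlgCl p) (weilGroup K) (Fin n → PadicAlgCl p))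
    (F : LocalField p) (i : ℕ) : Submodule (PadicAlgCl p) (Fin n → PadicAlgCl p) :=
  ⨅ g ∈ ramification K F i, LinearMap.eqLocus (ρ g) LinearMap.id

/-- The Artin conductor (exponent) of a smooth representation `V` of `W_K`,
`∑_i (|G_i| / |G_0|) * dim (V / V ^ {G_i})`, computed with any finite Galois extension `F / K` such
that `I_F` acts trivially; it is an integer, independent of `F`. -/
def artinConductor {K : LocalField p} {n : ℕ}
    (ρ : Representation (PadicAlgCl p) (weilGroup K) (Fin n → PadicAlgCl p)) : ℕ :=
  let F : LocalField p := Classical.epsilon (IsSplittingField ρ)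
  (∑ᶠ i : ℕ, ramCard K F i * (n - Module.finrank (PadicAlgCl p) (ramFixed ρ F i))) / ramCard K F 0

/-! ### Local class field theory and local constants -/

/-- Smooth characters of `K^×`, as multiplicative maps extended by `0 ↦ 0`. -/
def CharSmooth {K : LocalField p} (χ : K →*₀ PadicAlgCl p) : Prop :=
  ∃ n : ℕ, ∀ x : K, ‖(x : PadicAlgCl p) - 1‖ ≤ (p : ℝ) ^ (-(n : ℤ)) → χ x = 1

/-- The character `χ ∘ θ` of `W_K` attached to a character `χ` of `K^×`. -/
def pullChar {K : LocalField p} (θ : weilGroup K →* Kˣ) (χ : K →*₀ PadicAlgCl p) :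
    weilGroup K →* PadicAlgCl p :=
  (χ : K →* PadicAlgCl p).comp ((Units.coeHom K).comp θ)

/-- `θ : W_K → K^×` is the map of local class field theory, i.e. it induces the inverse
`W_K^ab ≅ K^×` of the reciprocity isomorphism, normalised so that geometric Frobenius elements
correspond to uniformizers.  (The fields `frob` and `norm_mem` already determine it; the others say
that it induces an isomorphism of topological groups on the maximal abelian quotient, in terms of
smooth characters.) -/
structure IsReciprocity (K : LocalField p) (θ : weilGroup K →* Kˣ) : Prop where
  frob : ∀ (g : weilGroup K) (n : ℤ), IsFrobPow K g n →
    ‖(((θ g : Kˣ) : K) : PadicAlgCl p)‖ = absUnif K ^ n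
  norm_mem : ∀ F : IntermediateField K (PadicAlgCl p), FiniteDimensional K F →
    ∀ g : weilGroup K, (∀ x ∈ F, (g : AbsGal p) x = x) →
      ∃ y : F, Algebra.norm K y = ((θ g : Kˣ) : K)
  surjective : Function.Surjective θ
  smooth_iff : ∀ χ : K →*₀ PadicAlgCl p, CharSmooth χ ↔ WeilSmooth (pullChar θ χ)
  factors : ∀ η : weilGroup K →* PadicAlgCl p, WeilSmooth η →
    ∃ χ : K →*₀ PadicAlgCl p, pullChar θ χ = η

/-- The additive character `ψ_K = ψ ∘ Tr_{K / ℚ_p}`. -/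
def addCharOf (ψ : AddChar ℚ_[p] (PadicAlgCl p)) (K : LocalField p) (x : K) : PadicAlgCl p :=
  ψ (Algebra.trace ℚ_[p] K x)

/-- The largest integer `n = n(ψ_K)` such that `ψ_K` is trivial on `𝔭_K ^ (-n)`. -/
def addLevel (ψ : AddChar ℚ_[p] (PadicAlgCl p)) (K : LocalField p) : ℤ :=
  sSup {n : ℤ | ∀ x : K, ‖(x : PadicAlgCl p)‖ ≤ absUnif K ^ (-n) → addCharOf ψ K x = 1}

/-- The conductor exponent `a(χ)` of a smooth character `χ` of `K^×`. -/
def charConductor {K : LocalField p} (χ : K →*₀ PadicAlgCl p) : ℕ :=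
  sInf {a : ℕ | ∀ u : K, ‖(u : PadicAlgCl p)‖ = 1 →
    ‖(u : PadicAlgCl p) - 1‖ ≤ absUnif K ^ a → χ u = 1}

/-- `R` represents `(𝒪_K / 𝔭_K ^ a)^×`. -/
def IsUnitTransversal (K : LocalField p) (a : ℕ) (R : Finset K) : Prop :=
  (∀ u ∈ R, ‖(u : PadicAlgCl p)‖ = 1) ∧
    ∀ x : K, ‖(x : PadicAlgCl p)‖ = 1 →
      ∃! u : K, u ∈ R ∧ ‖(x : PadicAlgCl p) - (u : PadicAlgCl p)‖ ≤ absUnif K ^ a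

/-- A system of maps on the representations of the Weil groups of all the finite extensions of
`ℚ_p`, with values in `ℚ̄_p^×`. -/
abbrev ConstantSystem (p : ℕ) [Fact p.Prime] :=
  (K : LocalField p) → (n : ℕ) →
    Representation (PadicAlgCl p) (weilGroup K) (Fin n → PadicAlgCl p) → (PadicAlgCl p)ˣ

/-- `ε K n ρ` is the Langlands–Deligne local constant `ε(ρ, ψ_K, dx_K)` of the smooth representation
`ρ` of `W_K`, where `dx_K` is the Haar measure on `K` of total mass `q_K ^ (-n(ψ_K))` on `𝒪_K`.
By the theorem of Langlands and Deligne these constants exist and are characterised by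
multiplicativity in exact sequences, inductivity in degree `0` (i.e. inductivity up to a constant
`λ(K' / K) ^ dim`) and Tate's formula in dimension `1`:
`ε(χ, ψ_K, dx) = ∫_{c⁻¹ 𝒪_K^×} χ⁻¹(x) ψ_K(x) dx` if `χ` is ramified and
`ε(χ, ψ_K, dx) = χ(c) |c|⁻¹ ∫_{𝒪_K} dx` if `χ` is unramified, where `v(c) = a(χ) + n(ψ_K)`;
for the given measure both are the finite sum below. -/
structure IsLocalConstant (ψ : AddChar ℚ_[p] (PadicAlgCl p))
    (θ : (K : LocalField p) → weilGroup K →* Kˣ) (ε : ConstantSystem p) : Prop where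
  exact : ∀ (K : LocalField p), FiniteDimensional ℚ_[p] K → ∀ (n n₁ n₂ : ℕ)
    (ρ : Representation (PadicAlgCl p) (weilGroup K) (Fin n → PadicAlgCl p))
    (ρ₁ : Representation (PadicAlgCl p) (weilGroup K) (Fin n₁ → PadicAlgCl p))
    (ρ₂ : Representation (PadicAlgCl p) (weilGroup K) (Fin n₂ → PadicAlgCl p)),
    WeilSmooth ρ → WeilSmooth ρ₁ → WeilSmooth ρ₂ →
    ∀ (i : ρ₁.IntertwiningMap ρ) (j : ρ.IntertwiningMap ρ₂),
      Function.Injective i → Function.Exact i j → Function.Surjective j →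
      ε K n ρ = ε K n₁ ρ₁ * ε K n₂ ρ₂
  induction : ∀ (K K' : LocalField p), FiniteDimensional ℚ_[p] K' → K ≤ K' →
    ∀ h : weilGroup K' ≤ weilGroup K, ∃ lam : (PadicAlgCl p)ˣ, ∀ (n m : ℕ)
      (ρ : Representation (PadicAlgCl p) (weilGroup K') (Fin n → PadicAlgCl p))
      (τ : Representation (PadicAlgCl p) (weilGroup K) (Fin m → PadicAlgCl p)),
      WeilSmooth ρ → Nonempty (τ.Equiv (Representation.coind (Subgroup.inclusion h) ρ)) →
      ε K m τ = lam ^ n * ε K' n ρ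
  tate : ∀ (K : LocalField p), FiniteDimensional ℚ_[p] K → ∀ χ : K →*₀ PadicAlgCl p,
    CharSmooth χ →
    ∀ ρ : Representation (PadicAlgCl p) (weilGroup K) (Fin 1 → PadicAlgCl p),
    (∀ g v, ρ g v = pullChar (θ K) χ g • v) →
    ∀ (c : K) (R : Finset K),
      ‖(c : PadicAlgCl p)‖ = absUnif K ^ ((charConductor χ : ℤ) + addLevel ψ K) →
      IsUnitTransversal K (charConductor χ) R →
      (ε K 1 ρ : PadicAlgCl p) = ∑ u ∈ R, χ (c / u) * addCharOf ψ K (u / c)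

/-! ### Quaternion division algebras -/

section Quaternion

variable (L : LocalField p) {D : Type*} [DivisionRing D] [Algebra L D]

/-- `|N(x)|` for the norm `N = N_{D / L}` of the regular representation.  For a quaternion algebra
`N = Nrd ^ 2`, hence the maximal order `𝒪_D` consists of the `x` with `quatAbs L x ≤ 1`, and
`𝔓_D ^ n = Π_D ^ n 𝒪_D` consists of the `x` with `quatAbs L x ≤ absUnif L ^ (2 * n)`. -/
def quatAbs (x : D) : ℝ := ‖((Algebra.norm L x : L) : PadicAlgCl p)‖

/-- `x ∈ 𝔓_D ^ n`. -/
def MemIdealPow (n : ℤ) (x : D) : Prop := quatAbs L x ≤ absUnif L ^ (2 * n)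

/-- The reduced norm of a quaternion algebra: the constant term of the power of degree `2` of the
minimal polynomial. -/
def redNorm (x : D) : L := (minpoly L x).coeff 0 ^ (2 / (minpoly L x).natDegree)

/-- The reduced trace of a quaternion algebra: half the trace of the regular representation. -/
def redTrace (x : D) : L := LinearMap.trace L D (LinearMap.mulLeft L x) / 2

variable (D) in
/-- The unit group `K = 𝒪_D^×` of the maximal order. -/
def unitGroup : Subgroup Dˣ where
  carrier := {x | quatAbs L (x : D) = 1}
  mul_mem' := by
    intro a b ha hb
    simp only [Set.mem_ofPred_eq, quatAbs] at ha hb ⊢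
    simp [ha, hb]
  one_mem' := by simp [quatAbs]
  inv_mem' := by
    intro a ha
    simp only [Set.mem_ofPred_eq, quatAbs] at ha ⊢
    have h : Algebra.norm L ((a⁻¹ : Dˣ) : D) * Algebra.norm L (a : D) = 1 := by
      rw [← map_mul]; simp
    have h2 := congrArg (fun y : L => ‖(y : PadicAlgCl p)‖) h
    simpa [ha] using h2

/-- Smoothness of a representation of a subgroup `G` of `D^×`: every vector is fixed by
`G ∩ (1 + 𝔓_D ^ n)` for some `n`. -/
def QuatSmooth {G k V : Type*} [Group G] [Field k] [AddCommGroup V] [Module k V]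
    (i : G →* Dˣ) (ρ : Representation k G V) : Prop :=
  ∀ v : V, ∃ n : ℕ, ∀ g : G, MemIdealPow L (n : ℤ) ((i g : D) - 1) → ρ g v = v

variable {L}

/-- The least `f` such that `π ⊗ (χ ∘ Nrd)` is trivial on `U_D ^ f`, where `U_D ^ 0 = 𝒪_D^×` and
`U_D ^ f = 1 + 𝔓_D ^ f` for `f ≥ 1`. -/
def quatLevel {d : ℕ} (χ : L →*₀ PadicAlgCl p)
    (π : Representation (PadicAlgCl p) Dˣ (Fin d → PadicAlgCl p)) : ℕ :=
  sInf {f : ℕ | ∀ g ∈ unitGroup L D, MemIdealPow L (f : ℤ) ((g : D) - 1) →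
    χ (redNorm L (g : D)) • π g = 1}

variable (L D) in
/-- The largest `n` such that `ψ_D = ψ_L ∘ Trd` is trivial on `𝔓_D ^ (-n)`. -/
def quatAddLevel (ψ : AddChar ℚ_[p] (PadicAlgCl p)) : ℤ :=
  sSup {n : ℤ | ∀ x : D, MemIdealPow L (-n) x → addCharOf ψ L (redTrace L x) = 1}

variable (L) in
/-- `R` represents `𝒪_D^× / U_D ^ f`. -/
def IsQuatTransversal (f : ℕ) (R : Finset Dˣ) : Prop :=
  (∀ u ∈ R, u ∈ unitGroup L D) ∧
    ∀ x ∈ unitGroup L D, ∃! u : Dˣ, u ∈ R ∧ MemIdealPow L (f : ℤ) ((x : D) - (u : D))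

/-- The scalar `t` is the non-abelian Gauss sum of `π' = π ⊗ (χ ∘ Nrd)`: one has
`∑_x ψ_D(x) π'(x)⁻¹ = t · id`, with `x` running over `c⁻¹ 𝒪_D^×` modulo `U_D ^ f`, where `f` is the
level of `π'` and `v_D(c) = f + n(ψ_D)`. -/
def IsQuatGaussSum {d : ℕ} (ψ : AddChar ℚ_[p] (PadicAlgCl p)) (χ : L →*₀ PadicAlgCl p)
    (π : Representation (PadicAlgCl p) Dˣ (Fin d → PadicAlgCl p)) (t : PadicAlgCl p) : Prop :=
  ∃ (c : Dˣ) (R : Finset Dˣ),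
    quatAbs L (c : D) = absUnif L ^ (2 * ((quatLevel χ π : ℤ) + quatAddLevel L D ψ)) ∧
    IsQuatTransversal L (quatLevel χ π) R ∧
    ∑ u ∈ R, (addCharOf ψ L (redTrace L ((c⁻¹ * u : Dˣ) : D)) *
      (χ (redNorm L ((c⁻¹ * u : Dˣ) : D)))⁻¹) • π (c⁻¹ * u)⁻¹ = t • LinearMap.id

/-- The Godement–Jacquet local factor `ε(π', s, ψ)` of `π' = π ⊗ (χ ∘ Nrd)` (for the self-dual
measure), as a monomial in `T = q ^ (1/2 - s)`: it is `q ^ (-f) t T ^ (f + n(ψ_D))`, where `t` is the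
Gauss sum and `f` the level of `π'`. -/
def quatEpsilon {d : ℕ} (ψ : AddChar ℚ_[p] (PadicAlgCl p)) (χ : L →*₀ PadicAlgCl p)
    (π : Representation (PadicAlgCl p) Dˣ (Fin d → PadicAlgCl p)) (t : PadicAlgCl p) :
    LaurentPolynomial (PadicAlgCl p) :=
  LaurentPolynomial.C ((resCard L : PadicAlgCl p) ^ (-(quatLevel χ π : ℤ)) * t) *
    LaurentPolynomial.T ((quatLevel χ π : ℤ) + quatAddLevel L D ψ)

/-- The local factor `ε(ρ ⊗ |·| ^ (s - 1/2), ψ_L)` of a two-dimensional representation of `W_L` (for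
the self-dual measure), as a monomial in `T = q ^ (1/2 - s)`: it is
`ε(ρ, ψ_L) T ^ (a(ρ) + 2 n(ψ_L))`.  The power of `q` is the change of measure. -/
def weilEpsilon (ψ : AddChar ℚ_[p] (PadicAlgCl p)) (ε : ConstantSystem p)
    (ρ : Representation (PadicAlgCl p) (weilGroup L) (Fin 2 → PadicAlgCl p)) :
    LaurentPolynomial (PadicAlgCl p) :=
  LaurentPolynomial.C ((resCard L : PadicAlgCl p) ^ addLevel ψ L *
      (ε L 2 ρ : PadicAlgCl p)) *
    LaurentPolynomial.T ((artinConductor ρ : ℤ) + 2 * addLevel ψ L)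

/-! ### Weil–Deligne representations and the local Langlands correspondence for `D^×` -/

variable (L) in
/-- Two-dimensional Weil–Deligne representations `(r, N)` of `W_L` over `ℚ̄_p`. -/
structure WeilDeligneRep where
  /-- the representation of the Weil group -/
  r : Representation (PadicAlgCl p) (weilGroup L) (Fin 2 → PadicAlgCl p)
  /-- the monodromy operator -/
  N : Module.End (PadicAlgCl p) (Fin 2 → PadicAlgCl p)
  smooth : WeilSmooth r
  nilpotent : IsNilpotent N
  comm : ∀ (g : weilGroup L) (n : ℤ), IsFrobPow L g n →
    N * r g = (resCard L : PadicAlgCl p) ^ n • (r g * N)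

/-- `(r, N) ∼ (r', N')`: the restrictions to inertia are isomorphic, i.e. both define the same
Weil–Deligne type. -/
def WeilDeligneRep.SameType (w w' : WeilDeligneRep L) : Prop :=
  ∃ e : (Fin 2 → PadicAlgCl p) ≃ₗ[PadicAlgCl p] (Fin 2 → PadicAlgCl p),
    (∀ g : weilGroup L, IsInertial (g : AbsGal p) → ∀ v, e (w.r g v) = w'.r g (e v)) ∧
    ∀ v, e (w.N v) = w'.N (e v)

/-- The set of Artin conductors of the twists of `r` by smooth characters of `W_L`.  Its least
element is the essential conductor of `[r, 0]`. -/
def twistConductors (r : Representation (PadicAlgCl p) (weilGroup L) (Fin 2 → PadicAlgCl p)) :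
    Set ℕ :=
  {a | ∃ η : weilGroup L →* PadicAlgCl p, WeilSmooth η ∧ a = artinConductor (twist η r)}

/-- `π` is the smooth irreducible representation `π_D(r, N)` of `D^×` that corresponds to `(r, N)`
under the local Langlands and Jacquet–Langlands correspondences, normalised so that
`Ind_B^{GL₂} (ξ₁ ⊗ ξ₂|·|⁻¹)` corresponds to `ξ₁ ⊕ ξ₂` (hence the shift of `s` by `1/2`).
* If `r` is irreducible (so `N = 0`), then `dim π > 1`, the `L`-factors of all the twists are `1`, and
  `π` is characterised by `ε(π ⊗ (χ ∘ Nrd), s, ψ) = - ε(r ⊗ χ, s - 1/2, ψ)` for all smooth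
  characters `χ` of `L^×`.
* If `N ≠ 0`, then `r` acts on `V / ker N` by a character `χ` of `L^×`, and `π = χ ∘ Nrd`.
* Nothing corresponds to the other `(r, N)` (whose Frobenius-semisimplification is decomposable).
Smooth irreducible representations of `D^×` are finite dimensional. -/
def LanglandsCorresponds (w : WeilDeligneRep L) {d : ℕ}
    (π : Representation (PadicAlgCl p) Dˣ (Fin d → PadicAlgCl p)) : Prop :=
  π.IsIrreducible ∧ QuatSmooth L (MonoidHom.id Dˣ) π ∧
  ∃ (ψ : AddChar ℚ_[p] (PadicAlgCl p)) (θ : (K : LocalField p) → weilGroup K →* Kˣ)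
    (ε : ConstantSystem p),
    (∀ x, ψ x = 1 ↔ ‖x‖ ≤ 1) ∧
    (∀ K : LocalField p, FiniteDimensional ℚ_[p] K → IsReciprocity K (θ K)) ∧
    IsLocalConstant ψ θ ε ∧
    ((w.r.IsIrreducible ∧ 1 < d ∧
        ∀ χ : L →*₀ PadicAlgCl p, CharSmooth χ → ∃ t : PadicAlgCl p,
          IsQuatGaussSum ψ χ π t ∧
          quatEpsilon ψ χ π t = -weilEpsilon ψ ε (twist (pullChar (θ L) χ) w.r)) ∨
      (w.N ≠ 0 ∧ ∃ χ : L →*₀ PadicAlgCl p, CharSmooth χ ∧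
        (∀ (g : weilGroup L) (v : Fin 2 → PadicAlgCl p),
          w.N (w.r g v - pullChar (θ L) χ g • v) = 0) ∧
        ∀ (x : Dˣ) (v : Fin d → PadicAlgCl p), π x v = χ (redNorm L (x : D)) • v))

/-- The smooth irreducible representation `ϑ` of `𝒪_D^×` over `E` is a `K`-type for `[r, N]`: for
every `(r', N')`, one has `Hom_{E[𝒪_D^×]}(ϑ, π_D(r', N')) ≠ 0` if and only if
`(r', N') ∼ (r, N)`. -/
def IsKType {E : LocalField p} {V : Type*} [AddCommGroup V] [Module E V]
    (ϑ : Representation E (unitGroup L D) V) (w : WeilDeligneRep L) : Prop :=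
  ϑ.IsIrreducible ∧ QuatSmooth L (unitGroup L D).subtype ϑ ∧
  ∀ w' : WeilDeligneRep L,
    (∃ (d : ℕ) (π : Representation (PadicAlgCl p) Dˣ (Fin d → PadicAlgCl p)),
      LanglandsCorresponds w' π ∧
      ∃ f : V →ₗ[E] (Fin d → PadicAlgCl p), f ≠ 0 ∧
        ∀ (g : unitGroup L D) (v : V), f (ϑ g v) = π (g : Dˣ) (f v)) ↔
    w'.SameType w

/-! ### Grothendieck groups and reduction -/

variable (L D)

/-- Smooth finite dimensional representations of `K = 𝒪_D^×` over `k`, in coordinates. -/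
structure SmoothRep (k : Type*) [Field k] where
  /-- the dimension -/
  dim : ℕ
  /-- the action -/
  ρ : Representation k (unitGroup L D) (Fin dim → k)
  smooth : QuatSmooth L (unitGroup L D).subtype ρ

/-- The relations `[B] = [A] + [C]` for short exact sequences `0 → A → B → C → 0`. -/
def exactRelations (k : Type*) [Field k] : AddSubgroup (FreeAbelianGroup (SmoothRep L D k)) :=
  AddSubgroup.closure {x | ∃ (A B C : SmoothRep L D k) (i : A.ρ.IntertwiningMap B.ρ)
    (j : B.ρ.IntertwiningMap C.ρ), Function.Injective i ∧ Function.Exact i j ∧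
      Function.Surjective j ∧
      x = FreeAbelianGroup.of B - (FreeAbelianGroup.of A + FreeAbelianGroup.of C)}

/-- The Grothendieck group `R_k(K)` of smooth finite dimensional representations of
`K = 𝒪_D^×` over `k`. -/
abbrev Groth (k : Type*) [Field k] := FreeAbelianGroup (SmoothRep L D k) ⧸ exactRelations L D k

variable {L D}

/-- The class `[A]` in `R_k(K)`. -/
def SmoothRep.cls {k : Type*} [Field k] (A : SmoothRep L D k) : Groth L D k :=
  QuotientAddGroup.mk (FreeAbelianGroup.of A)

/-- `x` is the class in `R_k(K)` of the (smooth, finite dimensional) representation `σ`. -/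
def HasClass {k W : Type*} [Field k] [AddCommGroup W] [Module k W]
    (σ : Representation k (unitGroup L D) W) (x : Groth L D k) : Prop :=
  ∃ A : SmoothRep L D k, Nonempty (A.ρ.Equiv σ) ∧ x = A.cls

/-- `Λ` is a `K`-stable `𝒪_E`-lattice in the representation `ϑ`. -/
def IsStableLattice {E : LocalField p} {V : Type*} [AddCommGroup V] [Module E V]
    (ϑ : Representation E (unitGroup L D) V) (Λ : Submodule (integers E) V) : Prop :=
  Λ.FG ∧ Submodule.span E (Λ : Set V) = ⊤ ∧ ∀ (g : unitGroup L D), ∀ v ∈ Λ, ϑ g v ∈ Λ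

/-- `A` is isomorphic to the representation `Λ / 𝔪_E Λ` of `K` over `k_E`. -/
def IsLatticeReduction {E : LocalField p} {V : Type*} [AddCommGroup V] [Module E V]
    (ϑ : Representation E (unitGroup L D) V) (Λ : Submodule (integers E) V)
    (A : SmoothRep L D (residueField E)) : Prop :=
  ∃ red : Λ →ₛₗ[IsLocalRing.residue (integers E)] (Fin A.dim → residueField E),
    Function.Surjective red ∧
    (∀ v : Λ, red v = 0 ↔
      v ∈ (IsLocalRing.maximalIdeal (integers E) • ⊤ : Submodule (integers E) Λ)) ∧
    ∀ (g : unitGroup L D) (v v' : Λ), (v' : V) = ϑ g (v : V) → red v' = A.ρ g (red v)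

/-- `x ∈ R_{k_E}(K)` is the reduction of `ϑ`, i.e. the class of `Λ / 𝔪_E Λ` for any `K`-stable
`𝒪_E`-lattice `Λ` (and there is such a lattice). -/
def IsReduction {E : LocalField p} {V : Type*} [AddCommGroup V] [Module E V]
    (ϑ : Representation E (unitGroup L D) V) (x : Groth L D (residueField E)) : Prop :=
  (∃ Λ, IsStableLattice ϑ Λ) ∧
    ∀ Λ, IsStableLattice ϑ Λ → ∃ A, IsLatticeReduction ϑ Λ A ∧ x = A.cls

variable (L D)

/-- The subgroup `Z I₁` of `K`, where `Z = 𝒪_L^×` and `I₁ = 1 + 𝔓_D`. -/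
def centerI1 : Subgroup (unitGroup L D) :=
  Subgroup.closure {g | (∃ z : L, ((g : Dˣ) : D) = algebraMap L D z) ∨
    MemIdealPow L 1 (((g : Dˣ) : D) - 1)}

variable {L D}

/-- A character, viewed as a one-dimensional representation. -/
def charRep {k G : Type*} [Field k] [Group G] (ψ : G →* k) : Representation k G k :=
  twist ψ (Representation.trivial k G k)

/-- `ψ` is the reduction of the central character of `ϑ`, extended to `Z I₁` by `1` on `I₁`: every
`z ∈ Z` acts through `ϑ` by a scalar in `𝒪_E` whose reduction is `ψ(z)`. -/
def IsReducedCentralChar {E : LocalField p} {V : Type*} [AddCommGroup V] [Module E V]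
    (ϑ : Representation E (unitGroup L D) V)
    (ψ : centerI1 L D →* residueField E) : Prop :=
  (∀ g : centerI1 L D, MemIdealPow L 1 ((((g : unitGroup L D) : Dˣ) : D) - 1) → ψ g = 1) ∧
  ∀ g : centerI1 L D, (∃ z : L, (((g : unitGroup L D) : Dˣ) : D) = algebraMap L D z) →
    ∃ a : integers E, (∀ v : V, ϑ (g : unitGroup L D) v = (a : E) • v) ∧
      ψ g = IsLocalRing.residue (integers E) a

end Quaternion

end LocalType

end

noncomputable section

namespace LocalType

/-! ### Discreteness of the absolute value and finiteness of the residue field -/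

variable {p : ℕ} [Fact p.Prime]

/-! Write `q` for `resCard L`, `U^i` for the congruence subgroups `unitFiltration L D i` of `K =
𝒪_D^×`, and `𝔓` for the maximal ideal of `𝒪_D`.

Let `π` be the representation of `D^×` attached to `w`. The two ε-factors of a twist are monomials
in `q ^ (1/2 - s)`, and only their degrees matter. Since `n(ψ_D) = 2 n(ψ_L) + 1`, a twist of Artin
conductor `2m + 1` corresponds to a twist of `π` of level exactly `2m`. So the twist of `π` is
trivial on `U^(2m)` and, `π` being irreducible under `D^×`, has no nonzero vector fixed by
`U^(2m-1)` (`exists_twist_level`).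

The quotient `U^m / U^(2m)` is abelian. An eigencharacter of it has the form `1 + x ↦ ψ_D(α x)`,
where `α` has valuation `-n(ψ_D) - 2m`. This number is odd, so `α` is a uniformizer `β` of `D` times
a central element. The stabilizer of the eigencharacter lies in the group `J` of the `g` commuting
with `β` modulo `𝔓^(m+1)`, and `J` is the product of `U^m` and the centralizer of `β` in `K`. That
centralizer is commutative, so `J` preserves a line of eigenvectors (`exists_eigenvector`). By
Clifford theory `ϑ` is, over `ℚ̄_p`, induced from a character of `J`. As `J` has index `q^(m-1)` in
`Z I₁` and `Z I₁` has index `q + 1` in `K`, the dimension follows.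

Let `τ ∈ K` lift a generator of `k_D^×`, chosen so that `τ^(q+1)` is central up to a subgroup acting
trivially; it then acts by a scalar `c`. Multiplication by `τ` permutes cyclically the cosets of `Z
I₁`, so the charpoly of `ϑ(τ)` is `(X^(q+1) - c)^(q^(m-1))` (`finrank_and_charpoly_of_level`).

In characteristic `p` the pro-`p` group `U^1` acts trivially on irreducible representations, and `K
/ U^1 = k_D^×` is generated by the image of `τ`. Hence a class in `R_k(K)` is determined by the
charpoly of `τ` (`SmoothRep.cls_eq_nsmul`). On the representation induced from `ψ` that charpoly is
`X^(q+1)` minus the residue of `c`, and charpolys are compatible with the reduction of lattices, so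
the two classes agree. -/

theorem norm_add_le_max_padicAlgCl (x y : PadicAlgCl p) : ‖x + y‖ ≤ max ‖x‖ ‖y‖ :=
  PadicAlgCl.isNonarchimedean p x y

theorem one_lt_prime_cast : (1 : ℝ) < p := by exact_mod_cast (Fact.out : p.Prime).one_lt

/-- The norm is the spectral norm, so its power by the degree falls into the discrete value group of
`ℚ_[p]`. -/
theorem norm_padicAlgCl_pow_natDegree (x : PadicAlgCl p) :
    ‖x‖ ^ (minpoly ℚ_[p] x).natDegree = ‖(minpoly ℚ_[p] x).coeff 0‖ := by
  have hpos : 0 < (minpoly ℚ_[p] x).natDegree :=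
    minpoly.natDegree_pos (Algebra.IsIntegral.isIntegral x)
  rw [← PadicAlgCl.spectralNorm_eq, spectralNorm.spectralNorm_eq_norm_coeff_zero_rpow,
    ← Real.rpow_natCast, ← Real.rpow_mul (norm_nonneg _), one_div, inv_mul_cancel₀, Real.rpow_one]
  exact_mod_cast hpos.ne'

variable (K : LocalField p) [FiniteDimensional ℚ_[p] K]

/-- The degree of each `x` divides `[K : ℚ_p]`, so a single exponent turns all norms on `K` into
powers of `p`. This is the source of discreteness. -/
theorem exists_norm_pow_finrank_eq_zpow (x : K) (hx : x ≠ 0) :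
    ∃ k : ℤ, ‖(x : PadicAlgCl p)‖ ^ Module.finrank ℚ_[p] K = (p : ℝ) ^ (-k) := by
  have hd : (minpoly ℚ_[p] (x : PadicAlgCl p)).natDegree ∣ Module.finrank ℚ_[p] K := by
    have h : minpoly ℚ_[p] (x : PadicAlgCl p) = minpoly ℚ_[p] x :=
      minpoly.algebraMap_eq (algebraMap K (PadicAlgCl p)).injective x
    rw [h]
    exact minpoly.degree_dvd (Algebra.IsIntegral.isIntegral x)
  obtain ⟨e, he⟩ := hd
  have h0 : (minpoly ℚ_[p] (x : PadicAlgCl p)).coeff 0 ≠ 0 :=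
    minpoly.coeff_zero_ne_zero (Algebra.IsIntegral.isIntegral _) (by simpa using hx)
  refine ⟨((minpoly ℚ_[p] (x : PadicAlgCl p)).coeff 0).valuation * e, ?_⟩
  rw [he, pow_mul, norm_padicAlgCl_pow_natDegree, Padic.norm_eq_zpow_neg_valuation h0,
    ← zpow_natCast, ← zpow_mul]
  congr 1
  ring

theorem norm_natCast_prime : ‖(p : PadicAlgCl p)‖ = (p : ℝ)⁻¹ := by
  have := PadicAlgCl.valuation_p p
  rw [← PadicAlgCl.valuation_coe, this]
  simp

/-- By definition `absUnif` is only a supremum. It is attained at an element for which the exponent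
of `p` in the `d`-th power of the norm is minimal. -/
theorem isGreatest_absUnif :
    IsGreatest {t : ℝ | ∃ x : K, ‖(x : PadicAlgCl p)‖ < 1 ∧ t = ‖(x : PadicAlgCl p)‖}
      (absUnif K) ∧ 0 < absUnif K := by
  classical
  set d := Module.finrank ℚ_[p] K
  have hd : 0 < d := Module.finrank_pos
  have hp := one_lt_prime_cast (p := p)
  have hex : ∃ k : ℕ, ∃ x : K, x ≠ 0 ∧ ‖(x : PadicAlgCl p)‖ < 1 ∧
      ‖(x : PadicAlgCl p)‖ ^ d = (p : ℝ) ^ (-(k : ℤ)) := by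
    -- The prime `p` has norm `p⁻¹`, with `d`-th power `p ^ (-d)`.
    refine ⟨d, (p : K), ?_, ?_, ?_⟩
    · exact_mod_cast (Fact.out : p.Prime).ne_zero
    · simpa [norm_natCast_prime] using inv_lt_one_of_one_lt₀ hp
    · simp [norm_natCast_prime]
  obtain ⟨x, hx0, hx1, hx⟩ := Nat.find_spec hex
  have hg : IsGreatest {t : ℝ | ∃ x : K, ‖(x : PadicAlgCl p)‖ < 1 ∧ t = ‖(x : PadicAlgCl p)‖}
      ‖(x : PadicAlgCl p)‖ := by
    refine ⟨⟨x, hx1, rfl⟩, ?_⟩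
    rintro t ⟨y, hy, rfl⟩
    rcases eq_or_ne y 0 with rfl | hy0
    · simp
    obtain ⟨k, hk⟩ := exists_norm_pow_finrank_eq_zpow K y hy0
    have hk0 : 0 ≤ k := by
      by_contra hneg
      push Not at hneg
      have h1 : ‖(y : PadicAlgCl p)‖ ^ d < 1 := pow_lt_one₀ (norm_nonneg _) hy hd.ne'
      rw [hk] at h1
      exact absurd h1 (not_lt.mpr (one_le_zpow₀ hp.le (by omega)))
    obtain ⟨k, rfl⟩ := Int.eq_ofNat_of_zero_le hk0
    have hle := Nat.find_min' hex ⟨y, hy0, hy, hk⟩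
    refine le_of_pow_le_pow_left₀ hd.ne' (norm_nonneg _) ?_
    rw [hx, hk]
    exact zpow_le_zpow_right₀ hp.le (by omega)
  have heq : absUnif K = ‖(x : PadicAlgCl p)‖ := hg.csSup_eq
  rw [heq]
  exact ⟨hg, by simpa using hx0⟩

theorem absUnif_pos : 0 < absUnif K := (isGreatest_absUnif K).2

theorem exists_norm_eq_absUnif : ∃ x : K, ‖(x : PadicAlgCl p)‖ = absUnif K := by
  obtain ⟨x, -, h⟩ := (isGreatest_absUnif K).1.1
  exact ⟨x, h.symm⟩

theorem absUnif_lt_one : absUnif K < 1 := by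
  obtain ⟨x, h, h'⟩ := (isGreatest_absUnif K).1.1
  rwa [h']

variable {K} in
theorem norm_le_absUnif {x : K} (hx : ‖(x : PadicAlgCl p)‖ < 1) :
    ‖(x : PadicAlgCl p)‖ ≤ absUnif K :=
  (isGreatest_absUnif K).1.2 ⟨x, hx, rfl⟩

theorem norm_zpow_of_norm_eq_absUnif {K : LocalField p} {ϖ : K}
    (hϖ : ‖(ϖ : PadicAlgCl p)‖ = absUnif K) (k : ℤ) :
    ‖((ϖ ^ k : K) : PadicAlgCl p)‖ = absUnif K ^ k := by
  rw [← hϖ, ← norm_zpow]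
  exact congrArg norm (map_zpow₀ (algebraMap K (PadicAlgCl p)) ϖ k)

variable {K} in
-- A norm strictly between two consecutive powers of `absUnif K` could be scaled by a power of a
-- uniformizer to lie strictly between `absUnif K` and `1`, against maximality.
theorem exists_norm_eq_absUnif_zpow {x : K} (hx : x ≠ 0) :
    ∃ k : ℤ, ‖(x : PadicAlgCl p)‖ = absUnif K ^ k := by
  have h0 := absUnif_pos K
  have h1 := absUnif_lt_one K
  obtain ⟨ϖ, hϖ⟩ := exists_norm_eq_absUnif K
  have hxpos : 0 < ‖(x : PadicAlgCl p)‖ := by simpa using hx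
  obtain ⟨j, hj1, hj2⟩ := exists_mem_Ico_zpow hxpos ((one_lt_inv₀ h0).mpr h1)
  refine ⟨-j, ?_⟩
  rw [inv_zpow, ← zpow_neg] at hj1 hj2
  by_contra hne
  have hlt : ‖((x * ϖ ^ (j + 1) : K) : PadicAlgCl p)‖ < 1 := by
    rw [IntermediateField.coe_mul, norm_mul, norm_zpow_of_norm_eq_absUnif hϖ]
    calc _ < absUnif K ^ (-(j + 1)) * absUnif K ^ (j + 1) := by gcongr
      _ = 1 := by rw [← zpow_add₀ h0.ne']; simp
  have hle := norm_le_absUnif hlt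
  rw [IntermediateField.coe_mul, norm_mul, norm_zpow_of_norm_eq_absUnif hϖ, zpow_add_one₀ h0.ne', ← mul_assoc] at hle
  have h2 : ‖(x : PadicAlgCl p)‖ * absUnif K ^ j ≤ 1 := by
    by_contra hcon
    push Not at hcon
    nlinarith
  have h3 : ‖(x : PadicAlgCl p)‖ ≤ absUnif K ^ (-j) := by
    rw [zpow_neg, ← one_div, le_div_iff₀ (zpow_pos h0 j)]
    exact h2
  exact hne (le_antisymm h3 hj1)

theorem mem_maximalIdeal_integers_iff (K : LocalField p) (x : integers K) :
    x ∈ IsLocalRing.maximalIdeal (integers K) ↔ ‖((x : K) : PadicAlgCl p)‖ < 1 := by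
  have hx := (mem_integers K x).mp x.2
  rw [IsLocalRing.mem_maximalIdeal, mem_nonunits_iff, lt_iff_le_and_ne, ← not_iff_not]
  simp only [not_not, not_and, ne_eq, hx, forall_const]
  constructor
  · intro h
    obtain ⟨y, hy⟩ := h.exists_right_inv
    have hy' := (mem_integers K y).mp y.2
    have h1 : ‖((x : K) : PadicAlgCl p)‖ * ‖((y : K) : PadicAlgCl p)‖ = 1 := by
      rw [← norm_mul]
      have := congrArg (fun z : integers K => ((z : K) : PadicAlgCl p)) hy
      simp only [MulMemClass.coe_mul, OneMemClass.coe_one] at this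
      rw [this, norm_one]
    nlinarith [norm_nonneg ((x : K) : PadicAlgCl p), norm_nonneg ((y : K) : PadicAlgCl p)]
  · intro h
    have hx0 : (x : K) ≠ 0 := by
      intro h0; rw [h0] at h; simp at h
    have hy : (x : K)⁻¹ ∈ integers K := by rw [mem_integers]; simp [h]
    exact IsUnit.of_mul_eq_one ⟨_, hy⟩ (Subtype.ext (mul_inv_cancel₀ hx0))

theorem residue_eq_zero_iff_norm_lt_one (K : LocalField p) (x : integers K) :
    IsLocalRing.residue (integers K) x = 0 ↔ ‖((x : K) : PadicAlgCl p)‖ < 1 := by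
  rw [IsLocalRing.residue_eq_zero_iff, mem_maximalIdeal_integers_iff]

/-- The closed unit ball of `K` is compact, and residue classes are its open balls of radius `1`. -/
instance finite_residueField : Finite (residueField K) := by
  have : ProperSpace K := FiniteDimensional.proper ℚ_[p] K
  have hc : IsCompact (Metric.closedBall (0 : K) 1) := isCompact_closedBall 0 1
  obtain ⟨t, ht, htf, hcov⟩ := hc.finite_cover_balls (e := 1) one_pos
  have hmem : ∀ x : K, x ∈ Metric.closedBall (0 : K) 1 ↔ x ∈ integers K := fun x => by
    rw [mem_integers, mem_closedBall_zero_iff]; rfl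
  have := htf.to_subtype
  refine Finite.of_surjective
    (fun y : t => IsLocalRing.residue (integers K) ⟨y, (hmem _).mp (ht y.2)⟩) ?_
  intro x
  obtain ⟨x, rfl⟩ := IsLocalRing.residue_surjective x
  obtain ⟨y, hy, hxy⟩ := Set.mem_iUnion₂.mp (hcov ((hmem x).mpr x.2))
  refine ⟨⟨y, hy⟩, ?_⟩
  rw [← sub_eq_zero, ← map_sub, residue_eq_zero_iff_norm_lt_one]
  rw [Metric.mem_ball, dist_comm, dist_eq_norm] at hxy
  exact hxy

theorem one_lt_resCard : 1 < resCard K := Finite.one_lt_card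

instance charP_residueField : CharP (residueField K) p := by
  have : ((p : ℕ) : residueField K) = 0 := by
    have h : ((p : ℕ) : residueField K) = IsLocalRing.residue (integers K) (p : integers K) := by
      simp
    rw [h, residue_eq_zero_iff_norm_lt_one]
    have := norm_natCast_prime (p := p)
    simpa [this] using inv_lt_one_of_one_lt₀ (one_lt_prime_cast (p := p))
  exact (CharP.charP_iff_prime_eq_zero Fact.out).mpr this

theorem exists_resCard_eq_pow : ∃ f : ℕ, 0 < f ∧ resCard K = p ^ f := by
  let _ := Fintype.ofFinite (residueField K)
  obtain ⟨n, -, h⟩ := FiniteField.card (residueField K) p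
  exact ⟨n, n.2, by rw [resCard, Nat.card_eq_fintype_card, h]⟩

/-- Discreteness of the norm gives the factorisation by powers of a uniformizer. Principality makes
stable lattices free later on. -/
instance isDiscreteValuationRing_integers : IsDiscreteValuationRing (integers K) := by
  obtain ⟨ϖ, hϖ⟩ := exists_norm_eq_absUnif K
  have h0 := absUnif_pos K
  have h1 := absUnif_lt_one K
  have hm : ϖ ∈ integers K := by rw [mem_integers, hϖ]; exact h1.le
  have hassoc : ∀ x : integers K, x ≠ 0 → ∃ n : ℕ, Associated ((⟨ϖ, hm⟩ : integers K) ^ n) x := by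
    intro x hx
    have hx0 : (x : K) ≠ 0 := by simpa using hx
    obtain ⟨k, hk⟩ := exists_norm_eq_absUnif_zpow hx0
    have hk0 : 0 ≤ k := by
      by_contra hneg
      push Not at hneg
      have h2 := (mem_integers K x).mp x.2
      rw [hk] at h2
      exact absurd h2 (not_le.mpr (one_lt_zpow_of_neg₀ h0 h1 hneg))
    obtain ⟨k, rfl⟩ := Int.eq_ofNat_of_zero_le hk0
    have hϖ0 : ϖ ≠ 0 := by
      intro h; rw [h] at hϖ; simp at hϖ; exact h0.ne hϖ
    have hy : (x : K) / ϖ ^ k ∈ integers K := by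
      rw [mem_integers]; push_cast; rw [norm_div, norm_pow, hϖ, hk]
      rw [zpow_natCast, div_self (pow_ne_zero _ h0.ne')]
    have hu : IsUnit (⟨_, hy⟩ : integers K) := by
      by_contra hnu
      have := (mem_maximalIdeal_integers_iff K ⟨_, hy⟩).mp
        ((IsLocalRing.mem_maximalIdeal _).mpr hnu)
      push_cast at this
      rw [norm_div, norm_pow, hϖ, hk, zpow_natCast,
        div_self (pow_ne_zero _ h0.ne')] at this
      exact lt_irrefl _ this
    refine ⟨k, hu.unit, Subtype.ext ?_⟩
    change ϖ ^ k * ((x : K) / ϖ ^ k) = x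
    field_simp
  refine IsDiscreteValuationRing.ofHasUnitMulPowIrreducibleFactorization ⟨⟨ϖ, hm⟩, ?_, ?_⟩
  · refine ⟨fun hu => ?_, ?_⟩
    · have : (⟨ϖ, hm⟩ : integers K) ∈ IsLocalRing.maximalIdeal (integers K) := by
        rw [mem_maximalIdeal_integers_iff, hϖ]; exact h1
      exact (IsLocalRing.mem_maximalIdeal _).mp this hu
    · rintro a b hab
      by_contra hcon
      push Not at hcon
      have ha := norm_le_absUnif ((mem_maximalIdeal_integers_iff K a).mp
        ((IsLocalRing.mem_maximalIdeal _).mpr hcon.1))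
      have hb := norm_le_absUnif ((mem_maximalIdeal_integers_iff K b).mp
        ((IsLocalRing.mem_maximalIdeal _).mpr hcon.2))
      have h2 : absUnif K = ‖((a : K) : PadicAlgCl p)‖ * ‖((b : K) : PadicAlgCl p)‖ := by
        rw [← hϖ, ← norm_mul]
        have := congrArg (fun z : integers K => ((z : K) : PadicAlgCl p)) hab
        simpa using congrArg norm this
      nlinarith [norm_nonneg ((a : K) : PadicAlgCl p), norm_nonneg ((b : K) : PadicAlgCl p)]
  · intro x hx
    exact hassoc x hx

/-! ### Minimal polynomials in a four-dimensional central division algebra -/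

section Algebra

variable {F D : Type*} [Field F] [DivisionRing D] [Algebra F D]

/-- The homomorphism `F[X] / (μ) → D` sending `X` to `x`, where `μ` is the minimal polynomial. -/
def adjoinRootMinpolyHom (x : D) : AdjoinRoot (minpoly F x) →ₐ[F] D :=
  Ideal.Quotient.liftₐ _ (Polynomial.aeval x) (by
    intro a ha
    obtain ⟨b, rfl⟩ := Ideal.mem_span_singleton.mp ha
    simp)

theorem adjoinRootMinpolyHom_root (x : D) :
    adjoinRootMinpolyHom (F := F) x (AdjoinRoot.root (minpoly F x)) = x := by
  exact Polynomial.aeval_X (R := F) x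

theorem exists_not_commute [Algebra.IsCentral F D] (x : D)
    (hx : x ∉ Set.range (algebraMap F D)) : ∃ y : D, y * x ≠ x * y := by
  by_contra hcon
  push Not at hcon
  have := Algebra.IsCentral.out (K := F) (D := D) (Subalgebra.mem_center_iff.mpr hcon)
  exact hx (Algebra.mem_bot.mp this)

/-- Left multiplication makes `D` a vector space over the field `S = F[x]`, so the degree of `x`
divides `4`. Once it is `2`, `D` is `S × S` over `S`, and multiplication by `x` is two copies of
multiplication on `S`: trace doubles and norm squares. -/
theorem minpoly_trace_norm_of_not_mem_range [Algebra.IsCentral F D]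
    (hD : Module.finrank F D = 4) (x : D) (hx : x ∉ Set.range (algebraMap F D)) :
    (minpoly F x).natDegree = 2 ∧
    LinearMap.trace F D (LinearMap.mulLeft F x) = -2 * (minpoly F x).coeff 1 ∧
    Algebra.norm F x = (minpoly F x).coeff 0 ^ 2 := by
  have : FiniteDimensional F D := FiniteDimensional.of_finrank_pos (by omega)
  have hint : IsIntegral F x := Algebra.IsIntegral.isIntegral x
  have hirr : Irreducible (minpoly F x) := minpoly.irreducible hint
  have : Fact (Irreducible (minpoly F x)) := ⟨hirr⟩
  set S := AdjoinRoot (minpoly F x)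
  let φ : S →ₐ[F] D := adjoinRootMinpolyHom x
  let _ : Module S D := Module.compHom D φ.toRingHom
  have hsmul : ∀ (s : S) (d : D), s • d = φ s * d := fun s d => rfl
  have : IsScalarTower F S D := ⟨fun a s d => by
    rw [hsmul, hsmul, map_smul, smul_mul_assoc]⟩
  have hroot : φ (AdjoinRoot.root (minpoly F x)) = x := adjoinRootMinpolyHom_root x
  let pb := AdjoinRoot.powerBasis (minpoly.ne_zero hint)
  have hmin : minpoly F pb.gen = minpoly F x :=
    AdjoinRoot.minpoly_powerBasis_gen_of_monic (minpoly.monic hint)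
  have hfin : Module.Finite F S := pb.finite
  have hS : Module.finrank F S = (minpoly F x).natDegree := pb.finrank
  have hmul : (minpoly F x).natDegree * Module.finrank S D = 4 := by
    rw [← hS, ← hD, Module.finrank_mul_finrank]
  have hne1 : (minpoly F x).natDegree ≠ 1 := by
    intro h1
    exact hx (minpoly.natDegree_eq_one_iff.mp h1)
  have hfinS : Module.Finite S D := Module.Finite.of_restrictScalars_finite F S D
  -- Otherwise `D` is the image of `S`, and every element commutes with `x`.
  have hne4 : (minpoly F x).natDegree ≠ 4 := by
    intro h4
    have h1 : Module.finrank S D = 1 := by rw [h4] at hmul; omega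
    obtain ⟨y, hy⟩ := exists_not_commute (F := F) x hx
    obtain ⟨c, hc⟩ := (finrank_eq_one_iff_of_nonzero' (1 : D) one_ne_zero).mp h1 y
    apply hy
    rw [hsmul, mul_one] at hc
    have h3 : φ c * φ (AdjoinRoot.root (minpoly F x)) = φ (AdjoinRoot.root (minpoly F x)) * φ c := by
      rw [← map_mul, ← map_mul, mul_comm]
    rwa [hroot, hc] at h3
  have h2 : (minpoly F x).natDegree = 2 := by
    have hdvd : (minpoly F x).natDegree ∣ 4 := ⟨_, hmul.symm⟩
    have hle := Nat.le_of_dvd (by norm_num) hdvd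
    interval_cases (minpoly F x).natDegree <;> omega
  have hrk : Module.finrank S D = Module.finrank S (S × S) := by
    rw [Module.finrank_prod, Module.finrank_self]; rw [h2] at hmul; omega
  let e : D ≃ₗ[F] S × S := (LinearEquiv.ofFinrankEq D (S × S) hrk).restrictScalars F
  have hconj : e.conj (LinearMap.mulLeft F x) =
      (LinearMap.mulLeft F pb.gen).prodMap (LinearMap.mulLeft F pb.gen) := by
    apply LinearMap.ext
    intro z
    have h3 : x * e.symm z = pb.gen • e.symm z := by
      rw [hsmul]; congr 1; exact hroot.symm
    rw [LinearEquiv.conj_apply_apply, LinearMap.mulLeft_apply, h3]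
    change (LinearEquiv.ofFinrankEq D (S × S) hrk) (pb.gen • _) = _
    rw [map_smul]
    change pb.gen • e (e.symm z) = _
    rw [LinearEquiv.apply_symm_apply]
    rfl
  have hdim : pb.dim = 2 := by rw [← h2]; rfl
  refine ⟨h2, ?_, ?_⟩
  · rw [← LinearMap.trace_conj' _ e, hconj, LinearMap.trace_prodMap']
    have h4 : LinearMap.trace F S (LinearMap.mulLeft F pb.gen) = -(minpoly F x).coeff 1 := by
      have h5 := PowerBasis.trace_gen_eq_nextCoeff_minpoly pb
      rw [hmin, Polynomial.nextCoeff_of_natDegree_pos (by omega), h2] at h5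
      exact h5
    rw [h4]; ring
  · rw [Algebra.norm_apply]
    have h6 : LinearMap.det (e.conj (LinearMap.mulLeft F x)) =
        LinearMap.det (LinearMap.mulLeft F x) := by
      rw [LinearEquiv.conj_apply, LinearMap.comp_assoc]
      exact LinearMap.det_conj (LinearMap.mulLeft F x) e
    change LinearMap.det (LinearMap.mulLeft F x) = _
    rw [← h6, hconj, LinearMap.det_prodMap]
    have h7 : LinearMap.det (LinearMap.mulLeft F pb.gen) = (minpoly F x).coeff 0 := by
      have h8 := Algebra.PowerBasis.norm_gen_eq_coeff_zero_minpoly pb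
      rw [hmin, hdim] at h8
      rw [Algebra.norm_apply] at h8
      rwa [neg_one_sq, one_mul] at h8
    rw [h7, sq]

end Algebra

/-! ### Reduced trace, reduced norm and the canonical involution -/

section Quaternion

variable {p : ℕ} [Fact p.Prime] {L : LocalField p}
  {D : Type*} [DivisionRing D] [Algebra L D]

theorem redTrace_add (x y : D) : redTrace L (x + y) = redTrace L x + redTrace L y := by
  simp only [redTrace]
  rw [← add_div, ← map_add]
  congr 2
  ext; simp [add_mul]

theorem redTrace_smul (a : L) (x : D) : redTrace L (a • x) = a * redTrace L x := by
  simp only [redTrace]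
  rw [← mul_div_assoc, ← smul_eq_mul a (LinearMap.trace _ _ _), ← map_smul]
  congr 2
  ext; simp

variable (L D) in
/-- The reduced trace as a linear form. -/
def redTraceLin : D →ₗ[L] L where
  toFun := redTrace L
  map_add' := redTrace_add
  map_smul' a x := by simp [redTrace_smul]

theorem redTrace_mul_comm (x y : D) : redTrace L (x * y) = redTrace L (y * x) := by
  simp only [redTrace]
  rw [LinearMap.mulLeft_mul, LinearMap.mulLeft_mul]
  congr 1
  exact LinearMap.trace_mul_comm L (LinearMap.mulLeft L x) (LinearMap.mulLeft L y)

theorem redTrace_algebraMap (hD : Module.finrank L D = 4) (a : L) :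
    redTrace L (algebraMap L D a) = 2 * a := by
  have h : LinearMap.mulLeft L (algebraMap L D a) = a • LinearMap.id := by
    ext y; simp [Algebra.smul_def]
  have : FiniteDimensional L D := FiniteDimensional.of_finrank_pos (by omega)
  rw [redTrace, h, map_smul, LinearMap.trace_id, hD, smul_eq_mul]
  push_cast
  ring

theorem redNorm_algebraMap (a : L) : redNorm L (algebraMap L D a) = a ^ 2 := by
  rw [redNorm, minpoly.eq_X_sub_C]
  simp

theorem norm_algebraMap_eq (hD : Module.finrank L D = 4) (a : L) :
    Algebra.norm L (algebraMap L D a) = a ^ 4 := by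
  rw [Algebra.norm_algebraMap, hD]

variable [Algebra.IsCentral L D]

theorem norm_eq_redNorm_sq (hD : Module.finrank L D = 4) (x : D) :
    Algebra.norm L x = redNorm L x ^ 2 := by
  by_cases hx : x ∈ Set.range (algebraMap L D)
  · obtain ⟨a, rfl⟩ := hx
    rw [norm_algebraMap_eq hD, redNorm_algebraMap]; ring
  · obtain ⟨h2, -, h⟩ := minpoly_trace_norm_of_not_mem_range hD x hx
    rw [h, redNorm, h2]; norm_num

theorem redTrace_of_not_mem_range (hD : Module.finrank L D = 4) (x : D)
    (hx : x ∉ Set.range (algebraMap L D)) : redTrace L x = -(minpoly L x).coeff 1 := by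
  obtain ⟨-, h, -⟩ := minpoly_trace_norm_of_not_mem_range hD x hx
  rw [redTrace, h]; ring

theorem redNorm_of_not_mem_range (hD : Module.finrank L D = 4) (x : D)
    (hx : x ∉ Set.range (algebraMap L D)) : redNorm L x = (minpoly L x).coeff 0 := by
  obtain ⟨h, -, -⟩ := minpoly_trace_norm_of_not_mem_range hD x hx
  rw [redNorm, h]; norm_num

theorem minpoly_of_not_mem_range (hD : Module.finrank L D = 4) (x : D)
    (hx : x ∉ Set.range (algebraMap L D)) :
    minpoly L x = Polynomial.X ^ 2 - Polynomial.C (redTrace L x) * Polynomial.X +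
      Polynomial.C (redNorm L x) := by
  have : FiniteDimensional L D := FiniteDimensional.of_finrank_pos (by omega)
  obtain ⟨h2, -, -⟩ := minpoly_trace_norm_of_not_mem_range hD x hx
  have hm := minpoly.monic (A := L) (Algebra.IsIntegral.isIntegral (R := L) x)
  rw [redTrace_of_not_mem_range hD x hx, redNorm_of_not_mem_range hD x hx]
  have h3 := Polynomial.as_sum_range_C_mul_X_pow (minpoly L x)
  have h4 : (minpoly L x).coeff 2 = 1 := by rw [← h2]; exact hm
  rw [h2] at h3
  simp only [Finset.sum_range_succ, Finset.sum_range_zero, h4] at h3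
  conv_lhs => rw [h3]
  simp
  ring

theorem mul_self_eq (hD : Module.finrank L D = 4) (x : D) :
    x * x = redTrace L x • x - algebraMap L D (redNorm L x) := by
  by_cases hx : x ∈ Set.range (algebraMap L D)
  · obtain ⟨a, rfl⟩ := hx
    rw [redTrace_algebraMap hD, redNorm_algebraMap, Algebra.smul_def, ← map_mul, ← map_mul,
      ← map_sub]
    congr 1; ring
  · have h := minpoly.aeval L x
    rw [minpoly_of_not_mem_range hD x hx] at h
    simp only [map_add, map_sub, map_mul, map_pow, Polynomial.aeval_X, Polynomial.aeval_C] at h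
    rw [Algebra.smul_def, ← sub_eq_zero, ← h, sq]
    abel

/-- The canonical involution. -/
def quatConj (x : D) : D := algebraMap L D (redTrace L x) - x

theorem mul_quatConj (hD : Module.finrank L D = 4) (x : D) :
    x * quatConj (L := L) x = algebraMap L D (redNorm L x) := by
  rw [quatConj, mul_sub, mul_self_eq hD, ← Algebra.commutes, Algebra.smul_def]; abel

/-- Polarise the quadratic equation satisfied by `x + y`. The scalar that remains is identified by
taking reduced traces, with `2` invertible. -/
theorem mul_add_mul_swap (hD : Module.finrank L D = 4) (x y : D) :
    x * y + y * x = redTrace L y • x + redTrace L x • y +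
      algebraMap L D (redTrace L (x * y) - redTrace L x * redTrace L y) := by
  have h1 := mul_self_eq hD (x + y)
  rw [redTrace_add, add_mul, mul_add, mul_add, mul_self_eq hD x, mul_self_eq hD y] at h1
  set s := redNorm L x + redNorm L y - redNorm L (x + y) with hs
  have h2 : x * y + y * x = redTrace L y • x + redTrace L x • y + algebraMap L D s := by
    rw [hs, map_sub, map_add]
    have h3 := sub_eq_zero.mpr h1
    rw [← sub_eq_zero, ← h3]
    simp only [smul_add, add_smul]
    abel
  have h3 := congrArg (redTrace L) h2
  simp only [redTrace_add, redTrace_smul, redTrace_algebraMap hD, redTrace_mul_comm y x] at h3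
  have h4 : s = redTrace L (x * y) - redTrace L x * redTrace L y := by
    linear_combination -h3 / 2
  rw [← h4, h2]

theorem quatConj_mul (hD : Module.finrank L D = 4) (x y : D) :
    quatConj (L := L) (x * y) = quatConj (L := L) y * quatConj (L := L) x := by
  have h := mul_add_mul_swap hD x y
  simp only [quatConj]
  have h2 : (algebraMap L D (redTrace L y) - y) * (algebraMap L D (redTrace L x) - x) =
      algebraMap L D (redTrace L x * redTrace L y) - redTrace L y • x - redTrace L x • y
        + y * x := by
    rw [sub_mul, mul_sub, mul_sub, ← map_mul, ← Algebra.commutes _ y, ← Algebra.smul_def,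
      ← Algebra.smul_def, mul_comm (redTrace L y)]
    abel
  rw [h2]
  have h3 : y * x = redTrace L y • x + redTrace L x • y +
      algebraMap L D (redTrace L (x * y) - redTrace L x * redTrace L y) - x * y := by
    rw [← h]; abel
  rw [h3, map_sub]
  abel

/-- The definition through minimal polynomials hides multiplicativity. It comes from the involution:
the product of `x * y` with its conjugate is `x` times the scalar `redNorm L y` times the conjugate
of `x`. -/
theorem redNorm_mul (hD : Module.finrank L D = 4) (x y : D) :
    redNorm L (x * y) = redNorm L x * redNorm L y := by
  apply (algebraMap L D).injective
  rw [← mul_quatConj hD, quatConj_mul hD, mul_assoc, ← mul_assoc y, mul_quatConj hD,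
    Algebra.commutes, ← mul_assoc, mul_quatConj hD, map_mul]

theorem redNorm_one : redNorm L (1 : D) = 1 := by
  have := redNorm_algebraMap (D := D) (1 : L); simpa using this

theorem redNorm_ne_zero (hD : Module.finrank L D = 4) {x : D} (hx : x ≠ 0) :
    redNorm L x ≠ 0 := by
  intro h
  have := redNorm_mul hD x x⁻¹
  rw [mul_inv_cancel₀ hx, redNorm_one, h, zero_mul] at this
  exact one_ne_zero this

theorem redNorm_add (hD : Module.finrank L D = 4) (x y : D) :
    redNorm L (x + y) = redNorm L x + redNorm L y +
      (redTrace L x * redTrace L y - redTrace L (x * y)) := by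
  apply (algebraMap L D).injective
  have h1 := mul_self_eq hD (x + y)
  rw [redTrace_add, add_mul, mul_add, mul_add, mul_self_eq hD x, mul_self_eq hD y] at h1
  have h2 := mul_add_mul_swap hD x y
  have h3 : algebraMap L D (redNorm L (x + y)) = (redTrace L x + redTrace L y) • (x + y) -
      (redTrace L x • x - algebraMap L D (redNorm L x) +
      (redTrace L y • y - algebraMap L D (redNorm L y)) + (x * y + y * x)) := by
    rw [eq_sub_iff_add_eq, eq_comm, ← sub_eq_iff_eq_add', ← h1]; abel
  rw [h3, h2]
  simp only [map_add, map_sub, add_smul, smul_add]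
  abel

end Quaternion

/-! ### The absolute value of `D` and the powers of its maximal ideal -/

section Quaternion

variable {p : ℕ} [Fact p.Prime] {L : LocalField p}
  {D : Type*} [DivisionRing D] [Algebra L D]

variable (L) in
/-- The square root of `quatAbs`: the absolute value of the reduced norm. -/
def qabs (x : D) : ℝ := ‖((redNorm L x : L) : PadicAlgCl p)‖

theorem qabs_nonneg (x : D) : 0 ≤ qabs L x := norm_nonneg _

theorem qabs_one : qabs L (1 : D) = 1 := by
  have := redNorm_algebraMap (D := D) (1 : L)
  rw [map_one, one_pow] at this
  simp [qabs, this]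

theorem qabs_algebraMap (a : L) : qabs L (algebraMap L D a) = ‖(a : PadicAlgCl p)‖ ^ 2 := by
  simp [qabs, redNorm_algebraMap]

theorem qabs_zero : qabs L (0 : D) = 0 := by
  have := qabs_algebraMap (D := D) (0 : L)
  simpa using this

variable [Algebra.IsCentral L D] [hD : Fact (Module.finrank L D = 4)]

theorem quatAbs_eq_qabs_sq (x : D) : quatAbs L x = qabs L x ^ 2 := by
  rw [quatAbs, norm_eq_redNorm_sq hD.out, qabs]
  simp

theorem qabs_mul (x y : D) : qabs L (x * y) = qabs L x * qabs L y := by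
  simp [qabs, redNorm_mul hD.out]

theorem qabs_eq_zero_iff {x : D} : qabs L x = 0 ↔ x = 0 := by
  refine ⟨fun h => ?_, fun h => by rw [h, qabs_zero]⟩
  by_contra hx
  exact redNorm_ne_zero (L := L) hD.out hx (by simpa [qabs] using h)

theorem qabs_pos {x : D} (hx : x ≠ 0) : 0 < qabs L x :=
  lt_of_le_of_ne (qabs_nonneg x) fun h => hx (qabs_eq_zero_iff.mp h.symm)

theorem qabs_inv (x : D) : qabs L x⁻¹ = (qabs L x)⁻¹ := by
  rcases eq_or_ne x 0 with rfl | hx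
  · simp [qabs_zero]
  · apply eq_inv_of_mul_eq_one_left
    rw [← qabs_mul, inv_mul_cancel₀ hx, qabs_one]

theorem qabs_pow (x : D) (n : ℕ) : qabs L (x ^ n) = qabs L x ^ n := by
  induction n with
  | zero => simp [qabs_one]
  | succ n ih => rw [pow_succ, qabs_mul, ih, pow_succ]

theorem qabs_zpow (x : D) (n : ℤ) : qabs L (x ^ n) = qabs L x ^ n := by
  cases n with
  | ofNat n => simpa using qabs_pow x n
  | negSucc n => rw [zpow_negSucc, qabs_inv, qabs_pow, zpow_negSucc]

theorem qabs_neg (x : D) : qabs L (-x) = qabs L x := by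
  have h : qabs L (-1 : D) = 1 := by
    have := qabs_algebraMap (D := D) (-1 : L)
    simpa using this
  rw [neg_eq_neg_one_mul, qabs_mul, h, one_mul]

/-- The roots of the reduced characteristic polynomial. -/
theorem exists_roots_redCharpoly (x : D) : ∃ y y' : PadicAlgCl p,
    (∀ c : L, ‖(c : PadicAlgCl p) + y‖ = ‖(c : PadicAlgCl p) + y'‖) ∧
    y + y' = redTrace L x ∧ y * y' = redNorm L x := by
  by_cases hx : x ∈ Set.range (algebraMap L D)
  · obtain ⟨a, rfl⟩ := hx
    refine ⟨a, a, fun _ => rfl, ?_, ?_⟩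
    · rw [redTrace_algebraMap hD.out, two_mul]; rfl
    · rw [redNorm_algebraMap, sq]; rfl
  · have : FiniteDimensional L D := FiniteDimensional.of_finrank_pos (by rw [hD.out]; norm_num)
    have hint : IsIntegral L x := Algebra.IsIntegral.isIntegral x
    have hirr := minpoly.irreducible hint
    have hmon := minpoly.monic hint
    have hmin := minpoly_of_not_mem_range hD.out x hx
    obtain ⟨y, hy⟩ := IsAlgClosed.exists_aeval_eq_zero (PadicAlgCl p) (minpoly L x)
      (Polynomial.degree_pos_of_irreducible hirr).ne'
    rw [hmin] at hy
    simp only [map_add, map_sub, map_mul, map_pow, Polynomial.aeval_X, Polynomial.aeval_C,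
      IntermediateField.algebraMap_apply] at hy
    have hy0 : Polynomial.aeval y (minpoly L x) = 0 := by
      rw [hmin]
      simpa only [map_add, map_sub, map_mul, map_pow, Polynomial.aeval_X, Polynomial.aeval_C,
        IntermediateField.algebraMap_apply] using hy
    have hy' : Polynomial.aeval ((redTrace L x : PadicAlgCl p) - y) (minpoly L x) = 0 := by
      rw [hmin]
      simp only [map_add, map_sub, map_mul, map_pow, Polynomial.aeval_X, Polynomial.aeval_C,
        IntermediateField.algebraMap_apply]
      linear_combination hy
    have hmin' : minpoly L x = minpoly L y := minpoly.eq_of_irreducible_of_monic hirr hy0 hmon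
    rw [hmin'] at hy'
    -- The second root is conjugate to the first over `L`, hence so are their translates by `c ∈ L`,
    -- and conjugation preserves the norm.
    obtain ⟨σ, hσ⟩ := (isConjRoot_of_aeval_eq_zero
      (Algebra.IsIntegral.isIntegral (R := L) y) hy').exists_algEquiv
    refine ⟨y, redTrace L x - y, fun c => ?_, by ring, by linear_combination -hy⟩
    have h1 : σ ((c : PadicAlgCl p) + (redTrace L x - y)) = c + y := by
      rw [map_add, hσ]
      congr 1
      exact σ.commutes c
    rw [← h1]
    exact norm_galois (σ.restrictScalars ℚ_[p]) _

/-- If `y` and `y'` are the roots of the reduced characteristic polynomial of `x`, then `1 + x` has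
reduced norm `(1 + y)(1 + y')`, whose factors have equal norm. The inequality thus reduces to the
ultrametric one for `1 + y`. -/
theorem qabs_one_add_le (x : D) : qabs L (1 + x) ≤ max 1 (qabs L x) := by
  obtain ⟨y, y', h, ht, hn⟩ := exists_roots_redCharpoly (L := L) x
  have h0 := h 0
  have h1 := h 1
  simp only [ZeroMemClass.coe_zero, zero_add, OneMemClass.coe_one] at h0 h1
  have e1 : qabs L x = ‖y‖ ^ 2 := by rw [qabs, ← hn, norm_mul, ← h0, sq]
  have e2 : qabs L (1 + x) = ‖1 + y‖ ^ 2 := by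
    have ht1 : redTrace L (1 : D) = 2 := by
      have := redTrace_algebraMap (D := D) hD.out (1 : L)
      simpa using this
    have : ((redNorm L (1 + x) : L) : PadicAlgCl p) = (1 + y) * (1 + y') := by
      rw [redNorm_add hD.out, redNorm_one, ht1, one_mul]
      have : (1 : L) + redNorm L x + (2 * redTrace L x - redTrace L x) =
        1 + redNorm L x + redTrace L x := by ring
      rw [this]
      change (1 : PadicAlgCl p) + redNorm L x + redTrace L x = _
      rw [← ht, ← hn]; ring
    rw [qabs, this, norm_mul, ← h1, sq]
  rw [e1, e2]
  have h3 := norm_add_le_max_padicAlgCl (1 : PadicAlgCl p) y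
  rw [norm_one] at h3
  rcases le_max_iff.mp h3 with h4 | h4
  · exact le_max_of_le_left (pow_le_one₀ (norm_nonneg _) h4)
  · exact le_max_of_le_right (by gcongr)

/-- The trace is the sum of two roots, the square of whose common norm is `qabs L x`. -/
theorem norm_redTrace_sq_le (x : D) : ‖(redTrace L x : PadicAlgCl p)‖ ^ 2 ≤ qabs L x := by
  obtain ⟨y, y', h, ht, hn⟩ := exists_roots_redCharpoly (L := L) x
  have h0 := h 0
  simp only [ZeroMemClass.coe_zero, zero_add] at h0
  have e1 : qabs L x = ‖y‖ ^ 2 := by rw [qabs, ← hn, norm_mul, ← h0, sq]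
  rw [e1, ← ht]
  have h3 := norm_add_le_max_padicAlgCl y y'
  rw [← h0, max_self] at h3
  gcongr

theorem qabs_add_le (x y : D) : qabs L (x + y) ≤ max (qabs L x) (qabs L y) := by
  rcases eq_or_ne x 0 with rfl | hx
  · simp
  have h : x + y = x * (1 + x⁻¹ * y) := by rw [mul_add, mul_one, mul_inv_cancel_left₀ hx]
  rw [h, qabs_mul]
  have h2 := qabs_one_add_le (L := L) (x⁻¹ * y)
  have hxp := qabs_pos (L := L) hx
  calc _ ≤ qabs L x * max 1 (qabs L (x⁻¹ * y)) := by gcongr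
    _ = _ := by
      rw [mul_max_of_nonneg _ _ hxp.le, mul_one, ← qabs_mul, mul_inv_cancel_left₀ hx]

theorem qabs_sub_le (x y : D) : qabs L (x - y) ≤ max (qabs L x) (qabs L y) := by
  rw [sub_eq_add_neg, ← qabs_neg y]; exact qabs_add_le x (-y)

theorem qabs_sub_comm (x y : D) : qabs L (x - y) = qabs L (y - x) := by
  rw [← qabs_neg, neg_sub]

theorem qabs_eq_of_sub_lt {x y : D} (h : qabs L (x - y) < qabs L y) : qabs L x = qabs L y := by
  apply le_antisymm
  · calc qabs L x = qabs L ((x - y) + y) := by rw [sub_add_cancel]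
      _ ≤ _ := qabs_add_le _ _
      _ = _ := max_eq_right h.le
  · by_contra hlt
    push Not at hlt
    have : qabs L y ≤ max (qabs L x) (qabs L (x - y)) := by
      calc qabs L y = qabs L (x - (x - y)) := by rw [sub_sub_cancel]
        _ ≤ _ := qabs_sub_le _ _
    exact absurd (max_lt hlt h) (not_lt.mpr this)

variable [FiniteDimensional ℚ_[p] L]

/-- Normalisation: in `qabs` a uniformizer of `D` has value `absUnif L` and a uniformizer of `L` has
its square. -/
theorem memIdealPow_iff {n : ℤ} {x : D} : MemIdealPow L n x ↔ qabs L x ≤ absUnif L ^ n := by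
  have h0 := zpow_pos (absUnif_pos L) n
  rw [MemIdealPow, quatAbs_eq_qabs_sq, mul_comm 2 n, zpow_mul]
  exact pow_le_pow_iff_left₀ (qabs_nonneg x) h0.le two_ne_zero

theorem exists_qabs_eq_zpow {x : D} (hx : x ≠ 0) : ∃ k : ℤ, qabs L x = absUnif L ^ k :=
  exists_norm_eq_absUnif_zpow (redNorm_ne_zero hD.out hx)

theorem absUnif_zpow_lt_iff {m n : ℤ} : absUnif L ^ m < absUnif L ^ n ↔ n < m :=
  zpow_lt_zpow_iff_right_of_lt_one₀ (absUnif_pos L) (absUnif_lt_one L)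

theorem absUnif_zpow_le_iff {m n : ℤ} : absUnif L ^ m ≤ absUnif L ^ n ↔ n ≤ m :=
  zpow_le_zpow_iff_right_of_lt_one₀ (absUnif_pos L) (absUnif_lt_one L)

theorem absUnif_zpow_inj {m n : ℤ} : absUnif L ^ m = absUnif L ^ n ↔ m = n := by
  refine ⟨fun h => le_antisymm (absUnif_zpow_le_iff.mp h.ge) (absUnif_zpow_le_iff.mp h.le),
    fun h => by rw [h]⟩

/-- An element of absolute value less than that of a generator of `𝔓 ^ n` lies in `𝔓 ^ (n + 1)`. -/
theorem memIdealPow_succ_iff_lt {n : ℤ} {x : D} :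
    MemIdealPow L (n + 1) x ↔ qabs L x < absUnif L ^ n := by
  rw [memIdealPow_iff]
  rcases eq_or_ne x 0 with rfl | hx
  · rw [qabs_zero]
    exact iff_of_true (zpow_pos (absUnif_pos L) _).le (zpow_pos (absUnif_pos L) _)
  · obtain ⟨k, hk⟩ := exists_qabs_eq_zpow (L := L) hx
    rw [hk, absUnif_zpow_lt_iff, absUnif_zpow_le_iff]; omega

theorem memIdealPow_zero {n : ℤ} : MemIdealPow L n (0 : D) := by
  rw [memIdealPow_iff, qabs_zero]; exact (zpow_pos (absUnif_pos L) _).le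

theorem MemIdealPow.add {n : ℤ} {x y : D} (hx : MemIdealPow L n x) (hy : MemIdealPow L n y) :
    MemIdealPow L n (x + y) := by
  rw [memIdealPow_iff] at *
  exact (qabs_add_le x y).trans (max_le hx hy)

theorem MemIdealPow.neg {n : ℤ} {x : D} (hx : MemIdealPow L n x) : MemIdealPow L n (-x) := by
  rw [memIdealPow_iff, qabs_neg] at *; exact hx

theorem MemIdealPow.sub {n : ℤ} {x y : D} (hx : MemIdealPow L n x) (hy : MemIdealPow L n y) :
    MemIdealPow L n (x - y) := by
  rw [sub_eq_add_neg]; exact hx.add hy.neg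

theorem MemIdealPow.mul {n m : ℤ} {x y : D} (hx : MemIdealPow L n x) (hy : MemIdealPow L m y) :
    MemIdealPow L (n + m) (x * y) := by
  rw [memIdealPow_iff] at *
  rw [qabs_mul, zpow_add₀ (absUnif_pos L).ne']
  exact mul_le_mul hx hy (qabs_nonneg y) (zpow_pos (absUnif_pos L) _).le

theorem MemIdealPow.mono {n m : ℤ} (h : n ≤ m) {x : D} (hx : MemIdealPow L m x) :
    MemIdealPow L n x := by
  rw [memIdealPow_iff] at *
  exact hx.trans (absUnif_zpow_le_iff.mpr h)

/-- The fractional ideal `𝔓 ^ n`. -/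
def idealPow (L : LocalField p) [FiniteDimensional ℚ_[p] L] (D : Type*) [DivisionRing D]
    [Algebra L D] [Algebra.IsCentral L D] [Fact (Module.finrank L D = 4)] (n : ℤ) :
    AddSubgroup D where
  carrier := {x | MemIdealPow L n x}
  add_mem' := MemIdealPow.add
  zero_mem' := memIdealPow_zero
  neg_mem' := MemIdealPow.neg

variable (L) in
/-- A uniformizer of `L`, viewed in `D`, generates `𝔓 ^ 2`. -/
theorem exists_center_qabs_eq : ∃ ϖ : L, ϖ ≠ 0 ∧ ∀ k : ℤ,
    qabs L (algebraMap L D ϖ ^ k) = absUnif L ^ (2 * k) := by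
  obtain ⟨ϖ, hϖ⟩ := exists_norm_eq_absUnif L
  refine ⟨ϖ, ?_, fun k => ?_⟩
  · rintro rfl
    simp at hϖ
    exact (absUnif_pos L).ne hϖ
  · rw [qabs_zpow, qabs_algebraMap, hϖ, zpow_mul]; rfl

end Quaternion

universe u

/-! ### The maximal order and its residue field -/

section Quaternion

variable {p : ℕ} [Fact p.Prime] (L : LocalField p)
  (D : Type u) [DivisionRing D] [Algebra L D]
  [Algebra.IsCentral L D] [hD : Fact (Module.finrank L D = 4)]

/-- The maximal order `𝒪_D`. -/
def quatInt : Subring D where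
  carrier := {x | qabs L x ≤ 1}
  mul_mem' {x y} hx hy := by
    change qabs L (x * y) ≤ 1
    rw [qabs_mul]
    exact mul_le_one₀ hx (qabs_nonneg y) hy
  one_mem' := qabs_one.le
  add_mem' {x y} hx hy := (qabs_add_le x y).trans (max_le hx hy)
  zero_mem' := by change qabs L (0 : D) ≤ 1; rw [qabs_zero]; exact zero_le_one
  neg_mem' {x} hx := by change qabs L (-x) ≤ 1; rw [qabs_neg]; exact hx

/-- The maximal ideal `𝔓_D` of `𝒪_D`. -/
def quatMax : Ideal (quatInt L D) where
  carrier := {x | qabs L (x : D) < 1}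
  add_mem' {x y} hx hy := lt_of_le_of_lt (qabs_add_le (x : D) y) (max_lt hx hy)
  zero_mem' := by change qabs L (0 : D) < 1; rw [qabs_zero]; exact zero_lt_one
  smul_mem' x y hy := by
    change qabs L ((x : D) * y) < 1
    rw [qabs_mul]
    exact lt_of_le_of_lt (mul_le_of_le_one_left (qabs_nonneg _) x.2) hy

instance quatMax_isTwoSided : (quatMax L D).IsTwoSided where
  mul_mem_of_left {x} y hx := by
    change qabs L ((x : D) * y) < 1
    rw [qabs_mul]
    exact lt_of_le_of_lt (mul_le_of_le_one_right (qabs_nonneg _) y.2) hx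

/-- The embedding of `𝒪_L` into `𝒪_D`. -/
def integersToQuatInt : integers L →+* quatInt L D :=
  ((algebraMap L D).comp (integers L).subtype).codRestrict (quatInt L D) (fun x => by
    change qabs L (algebraMap L D (x : L)) ≤ 1
    rw [qabs_algebraMap]
    exact pow_le_one₀ (norm_nonneg _) ((mem_integers L x).mp x.2))

theorem coe_integersToQuatInt (a : integers L) :
    (integersToQuatInt L D a : D) = algebraMap L D (a : L) := rfl

theorem quotient_mk_eq_zero_iff (x : quatInt L D) :
    Ideal.Quotient.mk (quatMax L D) x = 0 ↔ qabs L (x : D) < 1 :=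
  Ideal.Quotient.eq_zero_iff_mem

theorem qabs_integersToQuatInt_lt_one_iff (a : integers L) :
    qabs L (integersToQuatInt L D a : D) < 1 ↔ ‖((a : L) : PadicAlgCl p)‖ < 1 := by
  rw [coe_integersToQuatInt, qabs_algebraMap]
  exact pow_lt_one_iff_of_nonneg (norm_nonneg _) two_ne_zero

/-- The map of residue rings induced by `𝒪_L → 𝒪_D`. -/
def residueToQuotient : residueField L →+* quatInt L D ⧸ quatMax L D :=
  Ideal.Quotient.lift (IsLocalRing.maximalIdeal (integers L))
    ((Ideal.Quotient.mk (quatMax L D)).comp (integersToQuatInt L D)) (fun a ha => by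
      rw [RingHom.comp_apply, quotient_mk_eq_zero_iff, qabs_integersToQuatInt_lt_one_iff]
      exact (mem_maximalIdeal_integers_iff L a).mp ha)

instance nontrivial_quotient_quatMax : Nontrivial (quatInt L D ⧸ quatMax L D) :=
  ⟨1, 0, fun h => by
    rw [← map_one (Ideal.Quotient.mk (quatMax L D)), quotient_mk_eq_zero_iff] at h
    change qabs L (1 : D) < 1 at h
    rw [qabs_one] at h
    exact lt_irrefl _ h⟩

instance noZeroDivisors_quotient_quatMax : NoZeroDivisors (quatInt L D ⧸ quatMax L D) where
  eq_zero_or_eq_zero_of_mul_eq_zero {x y} h := by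
    obtain ⟨x, rfl⟩ := Ideal.Quotient.mk_surjective x
    obtain ⟨y, rfl⟩ := Ideal.Quotient.mk_surjective y
    rw [← map_mul, quotient_mk_eq_zero_iff] at h
    rw [quotient_mk_eq_zero_iff, quotient_mk_eq_zero_iff]
    by_contra hcon
    push Not at hcon
    change qabs L ((x : D) * y) < 1 at h
    rw [qabs_mul] at h
    nlinarith [hcon.1, hcon.2]

variable [FiniteDimensional ℚ_[p] L]

/-- Lifts of elements independent over `k_L` are independent over `L`: divide a relation by its
coefficient of largest norm and reduce it. So the quotient has dimension at most `4` over `k_L`. -/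
instance finite_quotient_quatMax : Finite (quatInt L D ⧸ quatMax L D) := by
  classical
  let _ : Module (residueField L) (quatInt L D ⧸ quatMax L D) :=
    Module.compHom _ (residueToQuotient L D)
  have : FiniteDimensional L D := FiniteDimensional.of_finrank_pos (by rw [hD.out]; norm_num)
  have hrank : Module.rank (residueField L) (quatInt L D ⧸ quatMax L D) ≤ (4 : ℕ) := by
    refine rank_le fun s hs => ?_
    choose w hw using fun i : s => Ideal.Quotient.mk_surjective (I := quatMax L D) (i : _ ⧸ _)
    have hlin : LinearIndependent L (fun i : s => (w i : D)) := by
      rw [Fintype.linearIndependent_iff]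
      intro g hg
      by_contra hcon
      push Not at hcon
      obtain ⟨i₀, hi₀⟩ := hcon
      obtain ⟨j, -, hj⟩ := Finset.exists_max_image Finset.univ
        (fun i => ‖(g i : PadicAlgCl p)‖) ⟨i₀, Finset.mem_univ _⟩
      have hjpos : 0 < ‖(g j : PadicAlgCl p)‖ :=
        lt_of_lt_of_le (by simpa using hi₀) (hj i₀ (Finset.mem_univ _))
      have hgj : g j ≠ 0 := by rintro h; rw [h] at hjpos; simp at hjpos
      have hint : ∀ i, g i / g j ∈ integers L := fun i => by
        rw [mem_integers]
        push_cast
        rw [norm_div]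
        exact div_le_one_of_le₀ (hj i (Finset.mem_univ _)) hjpos.le
      let c : s → integers L := fun i => ⟨_, hint i⟩
      have hsum : ∑ i, integersToQuatInt L D (c i) * w i = 0 := by
        apply Subtype.ext
        rw [AddSubmonoidClass.coe_finsetSum]
        have h1 : ∀ i, ((integersToQuatInt L D (c i) * w i : quatInt L D) : D) =
            (g j)⁻¹ • (g i • (w i : D)) := fun i => by
          rw [smul_smul, Algebra.smul_def, mul_comm, ← div_eq_mul_inv]; rfl
        simp_rw [h1, ← Finset.smul_sum, hg, smul_zero]
        rfl
      have hsum' : ∑ i, IsLocalRing.residue (integers L) (c i) • (i : _ ⧸ quatMax L D) = 0 := by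
        have h2 := congrArg (Ideal.Quotient.mk (quatMax L D)) hsum
        rw [map_sum, map_zero] at h2
        rw [← h2]
        refine Finset.sum_congr rfl fun i _ => ?_
        rw [map_mul, hw]
        rfl
      have h3 := Fintype.linearIndependent_iff.mp hs _ hsum' j
      have h4 : c j = 1 := Subtype.ext (div_self hgj)
      rw [h4, map_one] at h3
      exact one_ne_zero h3
    have := hlin.fintype_card_le_finrank
    rwa [hD.out, Fintype.card_coe] at this
  have : Module.Finite (residueField L) (quatInt L D ⧸ quatMax L D) :=
    Module.rank_lt_aleph0_iff.mp (lt_of_le_of_lt hrank (Cardinal.natCast_lt_aleph0))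
  exact Module.finite_of_finite (residueField L)

/-- The quotient is a finite ring without zero divisors, hence a commutative field by Wedderburn's
theorem. The existential form yields a type `quatResidueField` whose ring structure comes only from
its field structure. -/
theorem exists_quatResidueField : ∃ (k : Type u) (_ : Field k) (f : quatInt L D →+* k),
    Finite k ∧ Function.Surjective f ∧ ∀ x, f x = 0 ↔ qabs L (x : D) < 1 :=
  ⟨quatInt L D ⧸ quatMax L D,
    IsField.toField (have : IsDomain (quatInt L D ⧸ quatMax L D) := NoZeroDivisors.to_isDomain _
      Finite.isDomain_to_isField _),
    Ideal.Quotient.mk (quatMax L D), finite_quotient_quatMax L D, Ideal.Quotient.mk_surjective,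
    quotient_mk_eq_zero_iff L D⟩

/-- The residue field `k_D`. -/
def quatResidueField := (exists_quatResidueField L D).choose

instance field_quatResidueField : Field (quatResidueField L D) :=
  (exists_quatResidueField L D).choose_spec.choose

/-- The reduction map `𝒪_D → k_D`. -/
def quatResidue : quatInt L D →+* quatResidueField L D :=
  (exists_quatResidueField L D).choose_spec.choose_spec.choose

instance finite_quatResidueField : Finite (quatResidueField L D) :=
  (exists_quatResidueField L D).choose_spec.choose_spec.choose_spec.1

theorem quatResidue_surjective : Function.Surjective (quatResidue L D) :=
  (exists_quatResidueField L D).choose_spec.choose_spec.choose_spec.2.1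

theorem quatResidue_eq_zero_iff (x : quatInt L D) :
    quatResidue L D x = 0 ↔ qabs L (x : D) < 1 :=
  (exists_quatResidueField L D).choose_spec.choose_spec.choose_spec.2.2 x

theorem quatResidue_eq_iff (x y : quatInt L D) :
    quatResidue L D x = quatResidue L D y ↔ qabs L ((x : D) - y) < 1 := by
  rw [← sub_eq_zero, ← map_sub, quatResidue_eq_zero_iff]; rfl

/-- The embedding `k_L → k_D`. -/
def residueEmbedding : residueField L →+* quatResidueField L D :=
  Ideal.Quotient.lift (IsLocalRing.maximalIdeal (integers L))
    ((quatResidue L D).comp (integersToQuatInt L D)) (fun a ha => by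
      rw [RingHom.comp_apply, quatResidue_eq_zero_iff, qabs_integersToQuatInt_lt_one_iff]
      exact (mem_maximalIdeal_integers_iff L a).mp ha)

instance algebra_quatResidueField : Algebra (residueField L) (quatResidueField L D) :=
  (residueEmbedding L D).toAlgebra

theorem algebraMap_residue (a : integers L) :
    algebraMap (residueField L) (quatResidueField L D) (IsLocalRing.residue (integers L) a) =
      quatResidue L D (integersToQuatInt L D a) := rfl

end Quaternion

/-! ### The Frobenius of a finite field -/

section FiniteField

/-- The polynomial `X ^ q - X` has at most `q` roots, and the elements of `k` already supply `q` of
them. -/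
theorem FiniteField.pow_card_eq_self_iff {k K : Type*} [Field k] [Field K] [Algebra k K] [Finite k]
    (x : K) : x ^ Nat.card k = x ↔ x ∈ Set.range (algebraMap k K) := by
  classical
  let _ := Fintype.ofFinite k
  rw [Nat.card_eq_fintype_card]
  constructor
  · intro hx
    have hne : (Polynomial.X ^ Fintype.card k - Polynomial.X : Polynomial K) ≠ 0 :=
      FiniteField.X_pow_card_sub_X_ne_zero K Fintype.one_lt_card
    have hsub : Finset.univ.image (algebraMap k K) ⊆
        (Polynomial.X ^ Fintype.card k - Polynomial.X : Polynomial K).roots.toFinset := by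
      intro y hy
      obtain ⟨a, -, rfl⟩ := Finset.mem_image.mp hy
      rw [Multiset.mem_toFinset, Polynomial.mem_roots hne]
      simp [Polynomial.IsRoot, ← map_pow, FiniteField.pow_card]
    have hcard : (Polynomial.X ^ Fintype.card k - Polynomial.X : Polynomial K).roots.toFinset.card
        ≤ (Finset.univ.image (algebraMap k K)).card := by
      rw [Finset.card_image_of_injective _ (algebraMap k K).injective, Finset.card_univ]
      refine (Multiset.toFinset_card_le _).trans ((Polynomial.card_roots' _).trans ?_)
      rw [FiniteField.X_pow_card_sub_X_natDegree_eq K Fintype.one_lt_card]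
    have heq := Finset.eq_of_subset_of_card_le hsub hcard
    have : x ∈ Finset.univ.image (algebraMap k K) := by
      rw [heq, Multiset.mem_toFinset, Polynomial.mem_roots hne]
      simp [Polynomial.IsRoot, hx]
    obtain ⟨a, -, rfl⟩ := Finset.mem_image.mp this
    exact ⟨a, rfl⟩
  · rintro ⟨a, rfl⟩
    rw [← map_pow, FiniteField.pow_card]

theorem FiniteField.add_pow_natCard {k K : Type*} [Field k] [Field K] [Algebra k K] [Finite k]
    (x y : K) : (x + y) ^ Nat.card k = x ^ Nat.card k + y ^ Nat.card k := by
  let _ := Fintype.ofFinite k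
  rw [Nat.card_eq_fintype_card]
  exact map_add (FiniteField.frobeniusAlgHom k K) x y

/-- The `q`-power of a root of a quadratic polynomial over a field with `q` elements is a root. -/
theorem FiniteField.pow_card_root_quadratic {k K : Type*} [Field k] [Field K] [Algebra k K]
    [Finite k] {x : K} {t n : k} (h : x * x = algebraMap k K t * x - algebraMap k K n) :
    x ^ Nat.card k = x ∨ x ^ Nat.card k = algebraMap k K t - x := by
  let _ := Fintype.ofFinite k
  rw [Nat.card_eq_fintype_card]
  have h1 := congrArg (FiniteField.frobeniusAlgHom k K) h
  rw [map_mul, map_sub, map_mul, AlgHom.commutes, AlgHom.commutes] at h1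
  simp only [FiniteField.coe_frobeniusAlgHom] at h1
  have h2 : (x ^ Fintype.card k - x) * (x ^ Fintype.card k - (algebraMap k K t - x)) = 0 := by
    linear_combination h1 - h
  rcases mul_eq_zero.mp h2 with h3 | h3
  · exact Or.inl (sub_eq_zero.mp h3)
  · exact Or.inr (sub_eq_zero.mp h3)

end FiniteField

/-! ### The residue extension is quadratic, and uniformizers act on it by Frobenius -/

section Quaternion

variable {p : ℕ} [Fact p.Prime] {L : LocalField p}
  {D : Type*} [DivisionRing D] [Algebra L D]
  [Algebra.IsCentral L D] [hD : Fact (Module.finrank L D = 4)]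

theorem redTrace_one : redTrace L (1 : D) = 2 := by
  have := redTrace_algebraMap (D := D) hD.out (1 : L)
  simpa using this

/-- Every linear form on `D` is given by the reduced trace. -/
theorem exists_redTrace_mul_eq (f : D →ₗ[L] L) : ∃ b : D, ∀ x, f x = redTrace L (b * x) := by
  have : FiniteDimensional L D := FiniteDimensional.of_finrank_pos (by rw [hD.out]; norm_num)
  let T : D →ₗ[L] Module.Dual L D := (LinearMap.mul L D).compr₂ (redTraceLin L D)
  have hT : ∀ b x, T b x = redTrace L (b * x) := fun b x => rfl
  -- The trace form is nondegenerate because `b * b⁻¹` has reduced trace `2`.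
  have hinj : Function.Injective T := by
    rw [← LinearMap.ker_eq_bot, LinearMap.ker_eq_bot']
    intro b hb
    by_contra hb0
    have h1 := hT b b⁻¹
    rw [hb, mul_inv_cancel₀ hb0, redTrace_one] at h1
    exact two_ne_zero h1.symm
  obtain ⟨b, hb⟩ := (LinearMap.injective_iff_surjective_of_finrank_eq_finrank
    (Subspace.dual_finrank_eq (K := L) (V := D)).symm).mp hinj f
  exact ⟨b, fun x => by rw [← hb, hT]⟩

theorem redTrace_mem_integers {x : D} (hx : qabs L x ≤ 1) : redTrace L x ∈ integers L := by
  rw [mem_integers]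
  have := (norm_redTrace_sq_le (L := L) x).trans hx
  exact (sq_le_one_iff₀ (norm_nonneg _)).mp this

theorem redNorm_mem_integers {x : D} (hx : qabs L x ≤ 1) : redNorm L x ∈ integers L := by
  rw [mem_integers]; exact hx

theorem quatResidue_mul_self (x : quatInt L D) [FiniteDimensional ℚ_[p] L] :
    quatResidue L D x * quatResidue L D x =
      algebraMap (residueField L) (quatResidueField L D) (IsLocalRing.residue (integers L)
        ⟨_, redTrace_mem_integers x.2⟩) * quatResidue L D x -
      algebraMap (residueField L) (quatResidueField L D) (IsLocalRing.residue (integers L)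
        ⟨_, redNorm_mem_integers x.2⟩) := by
  rw [algebraMap_residue, algebraMap_residue, ← map_mul, ← map_mul, ← map_sub]
  congr 1
  apply Subtype.ext
  have := mul_self_eq hD.out (x : D)
  rw [Algebra.smul_def] at this
  exact this

variable [FiniteDimensional ℚ_[p] L]

variable (L D) in
/-- If all residues came from `L`, approximation by a subspace of dimension at most `2` would show
`dim D ≤ 2`. -/
theorem exists_quatResidue_not_mem_range :
    ∃ x : quatInt L D, quatResidue L D x ∉
      Set.range (algebraMap (residueField L) (quatResidueField L D)) := by
  by_contra hcon
  push Not at hcon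
  have : FiniteDimensional L D := FiniteDimensional.of_finrank_pos (by rw [hD.out]; norm_num)
  have happ : ∀ u : D, qabs L u ≤ 1 → ∃ a : L, qabs L (u - algebraMap L D a) < 1 := by
    intro u hu
    obtain ⟨a, ha⟩ := hcon ⟨u, hu⟩
    obtain ⟨a, rfl⟩ := IsLocalRing.residue_surjective a
    rw [algebraMap_residue, eq_comm, quatResidue_eq_iff] at ha
    exact ⟨a, ha⟩
  obtain ⟨ϖ, hϖ0, hϖ⟩ := exists_center_qabs_eq (D := D) L
  -- `M` is spanned by `1` and an element of odd valuation, if there is one. It realises every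
  -- nonzero value of `qabs`, yet has dimension at most `2`.
  have hM : ∃ M : Submodule L D, M ≠ ⊤ ∧ ∀ d : D, d ≠ 0 → ∃ μ ∈ M, qabs L μ = qabs L d := by
    have hspan : ∀ β : D, Submodule.span L {1, β} ≠ ⊤ := by
      intro β h
      classical
      have h1 := finrank_span_finset_le_card (R := L) ({1, β} : Finset D)
      rw [Finset.coe_pair, Set.finrank, h] at h1
      have h2 : ({1, β} : Finset D).card ≤ 2 := Finset.card_le_two
      rw [finrank_top, hD.out] at h1
      omega
    have hz : ∀ j : ℤ, algebraMap L D ϖ ^ j = algebraMap L D (ϖ ^ j) := fun j => by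
      rw [map_zpow₀]
    by_cases hodd : ∃ β : D, ∃ j : ℤ, qabs L β = absUnif L ^ (2 * j + 1)
    · obtain ⟨β, j, hβ⟩ := hodd
      refine ⟨_, hspan β, fun d hd => ?_⟩
      obtain ⟨k, hk⟩ := exists_qabs_eq_zpow (L := L) hd
      rcases Int.even_or_odd' k with ⟨i, rfl | rfl⟩
      · refine ⟨algebraMap L D ϖ ^ i, ?_, by rw [hϖ, hk]⟩
        rw [hz, Algebra.algebraMap_eq_smul_one]
        exact Submodule.smul_mem _ _ (Submodule.subset_span (by simp))
      · refine ⟨algebraMap L D ϖ ^ (i - j) * β, ?_, ?_⟩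
        · rw [hz, ← Algebra.smul_def]
          exact Submodule.smul_mem _ _ (Submodule.subset_span (by simp))
        · rw [qabs_mul, hϖ, hβ, hk, ← zpow_add₀ (absUnif_pos L).ne']
          congr 1; ring
    · push Not at hodd
      refine ⟨_, hspan 1, fun d hd => ?_⟩
      obtain ⟨k, hk⟩ := exists_qabs_eq_zpow (L := L) hd
      rcases Int.even_or_odd' k with ⟨i, rfl | rfl⟩
      · refine ⟨algebraMap L D ϖ ^ i, ?_, by rw [hϖ, hk]⟩
        rw [hz, Algebra.algebraMap_eq_smul_one]
        exact Submodule.smul_mem _ _ (Submodule.subset_span (by simp))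
      · exact absurd hk (hodd d i)
  obtain ⟨M, hMtop, hMval⟩ := hM
  obtain ⟨f, hf0, hfM⟩ := Submodule.exists_le_ker_of_lt_top M (lt_top_iff_ne_top.mpr hMtop)
  obtain ⟨y, hy⟩ : ∃ y, f y ≠ 0 := by
    by_contra h; push Not at h; exact hf0 (LinearMap.ext h)
  obtain ⟨b, hb⟩ := exists_redTrace_mul_eq f
  -- Since `f` vanishes on `M`, `f y = f (y - m)`; the bound on traces keeps `y` at a positive
  -- distance from `M`.
  have hlow : ∀ m ∈ M, ‖(f y : PadicAlgCl p)‖ ^ 2 ≤ qabs L b * qabs L (y - m) := by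
    intro m hm
    have h1 : f y = f (y - m) := by rw [map_sub, LinearMap.mem_ker.mp (hfM hm), sub_zero]
    rw [h1, hb, ← qabs_mul]
    exact norm_redTrace_sq_le _
  have hpos : 0 < ‖(f y : PadicAlgCl p)‖ ^ 2 := by
    have : 0 < ‖(f y : PadicAlgCl p)‖ := by simpa using hy
    positivity
  have hyM : ∀ m ∈ M, y - m ≠ 0 := by
    intro m hm h0
    have := hlow m hm
    rw [h0, qabs_zero, mul_zero] at this
    linarith
  have hb0 : b ≠ 0 := by
    rintro rfl
    have := hlow 0 M.zero_mem
    rw [qabs_zero, zero_mul] at this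
    linarith
  obtain ⟨kb, hkb⟩ := exists_qabs_eq_zpow (L := L) hb0
  obtain ⟨kf, hkf⟩ := exists_norm_eq_absUnif_zpow hy
  -- A best approximation `m` of `y` exists by discreteness. Dividing `y - m` by some `μ ∈ M` of the
  -- same absolute value and lifting the residue of the quotient to `L` produces a better one.
  obtain ⟨k, ⟨m, hm, hk⟩, hmax⟩ := Int.exists_greatest_of_bdd
    (P := fun k => ∃ m ∈ M, qabs L (y - m) = absUnif L ^ k)
    ⟨kf * 2 - kb, fun k ⟨m, hm, hk⟩ => by
      have := hlow m hm
      have e2 : (absUnif L ^ kf) ^ 2 = absUnif L ^ (kf * 2) := by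
        rw [zpow_mul]; rfl
      rw [hkb, hk, hkf, ← zpow_add₀ (absUnif_pos L).ne', e2, absUnif_zpow_le_iff] at this
      omega⟩
    (by
      obtain ⟨k, hk⟩ := exists_qabs_eq_zpow (L := L) (hyM 0 M.zero_mem)
      exact ⟨k, 0, M.zero_mem, hk⟩)
  obtain ⟨μ, hμ, hμk⟩ := hMval (y - m) (hyM m hm)
  have hμpos : 0 < qabs L μ := by rw [hμk]; exact qabs_pos (hyM m hm)
  have hμ0 : μ ≠ 0 := fun h => by rw [h, qabs_zero] at hμpos; exact lt_irrefl _ hμpos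
  obtain ⟨a, ha⟩ := happ (μ⁻¹ * (y - m)) (by
    rw [qabs_mul, qabs_inv, ← hμk, inv_mul_cancel₀ hμpos.ne'])
  have hm' : m + a • μ ∈ M := M.add_mem hm (M.smul_mem _ hμ)
  have hlt : qabs L (y - (m + a • μ)) < absUnif L ^ k := by
    have : y - (m + a • μ) = μ * (μ⁻¹ * (y - m) - algebraMap L D a) := by
      rw [mul_sub, mul_inv_cancel_left₀ hμ0, Algebra.smul_def, Algebra.commutes]; abel
    rw [this, qabs_mul, ← hk, ← hμk]
    exact mul_lt_of_lt_one_right hμpos ha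
  obtain ⟨k', hk'⟩ := exists_qabs_eq_zpow (L := L) (hyM _ hm')
  have h1 := hmax k' ⟨_, hm', hk'⟩
  rw [hk', absUnif_zpow_lt_iff] at hlt
  omega

variable (L D) in
-- A primitive element of `k_D` is a root of the reduction of the quadratic reduced characteristic
-- polynomial of a lift, so the degree is at most `2`.
theorem finrank_quatResidueField :
    Module.finrank (residueField L) (quatResidueField L D) = 2 := by
  have hfin : Module.Finite (residueField L) (quatResidueField L D) := Module.Finite.of_finite
  obtain ⟨ζ, hζ⟩ := Field.exists_primitive_element (residueField L) (quatResidueField L D)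
  obtain ⟨x, rfl⟩ := quatResidue_surjective L D ζ
  have hle : Module.finrank (residueField L) (quatResidueField L D) ≤ 2 := by
    rw [← (Field.primitive_element_iff_minpoly_natDegree_eq _ _).mp hζ]
    have h := quatResidue_mul_self x
    set t := IsLocalRing.residue (integers L) ⟨_, redTrace_mem_integers x.2⟩
    set n := IsLocalRing.residue (integers L) ⟨_, redNorm_mem_integers x.2⟩
    have hdeg : (Polynomial.X ^ 2 - Polynomial.C t * Polynomial.X + Polynomial.C n).natDegree = 2 := by
      compute_degree!
    have hmon : (Polynomial.X ^ 2 - Polynomial.C t * Polynomial.X + Polynomial.C n).Monic := by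
      monicity!
    rw [← hdeg]
    refine Polynomial.natDegree_le_of_dvd (minpoly.dvd _ _ ?_) hmon.ne_zero
    simp only [map_add, map_sub, map_mul, map_pow, Polynomial.aeval_X, Polynomial.aeval_C]
    rw [sq, h]; ring
  have hne : Module.finrank (residueField L) (quatResidueField L D) ≠ 1 := by
    intro h1
    obtain ⟨x, hx⟩ := exists_quatResidue_not_mem_range L D
    obtain ⟨c, hc⟩ := (finrank_eq_one_iff_of_nonzero' (1 : quatResidueField L D) one_ne_zero).mp h1
      (quatResidue L D x)
    exact hx ⟨c, by rw [← hc, Algebra.smul_def, mul_one]⟩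
  have hpos : 0 < Module.finrank (residueField L) (quatResidueField L D) := Module.finrank_pos
  omega

variable (L D) in
theorem card_quatResidueField : Nat.card (quatResidueField L D) = resCard L ^ 2 := by
  rw [← finrank_quatResidueField L D]
  exact Module.natCard_eq_pow_finrank

theorem qabs_conj {z : D} (hz : z ≠ 0) (x : D) : qabs L (z * x * z⁻¹) = qabs L x := by
  rw [qabs_mul, qabs_mul, qabs_inv, mul_comm (qabs L z), mul_assoc,
    mul_inv_cancel₀ (qabs_pos hz).ne', mul_one]

/-- Conjugation by a unit acts trivially on the residue field. -/
theorem qabs_unit_conj_sub_lt {u y : D} (hu : qabs L u = 1) (hy : qabs L y ≤ 1) :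
    qabs L (u * y * u⁻¹ - y) < 1 := by
  have hu0 : u ≠ 0 := fun h => by rw [h, qabs_zero] at hu; exact zero_ne_one hu
  have h1 : u * y * u⁻¹ - y = (u * y - y * u) * u⁻¹ := by
    rw [sub_mul, mul_inv_cancel_right₀ hu0]
  rw [h1, qabs_mul, qabs_inv, hu, inv_one, mul_one]
  have h2 : quatResidue L D (⟨u, hu.le⟩ * ⟨y, hy⟩) = quatResidue L D (⟨y, hy⟩ * ⟨u, hu.le⟩) := by
    rw [map_mul, map_mul, mul_comm]
  rw [quatResidue_eq_iff] at h2
  exact h2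

theorem zpow_center_conj (ϖ : L) (hϖ : ϖ ≠ 0) (k : ℤ) (z x : D) :
    (z * algebraMap L D ϖ ^ k) * x * (z * algebraMap L D ϖ ^ k)⁻¹ = z * x * z⁻¹ := by
  have h0 : algebraMap L D (ϖ ^ k) ≠ 0 := by
    exact (map_ne_zero _).mpr (zpow_ne_zero k hϖ)
  rw [← map_zpow₀, mul_inv_rev, mul_assoc z, Algebra.commutes, ← mul_assoc, ← mul_assoc,
    mul_inv_cancel_right₀ h0]

/-- A case of Skolem–Noether made explicit: a nonzero commutator `w * x - x * w` conjugates `x` into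
its image under the involution. -/
theorem commutator_conj (x w : D) :
    (w * x - x * w) * x = quatConj (L := L) x * (w * x - x * w) := by
  have h := mul_self_eq (L := L) hD.out x
  have e1 : (w * x - x * w) * x = w * (x * x) - x * w * x := by rw [sub_mul]; simp only [mul_assoc]
  have e2 : quatConj (L := L) x * (w * x - x * w) =
      redTrace L x • (w * x - x * w) - x * w * x + (x * x) * w := by
    rw [quatConj, sub_mul, ← Algebra.smul_def, mul_sub]
    simp only [mul_assoc]
    abel
  rw [e1, e2, h, mul_sub, sub_mul, ← Algebra.commutes, smul_sub]
  simp only [mul_smul_comm, smul_mul_assoc]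
  abel

theorem residue_quatConj (x : quatInt L D) (hx' : qabs L (quatConj (L := L) (x : D)) ≤ 1) :
    quatResidue L D ⟨_, hx'⟩ =
      algebraMap (residueField L) (quatResidueField L D) (IsLocalRing.residue (integers L)
        ⟨_, redTrace_mem_integers x.2⟩) - quatResidue L D x := by
  rw [algebraMap_residue, ← map_sub]; rfl

theorem quatResidue_pow_card_of_not_mem_range {x : quatInt L D} (hx : quatResidue L D x ∉
      Set.range (algebraMap (residueField L) (quatResidueField L D))) :
    quatResidue L D x ^ resCard L = algebraMap (residueField L) (quatResidueField L D)
      (IsLocalRing.residue (integers L) ⟨_, redTrace_mem_integers x.2⟩) - quatResidue L D x := by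
  rcases FiniteField.pow_card_root_quadratic (quatResidue_mul_self x) with h | h
  · exact absurd ((FiniteField.pow_card_eq_self_iff _).mp h) hx
  · exact h

theorem qabs_quatConj_le {x : D} (hx : qabs L x ≤ 1) : qabs L (quatConj (L := L) x) ≤ 1 := by
  refine (qabs_sub_le _ _).trans (max_le ?_ hx)
  rw [qabs_algebraMap]
  exact (norm_redTrace_sq_le x).trans hx

/-- There is a uniformizer of `D`, conjugation by which induces the Frobenius on an element
generating the residue field. -/
theorem exists_uniformizer_conj {x : quatInt L D} (hx : quatResidue L D x ∉
      Set.range (algebraMap (residueField L) (quatResidueField L D))) :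
    ∃ β : D, qabs L β = absUnif L ∧ β * x * β⁻¹ = quatConj (L := L) (x : D) := by
  have hx0 : (x : D) ∉ Set.range (algebraMap L D) := by
    rintro ⟨a, ha⟩
    have h1 := x.2
    change qabs L (x : D) ≤ 1 at h1
    rw [← ha, qabs_algebraMap, sq_le_one_iff₀ (norm_nonneg _)] at h1
    refine hx ⟨IsLocalRing.residue _ ⟨a, (mem_integers L a).mpr h1⟩, ?_⟩
    rw [algebraMap_residue]
    congr 1
    exact Subtype.ext ha
  obtain ⟨w, hw⟩ := exists_not_commute (F := L) (x : D) hx0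
  set z := w * (x : D) - x * w with hzdef
  have hz0 : z ≠ 0 := sub_ne_zero.mpr hw
  have hconj : z * x * z⁻¹ = quatConj (L := L) (x : D) := by
    rw [hzdef, commutator_conj (L := L), ← hzdef, mul_inv_cancel_right₀ hz0]
  obtain ⟨k, hk⟩ := exists_qabs_eq_zpow (L := L) hz0
  obtain ⟨ϖ, hϖ0, hϖ⟩ := exists_center_qabs_eq (D := D) L
  rcases Int.even_or_odd' k with ⟨i, rfl | rfl⟩
  -- In even valuation a central factor turns `z` into a unit. Units act trivially on residues, so
  -- Frobenius would fix the residue of `x`.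
  · exfalso
    have hu : qabs L (z * algebraMap L D ϖ ^ (-i)) = 1 := by
      rw [qabs_mul, hϖ, hk, ← zpow_add₀ (absUnif_pos L).ne']; simp
    have h1 := qabs_unit_conj_sub_lt hu x.2
    rw [zpow_center_conj ϖ hϖ0, hconj] at h1
    have h2 := (quatResidue_eq_iff L D ⟨_, qabs_quatConj_le x.2⟩ x).mpr h1
    rw [residue_quatConj, ← quatResidue_pow_card_of_not_mem_range hx] at h2
    exact hx ((FiniteField.pow_card_eq_self_iff _).mp h2)
  · refine ⟨z * algebraMap L D ϖ ^ (-i), ?_, ?_⟩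
    · rw [qabs_mul, hϖ, hk, ← zpow_add₀ (absUnif_pos L).ne']; simp
    · rw [zpow_center_conj ϖ hϖ0, hconj]

variable (L D) in
theorem exists_qabs_eq_absUnif : ∃ β : D, qabs L β = absUnif L := by
  obtain ⟨x, hx⟩ := exists_quatResidue_not_mem_range L D
  obtain ⟨β, hβ, -⟩ := exists_uniformizer_conj hx
  exact ⟨β, hβ⟩

theorem exists_quatResidue_eq_add_mul {x : quatInt L D} (hx : quatResidue L D x ∉
      Set.range (algebraMap (residueField L) (quatResidueField L D))) (y : quatInt L D) :
    ∃ a b : integers L, quatResidue L D y =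
      quatResidue L D (integersToQuatInt L D a + integersToQuatInt L D b * x) := by
  have hli : LinearIndependent (residueField L) ![(1 : quatResidueField L D), quatResidue L D x] := by
    rw [LinearIndependent.pair_iff' one_ne_zero]
    intro a ha
    exact hx ⟨a, by rw [← ha, Algebra.smul_def, mul_one]⟩
  have hspan := hli.span_eq_top_of_card_eq_finrank' (by
    rw [Fintype.card_fin, finrank_quatResidueField])
  have hmem : quatResidue L D y ∈ Submodule.span (residueField L)
      (Set.range ![(1 : quatResidueField L D), quatResidue L D x]) := by
    rw [hspan]; trivial
  rw [Matrix.range_cons_cons_empty, Submodule.mem_span_pair] at hmem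
  obtain ⟨a, b, hab⟩ := hmem
  obtain ⟨a, rfl⟩ := IsLocalRing.residue_surjective a
  obtain ⟨b, rfl⟩ := IsLocalRing.residue_surjective b
  refine ⟨a, b, ?_⟩
  rw [← hab, Algebra.smul_def, Algebra.smul_def, mul_one, map_add, map_mul, algebraMap_residue,
    algebraMap_residue]

theorem quatResidue_add_mul_pow_card {x : quatInt L D} (hx : quatResidue L D x ∉
      Set.range (algebraMap (residueField L) (quatResidueField L D))) (a b : integers L) :
    quatResidue L D (integersToQuatInt L D a + integersToQuatInt L D b * x) ^ resCard L =
      quatResidue L D (integersToQuatInt L D a + integersToQuatInt L D b *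
        ⟨_, qabs_quatConj_le x.2⟩) := by
  have ha := (FiniteField.pow_card_eq_self_iff (algebraMap (residueField L) (quatResidueField L D)
    (IsLocalRing.residue _ a))).mpr ⟨_, rfl⟩
  have hb := (FiniteField.pow_card_eq_self_iff (algebraMap (residueField L) (quatResidueField L D)
    (IsLocalRing.residue _ b))).mpr ⟨_, rfl⟩
  rw [algebraMap_residue] at ha hb
  have hx' := quatResidue_pow_card_of_not_mem_range hx
  have hc := residue_quatConj x (qabs_quatConj_le x.2)
  rw [← hx'] at hc
  rw [map_add, map_mul, map_add, map_mul, hc, resCard, FiniteField.add_pow_natCard, mul_pow, ha, hb]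

theorem conj_sub_affine {β : D} (hβ0 : β ≠ 0) (x x' y : D) (a b : L) :
    β * y * β⁻¹ - (algebraMap L D a + algebraMap L D b * x') =
      β * (y - (algebraMap L D a + algebraMap L D b * x)) * β⁻¹ +
        algebraMap L D b * (β * x * β⁻¹ - x') := by
  have hc : β * algebraMap L D a * β⁻¹ = algebraMap L D a := by
    rw [← Algebra.commutes, mul_inv_cancel_right₀ hβ0]
  rw [mul_sub, sub_mul, mul_add, add_mul, hc, ← mul_assoc β, ← Algebra.commutes b β, mul_sub]
  simp only [mul_assoc]
  abel

/-- Conjugation by a uniformizer of `D` induces the Frobenius on the residue field. -/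
theorem quatResidue_uniformizer_conj {β : D} (hβ : qabs L β = absUnif L) (y : quatInt L D)
    (hy : qabs L (β * y * β⁻¹) ≤ 1) :
    quatResidue L D ⟨β * y * β⁻¹, hy⟩ = quatResidue L D y ^ resCard L := by
  obtain ⟨x, hx⟩ := exists_quatResidue_not_mem_range L D
  obtain ⟨β₀, hβ₀, hconj⟩ := exists_uniformizer_conj hx
  have hne : ∀ z : D, qabs L z = absUnif L → z ≠ 0 := fun z hz h => by
    rw [h, qabs_zero] at hz; exact (absUnif_pos L).ne hz
  have hβ0 := hne β hβ
  have hβ₀0 := hne β₀ hβ₀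
  have hu : qabs L (β₀⁻¹ * β) = 1 := by
    rw [qabs_mul, qabs_inv, hβ, hβ₀, inv_mul_cancel₀ (absUnif_pos L).ne']
  -- The unit `β₀⁻¹ * β` acts trivially on residues, so `β` acts on the residue of `x` as `β₀` does.
  -- As `1` and that residue span `k_D` over `k_L`, this settles all `y`.
  have hβx : qabs L (β * x * β⁻¹ - quatConj (L := L) (x : D)) < 1 := by
    have h1 := qabs_unit_conj_sub_lt hu x.2
    rw [← qabs_conj hβ₀0] at h1
    have e : β₀ * (β₀⁻¹ * β * (x : D) * (β₀⁻¹ * β)⁻¹ - x) * β₀⁻¹ =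
        β * x * β⁻¹ - quatConj (L := L) (x : D) := by
      rw [mul_sub, sub_mul, hconj, mul_inv_rev, inv_inv]
      congr 1
      simp only [mul_assoc]
      rw [mul_inv_cancel_left₀ hβ₀0, mul_inv_cancel₀ hβ₀0, mul_one]
    rwa [e] at h1
  obtain ⟨a, b, hab⟩ := exists_quatResidue_eq_add_mul hx y
  have h2 := (quatResidue_eq_iff L D _ _).mp hab
  rw [← qabs_conj hβ0] at h2
  have h3 : qabs L (β * y * β⁻¹ - (algebraMap L D (a : L) + algebraMap L D (b : L) *
      quatConj (L := L) (x : D))) < 1 := by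
    rw [conj_sub_affine hβ0 (x : D)]
    refine lt_of_le_of_lt (qabs_add_le _ _) (max_lt h2 ?_)
    rw [qabs_mul]
    refine lt_of_le_of_lt (mul_le_of_le_one_left (qabs_nonneg _) ?_) hβx
    rw [qabs_algebraMap]
    exact pow_le_one₀ (norm_nonneg _) ((mem_integers L _).mp b.2)
  have h4 : quatResidue L D ⟨β * y * β⁻¹, hy⟩ =
      quatResidue L D (integersToQuatInt L D a + integersToQuatInt L D b *
        ⟨quatConj (L := L) (x : D), qabs_quatConj_le x.2⟩) := by
    rw [quatResidue_eq_iff]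
    exact h3
  rw [hab, quatResidue_add_mul_pow_card hx]
  exact h4

/-- An element of `𝒪_D` whose class is fixed by conjugation by a uniformizer is congruent to an
element of `𝒪_L`. -/
theorem exists_integer_sub_lt_of_conj {β y : D} (hβ : qabs L β = absUnif L) (hy : qabs L y ≤ 1)
    (h : qabs L (β * y * β⁻¹ - y) < 1) :
    ∃ a : L, ‖(a : PadicAlgCl p)‖ ≤ 1 ∧ qabs L (y - algebraMap L D a) < 1 := by
  have hβ0 : β ≠ 0 := fun h => by rw [h, qabs_zero] at hβ; exact (absUnif_pos L).ne hβ
  have hy' : qabs L (β * y * β⁻¹) ≤ 1 := by rwa [qabs_conj hβ0]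
  have h1 := quatResidue_uniformizer_conj hβ ⟨y, hy⟩ hy'
  rw [(quatResidue_eq_iff L D ⟨_, hy'⟩ ⟨y, hy⟩).mpr h] at h1
  obtain ⟨a, ha⟩ := (FiniteField.pow_card_eq_self_iff _).mp h1.symm
  obtain ⟨a, rfl⟩ := IsLocalRing.residue_surjective a
  rw [algebraMap_residue, eq_comm, quatResidue_eq_iff] at ha
  exact ⟨a, (mem_integers L _).mp a.2, ha⟩

variable (L D) in
-- If all traces of integral elements were nonunits, then `2`, the trace of `1`, would vanish in the
-- residue field, and Frobenius, which sends a residue outside `k_L` to its trace minus itself,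
-- would fix it.
theorem exists_norm_redTrace_eq_one : ∃ x : D, qabs L x ≤ 1 ∧
    ‖(redTrace L x : PadicAlgCl p)‖ = 1 := by
  by_contra hcon
  push Not at hcon
  have hlt : ∀ x : D, qabs L x ≤ 1 → ‖(redTrace L x : PadicAlgCl p)‖ < 1 := fun x hx =>
    lt_of_le_of_ne ((mem_integers L _).mp (redTrace_mem_integers hx)) (hcon x hx)
  have h2 := hlt 1 qabs_one.le
  rw [redTrace_one] at h2
  obtain ⟨x, hx⟩ := exists_quatResidue_not_mem_range L D
  have h3 := quatResidue_pow_card_of_not_mem_range hx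
  have h4 : IsLocalRing.residue (integers L) ⟨_, redTrace_mem_integers x.2⟩ = 0 :=
    (residue_eq_zero_iff_norm_lt_one L _).mpr (hlt x x.2)
  have h5 : IsLocalRing.residue (integers L) 2 = 0 :=
    (residue_eq_zero_iff_norm_lt_one L _).mpr h2
  have h6 : (2 : quatResidueField L D) = 0 := by
    have := congrArg (algebraMap (residueField L) (quatResidueField L D)) h5
    rw [map_zero, algebraMap_residue, map_ofNat, map_ofNat] at this
    exact this
  rw [h4, map_zero, zero_sub] at h3
  have h7 : quatResidue L D x ^ resCard L = quatResidue L D x := by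
    rw [h3]
    linear_combination (-quatResidue L D x) * h6
  exact hx ((FiniteField.pow_card_eq_self_iff _).mp h7)

end Quaternion

/-! ### Graded pieces of `D` and duality under the additive character -/

section Quaternion

variable {p : ℕ} [Fact p.Prime] {L : LocalField p}
  {D : Type*} [DivisionRing D] [Algebra L D]
  [Algebra.IsCentral L D] [hD : Fact (Module.finrank L D = 4)] [FiniteDimensional ℚ_[p] L]

theorem ne_zero_of_qabs_eq_absUnif {β : D} (hβ : qabs L β = absUnif L) : β ≠ 0 := fun h => by
  rw [h, qabs_zero] at hβ; exact (absUnif_pos L).ne hβ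

theorem qabs_zpow_uniformizer {β : D} (hβ : qabs L β = absUnif L) (n : ℤ) :
    qabs L (β ^ n) = absUnif L ^ n := by rw [qabs_zpow, hβ]

theorem qabs_zpow_neg_mul_le_one_iff {β : D} (hβ : qabs L β = absUnif L) {n : ℤ} {x : D} :
    qabs L (β ^ (-n) * x) ≤ 1 ↔ MemIdealPow L n x := by
  have h0 := zpow_pos (absUnif_pos L) n
  rw [qabs_mul, qabs_zpow_uniformizer hβ, memIdealPow_iff, zpow_neg, inv_mul_le_iff₀ h0, mul_one]

theorem qabs_zpow_neg_mul_lt_one_iff {β : D} (hβ : qabs L β = absUnif L) {n : ℤ} {x : D} :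
    qabs L (β ^ (-n) * x) < 1 ↔ MemIdealPow L (n + 1) x := by
  have h0 := zpow_pos (absUnif_pos L) n
  rw [qabs_mul, qabs_zpow_uniformizer hβ, memIdealPow_succ_iff_lt, zpow_neg, inv_mul_lt_iff₀ h0,
    mul_one]

theorem idealPow_mono {n m : ℤ} (h : n ≤ m) : idealPow L D m ≤ idealPow L D n :=
  fun _ hx => MemIdealPow.mono h hx

/-- The isomorphism `𝔓 ^ n / 𝔓 ^ (n + 1) ≅ k_D` given by a uniformizer. -/
def gradedMap {β : D} (hβ : qabs L β = absUnif L) (n : ℤ) :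
    idealPow L D n →+ quatResidueField L D where
  toFun x := quatResidue L D ⟨β ^ (-n) * x, (qabs_zpow_neg_mul_le_one_iff hβ).mpr x.2⟩
  map_zero' := by
    rw [quatResidue_eq_zero_iff]
    change qabs L (β ^ (-n) * 0) < 1
    rw [mul_zero, qabs_zero]; exact zero_lt_one
  map_add' x y := by
    rw [← map_add]
    congr 1
    exact Subtype.ext (mul_add _ _ _)

theorem gradedMap_eq_zero_iff {β : D} (hβ : qabs L β = absUnif L) (n : ℤ) (x : idealPow L D n) :
    gradedMap hβ n x = 0 ↔ MemIdealPow L (n + 1) (x : D) := by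
  rw [← qabs_zpow_neg_mul_lt_one_iff hβ]
  exact quatResidue_eq_zero_iff L D _

theorem gradedMap_surjective {β : D} (hβ : qabs L β = absUnif L) (n : ℤ) :
    Function.Surjective (gradedMap hβ n) := by
  intro y
  obtain ⟨y, rfl⟩ := quatResidue_surjective L D y
  have hβn : β ^ n ≠ 0 := zpow_ne_zero n (ne_zero_of_qabs_eq_absUnif hβ)
  have e : β ^ (-n) * (β ^ n * y) = y := by rw [zpow_neg, inv_mul_cancel_left₀ hβn]
  refine ⟨⟨β ^ n * y, (qabs_zpow_neg_mul_le_one_iff hβ).mp (by rw [e]; exact y.2)⟩, ?_⟩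
  change quatResidue L D _ = quatResidue L D y
  exact congrArg (quatResidue L D) (Subtype.ext e)

variable (L D) in
theorem relIndex_idealPow_succ (n : ℤ) :
    (idealPow L D (n + 1)).relIndex (idealPow L D n) = resCard L ^ 2 := by
  obtain ⟨β, hβ⟩ := exists_qabs_eq_absUnif L D
  have hker : (idealPow L D (n + 1)).addSubgroupOf (idealPow L D n) = (gradedMap hβ n).ker := by
    ext x
    rw [AddSubgroup.mem_addSubgroupOf, AddMonoidHom.mem_ker, gradedMap_eq_zero_iff]; rfl
  rw [AddSubgroup.relIndex, hker, AddSubgroup.index_ker,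
    AddMonoidHom.range_eq_top.mpr (gradedMap_surjective hβ n), AddSubgroup.card_top,
    card_quatResidueField]

variable (L D) in
theorem relIndex_idealPow (n : ℤ) (k : ℕ) :
    (idealPow L D (n + k)).relIndex (idealPow L D n) = resCard L ^ (2 * k) := by
  induction k with
  | zero => simp
  | succ k ih =>
    have h := AddSubgroup.relIndex_mul_relIndex (idealPow L D (n + k + 1)) (idealPow L D (n + k))
      (idealPow L D n) (idealPow_mono (by omega)) (idealPow_mono (by omega))
    rw [ih, relIndex_idealPow_succ] at h
    push_cast
    rw [← add_assoc, ← h, ← pow_add]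
    congr 1; ring

variable (D) in
/-- The additive character `ψ_D = ψ_L ∘ Trd`. -/
def quatAddChar (ψ : AddChar ℚ_[p] (PadicAlgCl p)) : AddChar D (PadicAlgCl p) :=
  ψ.compAddMonoidHom ((Algebra.trace ℚ_[p] L).toAddMonoidHom.comp (redTraceLin L D).toAddMonoidHom)

theorem quatAddChar_apply (ψ : AddChar ℚ_[p] (PadicAlgCl p)) (x : D) :
    quatAddChar (L := L) D ψ x = addCharOf ψ L (redTrace L x) := rfl

variable {ψ : AddChar ℚ_[p] (PadicAlgCl p)}

theorem norm_algHom_eq (σ : L →ₐ[ℚ_[p]] PadicAlgCl p) (x : L) :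
    ‖σ x‖ = ‖(x : PadicAlgCl p)‖ := by
  have h1 : minpoly ℚ_[p] (σ x) = minpoly ℚ_[p] x := minpoly.algHom_eq σ σ.injective x
  have h2 : minpoly ℚ_[p] (x : PadicAlgCl p) = minpoly ℚ_[p] x :=
    minpoly.algebraMap_eq (algebraMap L (PadicAlgCl p)).injective x
  rw [← PadicAlgCl.spectralNorm_eq, ← PadicAlgCl.spectralNorm_eq, spectralNorm, spectralNorm, h1, h2]

theorem norm_trace_le_one {x : L} (hx : ‖(x : PadicAlgCl p)‖ ≤ 1) :
    ‖Algebra.trace ℚ_[p] L x‖ ≤ 1 := by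
  rw [← PadicAlgCl.norm_extends]
  rw [trace_eq_sum_embeddings]
  exact IsUltrametricDist.norm_sum_le_of_forall_le_of_nonneg zero_le_one
    fun σ _ => (norm_algHom_eq σ x).le.trans hx

variable (L) in
theorem exists_one_lt_norm_trace : ∃ x : L, x ≠ 0 ∧ 1 < ‖Algebra.trace ℚ_[p] L x‖ := by
  have hd : (0 : ℝ) < ‖(Module.finrank ℚ_[p] L : ℚ_[p])‖ := by
    rw [norm_pos_iff]
    exact_mod_cast (Module.finrank_pos (R := ℚ_[p]) (M := L)).ne'
  obtain ⟨k, hk⟩ := pow_unbounded_of_one_lt ‖(Module.finrank ℚ_[p] L : ℚ_[p])‖⁻¹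
    (one_lt_prime_cast (p := p))
  refine ⟨algebraMap ℚ_[p] L ((p : ℚ_[p]) ^ k)⁻¹, ?_, ?_⟩
  · rw [Ne, map_eq_zero, inv_eq_zero]
    exact pow_ne_zero _ (by exact_mod_cast (Fact.out : p.Prime).ne_zero)
  · rw [Algebra.trace_algebraMap, nsmul_eq_mul, norm_mul, norm_inv, norm_pow, Padic.norm_p,
      inv_pow, inv_inv]
    rwa [inv_lt_iff_one_lt_mul₀ hd, mul_comm] at hk

variable (L) in
-- A supremum of integers is meaningful only for a nonempty set bounded above. Here `0` belongs to
-- the set, and an element with nonintegral trace bounds it.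
theorem isGreatest_addLevel (hψ : ∀ x, ψ x = 1 ↔ ‖x‖ ≤ 1) :
    IsGreatest {n : ℤ | ∀ x : L, ‖(x : PadicAlgCl p)‖ ≤ absUnif L ^ (-n) → addCharOf ψ L x = 1}
      (addLevel ψ L) := by
  have hne : {n : ℤ | ∀ x : L, ‖(x : PadicAlgCl p)‖ ≤ absUnif L ^ (-n) →
      addCharOf ψ L x = 1}.Nonempty := by
    refine ⟨0, fun x hx => ?_⟩
    rw [neg_zero, zpow_zero] at hx
    rw [addCharOf, hψ]
    exact norm_trace_le_one hx
  have hbdd : BddAbove {n : ℤ | ∀ x : L, ‖(x : PadicAlgCl p)‖ ≤ absUnif L ^ (-n) →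
      addCharOf ψ L x = 1} := by
    obtain ⟨x, hx0, hx⟩ := exists_one_lt_norm_trace L
    obtain ⟨k, hk⟩ := exists_norm_eq_absUnif_zpow hx0
    refine ⟨-k, fun n hn => ?_⟩
    by_contra hlt
    push Not at hlt
    have h1 := hn x (by rw [hk, absUnif_zpow_le_iff]; omega)
    rw [addCharOf, hψ] at h1
    exact absurd h1 (not_le.mpr hx)
  exact ⟨Int.csSup_mem hne hbdd, fun n hn => le_csSup hbdd hn⟩

/-- `Trd(𝔓_D ^ (2 j - 1)) = 𝔭_L ^ j`. -/
theorem norm_redTrace_le {x : D} {j : ℤ} (hx : MemIdealPow L (2 * j - 1) x) :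
    ‖(redTrace L x : PadicAlgCl p)‖ ≤ absUnif L ^ j := by
  rcases eq_or_ne (redTrace L x) 0 with h0 | h0
  · rw [h0]; simpa using (zpow_pos (absUnif_pos L) j).le
  obtain ⟨k, hk⟩ := exists_norm_eq_absUnif_zpow h0
  have h1 := (norm_redTrace_sq_le (L := L) x).trans (memIdealPow_iff.mp hx)
  have e2 : (absUnif L ^ k) ^ 2 = absUnif L ^ (k * 2) := by rw [zpow_mul]; rfl
  rw [hk, e2, absUnif_zpow_le_iff] at h1
  rw [hk, absUnif_zpow_le_iff]
  omega

variable (D) in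
theorem exists_redTrace_eq {a : L} {j : ℤ} (ha : ‖(a : PadicAlgCl p)‖ ≤ absUnif L ^ j) :
    ∃ x : D, MemIdealPow L (2 * j) x ∧ redTrace L x = a := by
  obtain ⟨y, hy, hy1⟩ := exists_norm_redTrace_eq_one L D
  have h0 : redTrace L y ≠ 0 := by intro h; rw [h] at hy1; simp at hy1
  refine ⟨(a / redTrace L y) • y, ?_, ?_⟩
  · rw [memIdealPow_iff, Algebra.smul_def, qabs_mul, qabs_algebraMap]
    push_cast
    rw [norm_div, hy1, div_one, mul_comm 2, zpow_mul]
    calc _ ≤ ‖(a : PadicAlgCl p)‖ ^ 2 * 1 := by gcongr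
      _ ≤ _ := by rw [mul_one]; exact pow_le_pow_left₀ (norm_nonneg _) ha 2
  · rw [redTrace_smul, div_mul_cancel₀ _ h0]

/-- The reduced trace maps both `𝔓_D ^ (2 j - 1)` and `𝔓_D ^ (2 j)` onto the same ideal of `L`. This
makes the level of `ψ_D` odd, which later forces `α` to be a uniformizer up to the centre. -/
theorem quatAddLevel_mem_iff (hψ : ∀ x, ψ x = 1 ↔ ‖x‖ ≤ 1) (n : ℤ) :
    (∀ x : D, MemIdealPow L (-n) x → addCharOf ψ L (redTrace L x) = 1) ↔
      n ≤ 2 * addLevel ψ L + 1 := by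
  have hg := isGreatest_addLevel L hψ
  constructor
  · intro h
    by_contra hlt
    push Not at hlt
    have hmem : addLevel ψ L + 1 ∈ {n : ℤ | ∀ x : L, ‖(x : PadicAlgCl p)‖ ≤ absUnif L ^ (-n) →
        addCharOf ψ L x = 1} := by
      intro a ha
      obtain ⟨x, hx, rfl⟩ := exists_redTrace_eq D ha
      exact h x (hx.mono (by omega))
    have := hg.2 hmem
    omega
  · intro hle x hx
    exact hg.1 _ (norm_redTrace_le (hx.mono (by omega)))

theorem quatAddLevel_eq (hψ : ∀ x, ψ x = 1 ↔ ‖x‖ ≤ 1) :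
    quatAddLevel L D ψ = 2 * addLevel ψ L + 1 := by
  have : IsGreatest {n : ℤ | ∀ x : D, MemIdealPow L (-n) x → addCharOf ψ L (redTrace L x) = 1}
      (2 * addLevel ψ L + 1) :=
    ⟨(quatAddLevel_mem_iff hψ _).mpr le_rfl, fun n hn => (quatAddLevel_mem_iff hψ n).mp hn⟩
  exact this.csSup_eq

theorem quatAddChar_trivial_iff (hψ : ∀ x, ψ x = 1 ↔ ‖x‖ ≤ 1) (k : ℤ) :
    (∀ x : D, MemIdealPow L k x → quatAddChar (L := L) D ψ x = 1) ↔
      -quatAddLevel L D ψ ≤ k := by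
  have := quatAddLevel_mem_iff (L := L) (D := D) hψ (-k)
  rw [neg_neg] at this
  rw [quatAddLevel_eq hψ]
  exact this.trans (by omega)

/-- `ψ_D` is trivial on `α 𝔓 ^ k` if and only if `α ∈ 𝔓 ^ (-n(ψ_D) - k)`. -/
theorem quatAddChar_mul_trivial_iff (hψ : ∀ x, ψ x = 1 ↔ ‖x‖ ≤ 1) (α : D) (k : ℤ) :
    (∀ x : D, MemIdealPow L k x → quatAddChar (L := L) D ψ (α * x) = 1) ↔
      MemIdealPow L (-quatAddLevel L D ψ - k) α := by
  rcases eq_or_ne α 0 with rfl | hα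
  · simp [memIdealPow_zero]
  obtain ⟨v, hv⟩ := exists_qabs_eq_zpow (L := L) hα
  have h1 : (∀ x : D, MemIdealPow L k x → quatAddChar (L := L) D ψ (α * x) = 1) ↔
      (∀ x : D, MemIdealPow L (v + k) x → quatAddChar (L := L) D ψ x = 1) := by
    constructor
    · intro h x hx
      have hx' : MemIdealPow L k (α⁻¹ * x) := by
        have : MemIdealPow L (-v) α⁻¹ := by
          rw [memIdealPow_iff, qabs_inv, hv, zpow_neg]
        have h2 := this.mul hx
        rwa [neg_add_cancel_left] at h2
      have h2 := h _ hx'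
      rwa [mul_inv_cancel_left₀ hα] at h2
    · intro h x hx
      exact h _ (MemIdealPow.mul (memIdealPow_iff.mpr hv.le) hx)
  rw [h1, quatAddChar_trivial_iff hψ, memIdealPow_iff, hv, absUnif_zpow_le_iff]
  omega

/-- The pairing `x ↦ ψ_D(α x)` on `𝔓 ^ i / 𝔓 ^ j`. -/
def quotientPairing (hψ : ∀ x, ψ x = 1 ↔ ‖x‖ ≤ 1) (i j : ℤ) :
    Multiplicative (idealPow L D (-quatAddLevel L D ψ - j)) →* (Multiplicative
      (idealPow L D i ⧸ (idealPow L D j).addSubgroupOf (idealPow L D i)) →* (PadicAlgCl p)ˣ) where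
  toFun α := AddMonoidHom.toMultiplicativeLeft (QuotientAddGroup.lift _
      (AddMonoidHom.toMultiplicativeLeft.symm
        (((quatAddChar (L := L) D ψ).compAddMonoidHom
          ((AddMonoidHom.mulLeft (α.toAdd : D)).comp
            (idealPow L D i).subtype)).toMonoidHom.toHomUnits))
      (fun x hx => by
        apply Additive.toMul.injective
        apply Units.ext
        exact (quatAddChar_mul_trivial_iff hψ (α.toAdd : D) j).mpr α.toAdd.2 x
          (AddSubgroup.mem_addSubgroupOf.mp hx)))
  map_one' := by
    ext x
    change quatAddChar (L := L) D ψ ((0 : D) * x) = 1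
    rw [zero_mul, AddChar.map_zero_eq_one]
  map_mul' α α' := by
    ext x
    change quatAddChar (L := L) D ψ (((α.toAdd : D) + α'.toAdd) * x) =
      quatAddChar (L := L) D ψ (α.toAdd * x) * quatAddChar (L := L) D ψ (α'.toAdd * x)
    rw [add_mul, AddChar.map_add_eq_mul]

theorem quotientPairing_apply (hψ : ∀ x, ψ x = 1 ↔ ‖x‖ ≤ 1) (i j : ℤ)
    (α : idealPow L D (-quatAddLevel L D ψ - j)) (x : idealPow L D i) :
    ((quotientPairing hψ i j (Multiplicative.ofAdd α) (Multiplicative.ofAdd (QuotientAddGroup.mk x)) :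
      (PadicAlgCl p)ˣ) : PadicAlgCl p) = quatAddChar (L := L) D ψ ((α : D) * x) := rfl

/-- Every character of `𝔓 ^ i / 𝔓 ^ j` is of the form `x ↦ ψ_D(α x)`. -/
theorem exists_eq_quatAddChar_mul (hψ : ∀ x, ψ x = 1 ↔ ‖x‖ ≤ 1) {i j : ℤ} (hij : i ≤ j)
    (g : AddChar (idealPow L D i) (PadicAlgCl p))
    (hg : ∀ x : idealPow L D i, MemIdealPow L j (x : D) → g x = 1) :
    ∃ α : D, ∀ x : idealPow L D i, g x = quatAddChar (L := L) D ψ (α * x) := by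
  obtain ⟨k, rfl⟩ := Int.le.dest hij
  set A := idealPow L D i ⧸ (idealPow L D (i + k)).addSubgroupOf (idealPow L D i)
  have hcardA : Nat.card A = resCard L ^ (2 * k) := relIndex_idealPow L D i k
  have hq : 0 < resCard L := zero_lt_one.trans (one_lt_resCard L)
  have : Finite A := Nat.finite_of_card_ne_zero (by rw [hcardA]; positivity)
  have hcardH : Nat.card (Multiplicative A →* (PadicAlgCl p)ˣ) = resCard L ^ (2 * k) := by
    rw [CommGroup.card_monoidHom_of_hasEnoughRootsOfUnity, ← hcardA]; rfl
  have : Finite (Multiplicative A →* (PadicAlgCl p)ˣ) :=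
    Nat.finite_of_card_ne_zero (by rw [hcardH]; positivity)
  set Φ := quotientPairing (L := L) (D := D) hψ i (i + k)
  have hker : Φ.ker = AddSubgroup.toSubgroup
      ((idealPow L D (-quatAddLevel L D ψ - i)).addSubgroupOf
        (idealPow L D (-quatAddLevel L D ψ - (i + k)))) := by
    ext α
    change Φ α = 1 ↔ MemIdealPow L (-quatAddLevel L D ψ - i) (α.toAdd : D)
    rw [← quatAddChar_mul_trivial_iff hψ]
    constructor
    · intro h x hx
      have h1 := quotientPairing_apply hψ i (i + k) α.toAdd ⟨x, hx⟩
      rw [← h1]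
      change ((Φ α _ : (PadicAlgCl p)ˣ) : PadicAlgCl p) = 1
      rw [h]; rfl
    · intro h
      ext x
      exact h x x.2
  -- The kernel has been identified, so the image has `q ^ (2 k)` elements, as many as the whole
  -- dual group.
  have hrange : Φ.range = ⊤ := by
    have h1 : Nat.card Φ.range = resCard L ^ (2 * k) := by
      rw [← Subgroup.index_ker, hker, AddSubgroup.index_toSubgroup]
      have := relIndex_idealPow L D (-quatAddLevel L D ψ - (i + k)) k
      rw [show -quatAddLevel L D ψ - (i + k) + (k : ℤ) = -quatAddLevel L D ψ - i by ring] at this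
      exact this
    apply Subgroup.eq_top_of_card_eq
    rw [h1, ← hcardH]
  let G : Multiplicative A →* (PadicAlgCl p)ˣ :=
    AddMonoidHom.toMultiplicativeLeft (QuotientAddGroup.lift _
      (AddMonoidHom.toMultiplicativeLeft.symm g.toMonoidHom.toHomUnits) (fun x hx => by
        apply Additive.toMul.injective
        apply Units.ext
        exact hg x (AddSubgroup.mem_addSubgroupOf.mp hx)))
  obtain ⟨α, hα⟩ : G ∈ Φ.range := by rw [hrange]; trivial
  refine ⟨α.toAdd, fun x => ?_⟩
  rw [← quotientPairing_apply hψ i (i + k) α.toAdd x]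
  change _ = ((Φ α _ : (PadicAlgCl p)ˣ) : PadicAlgCl p)
  rw [hα]
  rfl

end Quaternion

/-! ### Congruence subgroups and the stabilizers of a uniformizer -/

section Quaternion

variable {p : ℕ} [Fact p.Prime] {L : LocalField p}
  {D : Type*} [DivisionRing D] [Algebra L D]
  [Algebra.IsCentral L D] [hD : Fact (Module.finrank L D = 4)] [FiniteDimensional ℚ_[p] L]

theorem mem_unitGroup_iff {g : Dˣ} : g ∈ unitGroup L D ↔ qabs L (g : D) = 1 := by
  change quatAbs L (g : D) = 1 ↔ _
  rw [quatAbs_eq_qabs_sq, pow_eq_one_iff_of_nonneg (qabs_nonneg _) two_ne_zero]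

theorem qabs_unit (g : unitGroup L D) : qabs L ((g : Dˣ) : D) = 1 := mem_unitGroup_iff.mp g.2

/-- The element of `𝒪_D^×` given by an element of absolute value one. -/
def mkUnit (x : D) (hx : qabs L x = 1) : unitGroup L D :=
  ⟨Units.mk0 x fun h => by rw [h, qabs_zero] at hx; exact zero_ne_one hx,
    mem_unitGroup_iff.mpr hx⟩

@[simp] theorem coe_mkUnit (x : D) (hx : qabs L x = 1) :
    (((mkUnit x hx : unitGroup L D) : Dˣ) : D) = x := rfl

theorem memIdealPow_unit_mul {n : ℤ} (g : unitGroup L D) {x : D} :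
    MemIdealPow L n (((g : Dˣ) : D) * x) ↔ MemIdealPow L n x := by
  rw [memIdealPow_iff, memIdealPow_iff, qabs_mul, qabs_unit, one_mul]

theorem memIdealPow_mul_unit {n : ℤ} (g : unitGroup L D) {x : D} :
    MemIdealPow L n (x * ((g : Dˣ) : D)) ↔ MemIdealPow L n x := by
  rw [memIdealPow_iff, memIdealPow_iff, qabs_mul, qabs_unit, mul_one]

theorem coe_inv_unit (g : unitGroup L D) : (((g⁻¹ : unitGroup L D) : Dˣ) : D) = ((g : Dˣ) : D)⁻¹ := by
  simp

variable (L D) in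
/-- The congruence subgroups `U_D ^ i` of `𝒪_D^×`. -/
def unitFiltration (i : ℕ) : Subgroup (unitGroup L D) where
  carrier := {g | MemIdealPow L (i : ℤ) (((g : Dˣ) : D) - 1)}
  mul_mem' {a b} ha hb := by
    have e : (((a * b : unitGroup L D) : Dˣ) : D) - 1 =
      ((a : Dˣ) : D) * (((b : Dˣ) : D) - 1) + (((a : Dˣ) : D) - 1) := by
      simp [mul_sub]
    change MemIdealPow L _ _
    rw [e]
    exact ((memIdealPow_unit_mul a).mpr hb).add ha
  one_mem' := by simp [memIdealPow_zero]
  inv_mem' {a} ha := by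
    change MemIdealPow L _ _
    rw [← memIdealPow_unit_mul a]
    have e : ((a : Dˣ) : D) * ((((a⁻¹ : unitGroup L D) : Dˣ) : D) - 1) =
      -(((a : Dˣ) : D) - 1) := by
      rw [mul_sub, mul_one, neg_sub]; simp
    rw [e]
    exact MemIdealPow.neg ha

theorem mem_unitFiltration {i : ℕ} {g : unitGroup L D} :
    g ∈ unitFiltration L D i ↔ MemIdealPow L (i : ℤ) (((g : Dˣ) : D) - 1) := Iff.rfl

theorem unitFiltration_anti {i j : ℕ} (h : i ≤ j) : unitFiltration L D j ≤ unitFiltration L D i :=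
  fun _ hg => MemIdealPow.mono (by exact_mod_cast h) hg

theorem inv_mul_mem_unitFiltration {i : ℕ} {g h : unitGroup L D} :
    g⁻¹ * h ∈ unitFiltration L D i ↔ MemIdealPow L (i : ℤ) (((h : Dˣ) : D) - ((g : Dˣ) : D)) := by
  rw [mem_unitFiltration, ← memIdealPow_unit_mul g]
  congr! 1
  simp [mul_sub]

theorem conj_sub_one (g h : Dˣ) : ((g * h * g⁻¹ : Dˣ) : D) - 1 = g * ((h : D) - 1) * (g : D)⁻¹ := by
  simp [mul_sub, sub_mul]

instance normal_unitFiltration (i : ℕ) : (unitFiltration L D i).Normal where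
  conj_mem n hn g := by
    rw [mem_unitFiltration, memIdealPow_iff] at *
    change qabs L ((((g : Dˣ) * n * (g : Dˣ)⁻¹ : Dˣ) : D) - 1) ≤ _
    rw [conj_sub_one, qabs_conj (Units.ne_zero _)]
    exact hn

theorem memIdealPow_one_iff {x : D} : MemIdealPow L 1 x ↔ qabs L x < 1 := by
  have := memIdealPow_succ_iff_lt (L := L) (n := 0) (x := x)
  simpa using this

theorem memIdealPow_zero_iff {x : D} : MemIdealPow L 0 x ↔ qabs L x ≤ 1 := by
  rw [memIdealPow_iff, zpow_zero]

theorem qabs_one_add_eq_one {x : D} (h : MemIdealPow L 1 x) : qabs L (1 + x) = 1 := by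
  have := qabs_eq_of_sub_lt (L := L) (x := 1 + x) (y := 1)
    (by rw [add_sub_cancel_left, qabs_one]; exact memIdealPow_one_iff.mp h)
  rw [this, qabs_one]

variable (L D) in
/-- The reduction `𝒪_D^× → k_D^×`. -/
def unitResidue : unitGroup L D →* (quatResidueField L D)ˣ :=
  MonoidHom.toHomUnits
    { toFun := fun g => quatResidue L D ⟨((g : Dˣ) : D), (qabs_unit g).le⟩
      map_one' := by rw [← map_one (quatResidue L D)]; rfl
      map_mul' := fun a b => by rw [← map_mul (quatResidue L D)]; rfl }

theorem coe_unitResidue (g : unitGroup L D) :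
    (unitResidue L D g : quatResidueField L D) =
      quatResidue L D ⟨((g : Dˣ) : D), (qabs_unit g).le⟩ := rfl

theorem qabs_eq_one_of_quatResidue_ne_zero {x : quatInt L D} (h : quatResidue L D x ≠ 0) :
    qabs L (x : D) = 1 := by
  rw [Ne, quatResidue_eq_zero_iff, not_lt] at h
  exact le_antisymm x.2 h

variable (L D) in
theorem unitResidue_surjective : Function.Surjective (unitResidue L D) := by
  intro y
  obtain ⟨x, hx⟩ := quatResidue_surjective L D (y : quatResidueField L D)
  refine ⟨mkUnit (x : D) (qabs_eq_one_of_quatResidue_ne_zero (by rw [hx]; exact y.ne_zero)), ?_⟩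
  exact Units.ext hx

theorem ker_unitResidue : (unitResidue L D).ker = unitFiltration L D 1 := by
  ext g
  rw [MonoidHom.mem_ker, mem_unitFiltration, Nat.cast_one, memIdealPow_one_iff, Units.ext_iff,
    coe_unitResidue, Units.val_one, ← map_one (quatResidue L D), quatResidue_eq_iff]
  rfl

/-- The stabilizer in `𝒪_D^×` of `β` modulo `𝔓 ^ (i + 1)`. -/
def conjStabilizer (L : LocalField p) [FiniteDimensional ℚ_[p] L] {D : Type*} [DivisionRing D]
    [Algebra L D] [Algebra.IsCentral L D] [Fact (Module.finrank L D = 4)] (β : D) (i : ℕ) :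
    Subgroup (unitGroup L D) where
  carrier := {g | MemIdealPow L (i + 1) (((g : Dˣ) : D) * β - β * ((g : Dˣ) : D))}
  mul_mem' {a b} ha hb := by
    have e : (((a * b : unitGroup L D) : Dˣ) : D) * β - β * ((a * b : unitGroup L D) : Dˣ) =
      ((a : Dˣ) : D) * (((b : Dˣ) : D) * β - β * ((b : Dˣ) : D)) +
        (((a : Dˣ) : D) * β - β * ((a : Dˣ) : D)) * ((b : Dˣ) : D) := by
      simp only [Subgroup.coe_mul, Units.val_mul]; noncomm_ring
    change MemIdealPow L _ _
    rw [e]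
    exact ((memIdealPow_unit_mul a).mpr hb).add ((memIdealPow_mul_unit b).mpr ha)
  one_mem' := by simp [memIdealPow_zero]
  inv_mem' {a} ha := by
    change MemIdealPow L _ _
    rw [← memIdealPow_unit_mul a, ← memIdealPow_mul_unit a]
    have e : ((a : Dˣ) : D) * ((((a⁻¹ : unitGroup L D) : Dˣ) : D) * β -
        β * (((a⁻¹ : unitGroup L D) : Dˣ) : D)) * ((a : Dˣ) : D) =
      -(((a : Dˣ) : D) * β - β * ((a : Dˣ) : D)) := by
      have h0 := Units.ne_zero (a : Dˣ)
      rw [coe_inv_unit, mul_sub, sub_mul, mul_inv_cancel_left₀ h0, ← mul_assoc _ β,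
        inv_mul_cancel_right₀ h0, neg_sub]
    rw [e]
    exact MemIdealPow.neg ha

theorem mem_conjStabilizer {β : D} {i : ℕ} {g : unitGroup L D} :
    g ∈ conjStabilizer L β i ↔
      MemIdealPow L (i + 1) (((g : Dˣ) : D) * β - β * ((g : Dˣ) : D)) := Iff.rfl

theorem conjStabilizer_anti (β : D) {i j : ℕ} (h : i ≤ j) :
    conjStabilizer L β j ≤ conjStabilizer L β i :=
  fun _ hg => MemIdealPow.mono (by exact_mod_cast Nat.succ_le_succ h) hg

theorem unitFiltration_le_conjStabilizer {β : D} (hβ : qabs L β = absUnif L) (i : ℕ) :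
    unitFiltration L D i ≤ conjStabilizer L β i := by
  intro g hg
  have hβ' : MemIdealPow L 1 β := by rw [memIdealPow_iff, hβ, zpow_one]
  rw [mem_conjStabilizer]
  have e : ((g : Dˣ) : D) * β - β * ((g : Dˣ) : D) =
    (((g : Dˣ) : D) - 1) * β - β * (((g : Dˣ) : D) - 1) := by noncomm_ring
  rw [e]
  have h1 : MemIdealPow L (i + 1) ((((g : Dˣ) : D) - 1) * β) := MemIdealPow.mul hg hβ'
  have h2 : MemIdealPow L (1 + i) (β * (((g : Dˣ) : D) - 1)) := MemIdealPow.mul hβ' hg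
  rw [add_comm] at h2
  exact h1.sub h2

/-- For `x ∈ 𝔓 ^ i` that commutes with `β` modulo `𝔓 ^ (i + 2)`, the leading coefficient is
central. -/
theorem exists_sub_mul_pow_memIdealPow {β x : D} (hβ : qabs L β = absUnif L) (i : ℕ)
    (hx : MemIdealPow L i x) (h : MemIdealPow L (i + 2) (x * β - β * x)) :
    ∃ a : L, ‖(a : PadicAlgCl p)‖ ≤ 1 ∧ MemIdealPow L (i + 1) (x - algebraMap L D a * β ^ i) := by
  have h0 := ne_zero_of_qabs_eq_absUnif hβ
  have hi : qabs L (x * (β ^ i)⁻¹) ≤ 1 := by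
    rw [qabs_mul, qabs_inv, qabs_pow, hβ, ← div_eq_mul_inv, div_le_one (pow_pos (absUnif_pos L) _)]
    simpa using memIdealPow_iff.mp hx
  -- The bound on the commutator says that the residue of `x * (β ^ i)⁻¹` is fixed by conjugation by
  -- `β`, that is, by Frobenius; so it lies in `k_L`.
  obtain ⟨a, ha, h'⟩ := exists_integer_sub_lt_of_conj hβ hi (by
    have e : β * (x * (β ^ i)⁻¹) * β⁻¹ - x * (β ^ i)⁻¹ =
        -(x * β - β * x) * (β ^ (i + 1))⁻¹ := by
      have e1 : (β ^ (i + 1))⁻¹ = (β ^ i)⁻¹ * β⁻¹ := by rw [pow_succ', mul_inv_rev]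
      have e2 : (β ^ (i + 1))⁻¹ = β⁻¹ * (β ^ i)⁻¹ := by rw [pow_succ, mul_inv_rev]
      have e3 : x * (β ^ i)⁻¹ = x * β * (β ^ (i + 1))⁻¹ := by
        rw [e2, ← mul_assoc, mul_inv_cancel_right₀ h0]
      have e4 : β * (x * (β ^ i)⁻¹) * β⁻¹ = β * x * (β ^ (i + 1))⁻¹ := by
        rw [e1]; simp only [mul_assoc]
      rw [e4, e3, neg_mul, sub_mul, neg_sub]
    rw [e, qabs_mul, qabs_inv, qabs_pow, qabs_neg, hβ, ← div_eq_mul_inv,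
      div_lt_one (pow_pos (absUnif_pos L) _)]
    have h3 : MemIdealPow L ((i : ℤ) + 1 + 1) (x * β - β * x) := by
      rwa [add_assoc, one_add_one_eq_two]
    have h4 := memIdealPow_succ_iff_lt.mp h3
    rwa [← Nat.cast_succ, zpow_natCast] at h4)
  refine ⟨a, ha, memIdealPow_succ_iff_lt.mpr ?_⟩
  have e : x - algebraMap L D a * β ^ i = (x * (β ^ i)⁻¹ - algebraMap L D a) * β ^ i := by
    rw [sub_mul, inv_mul_cancel_right₀ (pow_ne_zero _ h0)]
  rw [e, qabs_mul, qabs_pow, hβ, zpow_natCast]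
  exact mul_lt_of_lt_one_left (pow_pos (absUnif_pos L) _) h'

theorem memIdealPow_commutator_of_sub_mul_pow {β x : D} (hβ : qabs L β = absUnif L) (i : ℕ) (a : L)
    (h : MemIdealPow L (i + 1) (x - algebraMap L D a * β ^ i)) :
    MemIdealPow L (i + 2) (x * β - β * x) := by
  have hβ' : MemIdealPow L 1 β := by rw [memIdealPow_iff, hβ, zpow_one]
  have hc : algebraMap L D a * β ^ i * β = β * (algebraMap L D a * β ^ i) := by
    rw [← mul_assoc, ← Algebra.commutes a β, mul_assoc, mul_assoc, ← pow_succ, ← pow_succ']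
  have e : x * β - β * x = (x - algebraMap L D a * β ^ i) * β -
      β * (x - algebraMap L D a * β ^ i) := by
    rw [sub_mul, mul_sub, hc]; abel
  rw [e]
  have h1 := h.mul hβ'
  have h2 := hβ'.mul h
  rw [show (i : ℤ) + 1 + 1 = i + 2 by ring] at h1
  rw [show (1 : ℤ) + (i + 1) = i + 2 by ring] at h2
  exact h1.sub h2

/-- An element of `𝒪_D^×` commuting with `β` modulo `𝔓 ^ (i + 1)` is congruent modulo `U_D ^ i` to
one that commutes with `β`. -/
theorem exists_commute_mem_unitFiltration {β : D} (hβ : qabs L β = absUnif L) (i : ℕ)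
    {g : unitGroup L D} (hg : g ∈ conjStabilizer L β i) :
    ∃ c : unitGroup L D, Commute ((c : Dˣ) : D) β ∧ c⁻¹ * g ∈ unitFiltration L D i := by
  induction i generalizing g with
  | zero =>
    refine ⟨1, by simp, ?_⟩
    rw [inv_mul_mem_unitFiltration, Nat.cast_zero, memIdealPow_zero_iff]
    exact (qabs_sub_le _ _).trans (max_le (qabs_unit _).le (qabs_unit _).le)
  | succ i ih =>
    obtain ⟨c, hc, hcg⟩ := ih (conjStabilizer_anti β (Nat.le_succ i) hg)
    have hc1 : c ∈ conjStabilizer L β (i + 1) := by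
      rw [mem_conjStabilizer, hc.eq, sub_self]; exact memIdealPow_zero
    set u := c⁻¹ * g with hu
    have hu1 : u ∈ conjStabilizer L β (i + 1) := mul_mem (inv_mem hc1) hg
    -- At level `0` the residue of `u` itself is that of a central unit. At higher levels the
    -- leading term of `u - 1` is removed by the factor `1 + a * β ^ i`, which commutes with `β`.
    rcases Nat.eq_zero_or_pos i with rfl | hi
    · obtain ⟨a, ha, h⟩ := exists_sub_mul_pow_memIdealPow hβ 0
        (x := ((u : Dˣ) : D)) (by rw [Nat.cast_zero, memIdealPow_zero_iff]; exact (qabs_unit u).le)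
        (by rw [mem_conjStabilizer] at hu1; simpa using hu1)
      rw [pow_zero, mul_one, Nat.cast_zero, zero_add, memIdealPow_one_iff] at h
      have ha1 : qabs L (algebraMap L D a) = 1 := by
        rw [qabs_sub_comm] at h
        rw [qabs_eq_of_sub_lt (h.trans_eq (qabs_unit u).symm), qabs_unit]
      refine ⟨c * mkUnit _ ha1, ?_, ?_⟩
      · simp only [Subgroup.coe_mul, Units.val_mul, coe_mkUnit]
        exact hc.mul_left (Algebra.commutes a β)
      · rw [mul_inv_rev, mul_assoc, ← hu, inv_mul_mem_unitFiltration, coe_mkUnit]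
        simpa [memIdealPow_one_iff] using h
    · obtain ⟨a, ha, h⟩ := exists_sub_mul_pow_memIdealPow hβ i (x := ((u : Dˣ) : D) - 1) hcg (by
        rw [mem_conjStabilizer] at hu1
        have e : (((u : Dˣ) : D) - 1) * β - β * (((u : Dˣ) : D) - 1) =
          ((u : Dˣ) : D) * β - β * ((u : Dˣ) : D) := by noncomm_ring
        rw [e]
        push_cast at hu1
        rwa [add_assoc, one_add_one_eq_two] at hu1)
      have hy : MemIdealPow L i (algebraMap L D a * β ^ i) := by
        rw [memIdealPow_iff, qabs_mul, qabs_algebraMap, qabs_pow, hβ, zpow_natCast]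
        exact mul_le_of_le_one_left (pow_nonneg (absUnif_pos L).le _) (pow_le_one₀ (norm_nonneg _) ha)
      have hy1 : qabs L (1 + algebraMap L D a * β ^ i) = 1 :=
        qabs_one_add_eq_one (hy.mono (by exact_mod_cast hi))
      refine ⟨c * mkUnit _ hy1, ?_, ?_⟩
      · simp only [Subgroup.coe_mul, Units.val_mul, coe_mkUnit]
        refine hc.mul_left ((Commute.one_left β).add_left ?_)
        exact Commute.mul_left (Algebra.commutes a β) (Commute.pow_self β i)
      · rw [mul_inv_rev, mul_assoc, ← hu, inv_mul_mem_unitFiltration, coe_mkUnit,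
          ← sub_sub]
        exact_mod_cast h

/-- The centralizer of a noncentral element is commutative. -/
theorem commute_of_commute {β x y : D} (hβ : β ∉ Set.range (algebraMap L D)) (hx : Commute x β)
    (hy : Commute y β) : Commute x y := by
  have h2 : (2 : D) ≠ 0 := by
    have := (algebraMap L D).injective.ne (two_ne_zero (α := L))
    rwa [map_ofNat, map_zero] at this
  have tr0 : ∀ z : D, redTrace L (2 * z - algebraMap L D (redTrace L z)) = 0 := by
    intro z
    have : (2 : D) * z - algebraMap L D (redTrace L z) = (2 : L) • z - redTrace L z • (1 : D) := by
      rw [Algebra.smul_def, Algebra.smul_def, mul_one, map_ofNat]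
    rw [this]
    change redTraceLin L D _ = 0
    rw [map_sub, map_smul, map_smul]
    change (2 : L) • redTrace L z - redTrace L z • redTrace L (1 : D) = 0
    rw [redTrace_one, smul_eq_mul, smul_eq_mul]; ring
  have sq : ∀ z : D, redTrace L z = 0 → z * z = algebraMap L D (-redNorm L z) := by
    intro z hz
    rw [mul_self_eq hD.out z, hz, zero_smul, zero_sub, map_neg]
  set β₀ := 2 * β - algebraMap L D (redTrace L β) with hβ₀
  have hβ0 : β₀ ≠ 0 := by
    intro h
    refine hβ ⟨redTrace L β / 2, ?_⟩
    rw [map_div₀, map_ofNat, div_eq_iff h2, mul_two, ← two_mul]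
    exact (sub_eq_zero.mp h).symm
  -- Squares of trace-zero elements are scalars. For the commuting trace-zero parts `β₀`, `z₀`,
  -- expanding `(β₀ + z₀) ^ 2` shows that `β₀ * z₀` is a scalar, hence `z₀` is a multiple of `β₀`.
  have key : ∀ z : D, Commute z β → ∃ a b : L, z = algebraMap L D a * β + algebraMap L D b := by
    intro z hz
    set z₀ := 2 * z - algebraMap L D (redTrace L z) with hz₀
    have hzc : Commute z₀ β₀ := by
      have c2 : ∀ w : D, Commute (2 : D) w := fun w => by rw [Commute, SemiconjBy, two_mul, mul_two]
      have cA : ∀ (l : L) (w : D), Commute (algebraMap L D l) w := fun l w => Algebra.commutes l w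
      refine Commute.sub_left (Commute.sub_right ?_ (cA _ _).symm) (cA _ _)
      exact ((c2 _).mul_left ((c2 z).symm.mul_right hz))
    have h1 := sq (β₀ + z₀) (by
      change redTraceLin L D _ = 0
      rw [map_add]
      change redTrace L β₀ + redTrace L z₀ = 0
      rw [tr0, tr0, add_zero])
    rw [mul_add, add_mul, add_mul, sq β₀ (tr0 _), sq z₀ (tr0 _), hzc.eq] at h1
    set c := (-redNorm L (β₀ + z₀) + redNorm L β₀ + redNorm L z₀) / 2 with hc
    have h3 : β₀ * z₀ = algebraMap L D c := by
      rw [hc, map_div₀, map_ofNat, eq_div_iff h2, mul_two, map_add, map_add, ← h1, map_neg, map_neg]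
      abel
    have hN : redNorm L β₀ ≠ 0 := redNorm_ne_zero hD.out hβ0
    have h4 : z₀ = algebraMap L D (-(c / redNorm L β₀)) * β₀ := by
      have h5 := congrArg (β₀ * ·) h3
      simp only [← mul_assoc, sq β₀ (tr0 _)] at h5
      rw [← Algebra.commutes] at h5
      have h6 : algebraMap L D (-redNorm L β₀) ≠ 0 := by simpa using hN
      apply mul_left_cancel₀ h6
      rw [h5, ← mul_assoc, ← map_mul]
      congr 2
      field_simp
    set e := -(c / redNorm L β₀)
    refine ⟨e, (redTrace L z - e * redTrace L β) / 2, ?_⟩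
    apply mul_left_cancel₀ h2
    have h7 : 2 * z = z₀ + algebraMap L D (redTrace L z) := by rw [hz₀, sub_add_cancel]
    have h8 : (2 : D) * algebraMap L D ((redTrace L z - e * redTrace L β) / 2) =
        algebraMap L D (redTrace L z - e * redTrace L β) := by
      rw [← map_ofNat (algebraMap L D) 2, ← map_mul]
      congr 1
      ring
    rw [h7, h4, hβ₀, mul_add, h8, mul_sub, map_sub, map_mul, two_mul, two_mul, mul_add]
    abel
  obtain ⟨a, b, rfl⟩ := key x hx
  have cA : ∀ (l : L) (w : D), Commute (algebraMap L D l) w := fun l w => Algebra.commutes l w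
  exact Commute.add_left ((cA a y).mul_left hy.symm) (cA b y)

end Quaternion

/-- The second isomorphism theorem for indices: `J` is contained in `U * H`. -/
theorem relIndex_eq_of_forall_exists_mul {G : Type*} [Group G] (H : Subgroup G) {U J : Subgroup G}
    (hUJ : U ≤ J) (h : ∀ g ∈ J, ∃ u ∈ U, u⁻¹ * g ∈ H) : H.relIndex J = H.relIndex U := by
  refine (Nat.card_congr (Equiv.ofBijective (Subgroup.quotientSubgroupOfEmbeddingOfLE H hUJ)
    ⟨(Subgroup.quotientSubgroupOfEmbeddingOfLE H hUJ).injective, fun x => ?_⟩)).symm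
  induction x using QuotientGroup.induction_on with
  | H g =>
    obtain ⟨u, hu, hug⟩ := h g g.2
    refine ⟨QuotientGroup.mk ⟨u, hu⟩, ?_⟩
    rw [Subgroup.quotientSubgroupOfEmbeddingOfLE_apply_mk, QuotientGroup.eq]
    exact hug

/-! ### Indices of the stabilizers and a generator of the residue field -/

section Quaternion

variable {p : ℕ} [Fact p.Prime] {L : LocalField p}
  {D : Type*} [DivisionRing D] [Algebra L D]
  [Algebra.IsCentral L D] [hD : Fact (Module.finrank L D = 4)] [FiniteDimensional ℚ_[p] L]

theorem mem_conjStabilizer_of_commute {β : D} {c : unitGroup L D} (h : Commute ((c : Dˣ) : D) β)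
    (i : ℕ) : c ∈ conjStabilizer L β i := by
  rw [mem_conjStabilizer, h.eq, sub_self]; exact memIdealPow_zero

theorem mem_conjStabilizer_one_iff {β : D} (hβ : qabs L β = absUnif L) {g : unitGroup L D} :
    g ∈ conjStabilizer L β 1 ↔ ∃ z : unitGroup L D, (∃ a : L, ((z : Dˣ) : D) = algebraMap L D a) ∧
      z⁻¹ * g ∈ unitFiltration L D 1 := by
  constructor
  · intro hg
    obtain ⟨a, ha, h⟩ := exists_sub_mul_pow_memIdealPow hβ 0
      (x := ((g : Dˣ) : D)) (by rw [Nat.cast_zero, memIdealPow_zero_iff]; exact (qabs_unit g).le)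
      (by rw [mem_conjStabilizer] at hg; simpa [one_add_one_eq_two] using hg)
    rw [pow_zero, mul_one, Nat.cast_zero, zero_add] at h
    have ha1 : qabs L (algebraMap L D a) = 1 := by
      rw [memIdealPow_one_iff, qabs_sub_comm] at h
      rw [qabs_eq_of_sub_lt (h.trans_eq (qabs_unit g).symm), qabs_unit]
    refine ⟨mkUnit _ ha1, ⟨a, rfl⟩, ?_⟩
    rw [inv_mul_mem_unitFiltration]
    exact_mod_cast h
  · rintro ⟨z, ⟨a, ha⟩, hz⟩
    rw [← mul_inv_cancel_left z g]
    refine mul_mem (mem_conjStabilizer_of_commute ?_ 1) (unitFiltration_le_conjStabilizer hβ 1 hz)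
    rw [ha]; exact Algebra.commutes a β

/-- An element commutes with `β` modulo `𝔓 ^ 2` exactly when its residue is fixed by Frobenius. So
the chain of stabilizers starts at `Z I₁` for every uniformizer `β`. -/
theorem conjStabilizer_one_eq_centerI1 {β : D} (hβ : qabs L β = absUnif L) :
    conjStabilizer L β 1 = centerI1 L D := by
  apply le_antisymm
  · intro g hg
    obtain ⟨z, hz, hzg⟩ := (mem_conjStabilizer_one_iff hβ).mp hg
    rw [← mul_inv_cancel_left z g]
    refine mul_mem (Subgroup.subset_closure (Or.inl hz)) (Subgroup.subset_closure (Or.inr ?_))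
    exact_mod_cast hzg
  · rw [centerI1, Subgroup.closure_le]
    rintro g (⟨a, ha⟩ | hg)
    · refine mem_conjStabilizer_of_commute ?_ 1
      rw [ha]; exact Algebra.commutes a β
    · refine unitFiltration_le_conjStabilizer hβ 1 ?_
      rw [mem_unitFiltration]
      exact_mod_cast hg

variable (L D) in
theorem mem_centerI1_iff {g : unitGroup L D} : g ∈ centerI1 L D ↔
    ∃ z : unitGroup L D, (∃ a : L, ((z : Dˣ) : D) = algebraMap L D a) ∧
      z⁻¹ * g ∈ unitFiltration L D 1 := by
  obtain ⟨β, hβ⟩ := exists_qabs_eq_absUnif L D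
  rw [← conjStabilizer_one_eq_centerI1 hβ, mem_conjStabilizer_one_iff hβ]

variable (L D) in
theorem unitFiltration_one_le_centerI1 : unitFiltration L D 1 ≤ centerI1 L D := by
  obtain ⟨β, hβ⟩ := exists_qabs_eq_absUnif L D
  rw [← conjStabilizer_one_eq_centerI1 hβ]
  exact unitFiltration_le_conjStabilizer hβ 1

theorem integer_of_qabs_algebraMap_le {a : L} (h : qabs L (algebraMap L D a) ≤ 1) :
    a ∈ integers L := by
  rw [qabs_algebraMap, sq_le_one_iff₀ (norm_nonneg _)] at h
  exact (mem_integers L a).mpr h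

variable (L D) in
-- Normality of `Z I₁` and the comparison of its cosets with those of `k_L^×` in `k_D^×` are read
-- off from this description.
theorem centerI1_eq_comap : centerI1 L D = Subgroup.comap (unitResidue L D)
    (Units.map (algebraMap (residueField L) (quatResidueField L D) : residueField L →* quatResidueField L D)).range := by
  ext g
  rw [mem_centerI1_iff, Subgroup.mem_comap]
  constructor
  · rintro ⟨z, ⟨a, ha⟩, hzg⟩
    rw [← ker_unitResidue, MonoidHom.mem_ker, map_mul, map_inv, inv_mul_eq_one] at hzg
    have hz1 := qabs_unit z
    have hint : a ∈ integers L := integer_of_qabs_algebraMap_le (D := D) (by rw [← ha, hz1])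
    have hne : IsLocalRing.residue (integers L) ⟨a, hint⟩ ≠ 0 := by
      rw [Ne, residue_eq_zero_iff_norm_lt_one]
      rw [ha, qabs_algebraMap, pow_eq_one_iff_of_nonneg (norm_nonneg _) two_ne_zero] at hz1
      exact hz1.not_lt
    refine ⟨Units.mk0 _ hne, ?_⟩
    rw [← hzg, Units.ext_iff, coe_unitResidue]
    change algebraMap _ _ (IsLocalRing.residue (integers L) ⟨a, hint⟩) = _
    rw [algebraMap_residue]
    congr 1
    exact Subtype.ext ha.symm
  · rintro ⟨y, hy⟩
    obtain ⟨a, ha⟩ := IsLocalRing.residue_surjective (y : residueField L)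
    have h1 : quatResidue L D (integersToQuatInt L D a) = unitResidue L D g := by
      rw [← algebraMap_residue, ha, ← hy]; rfl
    have ha1 : qabs L (algebraMap L D (a : L)) = 1 :=
      qabs_eq_one_of_quatResidue_ne_zero (x := integersToQuatInt L D a)
        (by rw [h1]; exact Units.ne_zero _)
    refine ⟨mkUnit _ ha1, ⟨a, rfl⟩, ?_⟩
    rw [← ker_unitResidue, MonoidHom.mem_ker, map_mul, map_inv, inv_mul_eq_one]
    exact Units.ext h1

instance charP_quatResidueField : CharP (quatResidueField L D) p :=
  charP_of_injective_algebraMap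
    (algebraMap (residueField L) (quatResidueField L D)).injective p

/-- The isomorphism `U_D ^ i / U_D ^ (i + 1) ≅ k_D` given by a uniformizer. -/
def unitGradedMap {β : D} (hβ : qabs L β = absUnif L) {i : ℕ} (hi : 1 ≤ i) :
    unitFiltration L D i →* Multiplicative (quatResidueField L D) where
  toFun u := Multiplicative.ofAdd (gradedMap hβ i ⟨(((u : unitGroup L D) : Dˣ) : D) - 1, u.2⟩)
  map_one' := by
    rw [← ofAdd_zero, gradedMap_eq_zero_iff _ _ _ |>.mpr]
    simp [memIdealPow_zero]
  map_mul' u v := by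
    rw [← ofAdd_add, ← map_add]
    refine congrArg Multiplicative.ofAdd (sub_eq_zero.mp ?_)
    rw [← map_sub, gradedMap_eq_zero_iff]
    have e : ((((u * v : unitFiltration L D i) : unitGroup L D) : Dˣ) : D) - 1 -
        (((((u : unitGroup L D) : Dˣ) : D) - 1) + ((((v : unitGroup L D) : Dˣ) : D) - 1)) =
        ((((u : unitGroup L D) : Dˣ) : D) - 1) * ((((v : unitGroup L D) : Dˣ) : D) - 1) := by
      simp only [Subgroup.coe_mul, Units.val_mul]; noncomm_ring
    change MemIdealPow L _ (((((u * v : unitFiltration L D i) : unitGroup L D) : Dˣ) : D) - 1 -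
        (((((u : unitGroup L D) : Dˣ) : D) - 1) + ((((v : unitGroup L D) : Dˣ) : D) - 1)))
    rw [e]
    exact (MemIdealPow.mul u.2 v.2).mono (by omega)

theorem unitGradedMap_eq_one_iff {β : D} (hβ : qabs L β = absUnif L) {i : ℕ} (hi : 1 ≤ i)
    (u : unitFiltration L D i) : unitGradedMap hβ hi u = 1 ↔
      (u : unitGroup L D) ∈ unitFiltration L D (i + 1) := by
  rw [mem_unitFiltration, Nat.cast_succ]
  exact gradedMap_eq_zero_iff hβ i _

theorem unitGradedMap_surjective {β : D} (hβ : qabs L β = absUnif L) {i : ℕ} (hi : 1 ≤ i) :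
    Function.Surjective (unitGradedMap (L := L) hβ hi) := by
  intro y
  obtain ⟨x, hx⟩ := gradedMap_surjective hβ i y.toAdd
  have h1 : qabs L (1 + (x : D)) = 1 :=
    qabs_one_add_eq_one (MemIdealPow.mono (by exact_mod_cast hi) x.2)
  have h2 : (1 + (x : D)) - 1 = x := add_sub_cancel_left _ _
  refine ⟨⟨mkUnit _ h1, by rw [mem_unitFiltration, coe_mkUnit, h2]; exact x.2⟩, ?_⟩
  change Multiplicative.ofAdd (gradedMap hβ i _) = y
  rw [← ofAdd_toAdd y, ← hx]
  congr 2
  exact Subtype.ext h2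

theorem finiteIndex_unitFiltration (i : ℕ) : (unitFiltration L D i).FiniteIndex := by
  obtain ⟨β, hβ⟩ := exists_qabs_eq_absUnif L D
  have h1 : (unitFiltration L D 1).FiniteIndex := by
    rw [← ker_unitResidue]; exact Subgroup.finiteIndex_ker _
  suffices h : ∀ i, 1 ≤ i → (unitFiltration L D i).FiniteIndex by
    rcases Nat.eq_zero_or_pos i with rfl | hi
    · exact Subgroup.finiteIndex_of_le (unitFiltration_anti zero_le_one)
    · exact h i hi
  intro i hi
  induction i, hi using Nat.le_induction with
  | base => exact h1
  | succ i hi ih =>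
    constructor
    rw [← Subgroup.relIndex_mul_index (unitFiltration_anti (Nat.le_succ i))]
    refine mul_ne_zero ?_ ih.index_ne_zero
    have e : (unitFiltration L D (i + 1)).subgroupOf (unitFiltration L D i) =
        (unitGradedMap hβ hi).ker := by
      ext u
      rw [MonoidHom.mem_ker, unitGradedMap_eq_one_iff]; rfl
    have := Subgroup.finiteIndex_ker (unitGradedMap (L := L) hβ hi)
    rw [Subgroup.relIndex, e]
    exact this.index_ne_zero

/-- The graded piece `U_D ^ i / U_D ^ (i + 1)` embeds in the additive group of `k_D`, which is
killed by `p`. -/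
theorem pow_mem_unitFiltration_succ {i : ℕ} (hi : 1 ≤ i) {u : unitGroup L D}
    (hu : u ∈ unitFiltration L D i) : u ^ p ∈ unitFiltration L D (i + 1) := by
  obtain ⟨β, hβ⟩ := exists_qabs_eq_absUnif L D
  have := (unitGradedMap_eq_one_iff hβ hi (⟨u, hu⟩ ^ p)).mp (by
    rw [map_pow]
    apply Multiplicative.toAdd.injective
    rw [toAdd_pow, toAdd_one, nsmul_eq_mul, CharP.cast_eq_zero, zero_mul])
  exact this

theorem pow_pow_mem_unitFiltration (n : ℕ) {u : unitGroup L D}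
    (hu : u ∈ unitFiltration L D 1) : u ^ p ^ n ∈ unitFiltration L D (n + 1) := by
  induction n with
  | zero => simpa using hu
  | succ n ih =>
    rw [pow_succ, pow_mul]
    exact pow_mem_unitFiltration_succ (by omega) ih

/-- Inside `U_D ^ i` this describes the next stabilizer as the preimage of `k_L` in `k_D`. -/
theorem gradedMap_mem_range_iff {β : D} (hβ : qabs L β = absUnif L) (i : ℕ) (x : idealPow L D i) :
    gradedMap hβ i x ∈ Set.range (algebraMap (residueField L) (quatResidueField L D)) ↔
      MemIdealPow L (i + 2) ((x : D) * β - β * x) := by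
  have h0 := ne_zero_of_qabs_eq_absUnif hβ
  have key : ∀ a : integers L, gradedMap hβ i x = algebraMap (residueField L)
      (quatResidueField L D) (IsLocalRing.residue (integers L) a) ↔
      MemIdealPow L (i + 1) ((x : D) - algebraMap L D (a : L) * β ^ i) := by
    intro a
    rw [algebraMap_residue, ← qabs_zpow_neg_mul_lt_one_iff hβ]
    change quatResidue L D _ = _ ↔ _
    rw [quatResidue_eq_iff]
    have e : β ^ (-(i : ℤ)) * ((x : D) - algebraMap L D (a : L) * β ^ i) =
        β ^ (-(i : ℤ)) * x - algebraMap L D (a : L) := by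
      rw [mul_sub, ← mul_assoc, ← Algebra.commutes, mul_assoc, zpow_neg, zpow_natCast,
        inv_mul_cancel₀ (pow_ne_zero _ h0), mul_one]
    rw [e]
    rfl
  constructor
  · rintro ⟨y, hy⟩
    obtain ⟨a, rfl⟩ := IsLocalRing.residue_surjective y
    exact memIdealPow_commutator_of_sub_mul_pow hβ i a ((key a).mp hy.symm)
  · intro h
    obtain ⟨a, ha, h'⟩ := exists_sub_mul_pow_memIdealPow hβ i x.2 h
    exact ⟨_, ((key ⟨a, (mem_integers L a).mpr ha⟩).mpr h').symm⟩

/-- Modulo elements commuting with `β`, which lie in both groups, the larger stabilizer is `U_D ^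
i`. The index may thus be computed there, where it is that of `k_L` in `k_D`. -/
theorem relIndex_conjStabilizer_succ {β : D} (hβ : qabs L β = absUnif L) {i : ℕ} (hi : 1 ≤ i) :
    (conjStabilizer L β (i + 1)).relIndex (conjStabilizer L β i) = resCard L := by
  rw [relIndex_eq_of_forall_exists_mul _ (unitFiltration_le_conjStabilizer hβ i)]
  · set R : Subgroup (Multiplicative (quatResidueField L D)) := AddSubgroup.toSubgroup
      (algebraMap (residueField L) (quatResidueField L D)).toAddMonoidHom.range
    have e : (conjStabilizer L β (i + 1)).subgroupOf (unitFiltration L D i) =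
        R.comap (unitGradedMap hβ hi) := by
      ext u
      rw [Subgroup.mem_subgroupOf, mem_conjStabilizer, Subgroup.mem_comap]
      have := gradedMap_mem_range_iff hβ i ⟨_, u.2⟩
      refine Iff.trans ?_ this.symm
      have e : ((((u : unitGroup L D) : Dˣ) : D) - 1) * β -
        β * ((((u : unitGroup L D) : Dˣ) : D) - 1) =
          (((u : unitGroup L D) : Dˣ) : D) * β - β * (((u : unitGroup L D) : Dˣ) : D) := by
        noncomm_ring
      rw [e]
      push_cast
      rw [add_assoc, one_add_one_eq_two]
    rw [Subgroup.relIndex, e, Subgroup.index_comap_of_surjective _ (unitGradedMap_surjective hβ hi)]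
    have h1 := R.card_mul_index
    have h2 : Nat.card R = resCard L :=
      (Nat.card_congr (AddMonoidHom.ofInjective
        (f := (algebraMap (residueField L) (quatResidueField L D)).toAddMonoidHom)
        (algebraMap (residueField L) (quatResidueField L D)).injective).toEquiv).symm
    have h3 : Nat.card (Multiplicative (quatResidueField L D)) = resCard L ^ 2 :=
      card_quatResidueField L D
    rw [h2, h3, sq] at h1
    exact Nat.eq_of_mul_eq_mul_left (zero_lt_one.trans (one_lt_resCard L)) h1
  · intro g hg
    obtain ⟨c, hc, hcg⟩ := exists_commute_mem_unitFiltration hβ i hg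
    -- `g * c⁻¹` is the conjugate by `c` of `c⁻¹ * g`, and `U_D ^ i` is normal.
    refine ⟨g * c⁻¹, ?_, ?_⟩
    · have := (normal_unitFiltration i).conj_mem _ hcg c
      rwa [← mul_assoc, mul_inv_cancel, one_mul] at this
    · rw [mul_inv_rev, inv_inv, inv_mul_cancel_right]
      exact mem_conjStabilizer_of_commute hc _

/-- There are `m - 1` steps of index `q` from level `1`, where the stabilizer is `Z I₁`, to level
`m`. -/
theorem relIndex_conjStabilizer_centerI1 {β : D} (hβ : qabs L β = absUnif L) {m : ℕ} (hm : 1 ≤ m) :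
    (conjStabilizer L β m).relIndex (centerI1 L D) = resCard L ^ (m - 1) := by
  rw [← conjStabilizer_one_eq_centerI1 hβ]
  induction m, hm using Nat.le_induction with
  | base => simp
  | succ m hm ih =>
    rw [← Subgroup.relIndex_mul_relIndex _ (conjStabilizer L β m) _
      (conjStabilizer_anti β (Nat.le_succ m)) (conjStabilizer_anti β hm), ih,
      relIndex_conjStabilizer_succ hβ hm, ← pow_succ']
    congr 1
    omega

theorem conjStabilizer_le_centerI1 {β : D} (hβ : qabs L β = absUnif L) {m : ℕ} (hm : 1 ≤ m) :
    conjStabilizer L β m ≤ centerI1 L D :=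
  (conjStabilizer_anti β hm).trans (conjStabilizer_one_eq_centerI1 hβ).le

variable (L D) in
/-- A lift of a generator of `k_D^×` whose `(q + 1)`-st power is central up to `U_D ^ n`. -/
theorem exists_generator (n : ℕ) : ∃ τ z : unitGroup L D,
    (∃ a : L, ((z : Dˣ) : D) = algebraMap L D a) ∧
    z⁻¹ * τ ^ (resCard L + 1) ∈ unitFiltration L D n ∧
    ∀ y, y ∈ Subgroup.zpowers (unitResidue L D τ) := by
  have := Fintype.ofFinite (quatResidueField L D)
  obtain ⟨γ, hγ⟩ := IsCyclic.exists_generator (α := (quatResidueField L D)ˣ)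
  obtain ⟨τ, hτ⟩ := unitResidue_surjective L D γ
  have hq := one_lt_resCard L
  have hcard : Fintype.card (quatResidueField L D) = resCard L ^ 2 := by
    rw [← Nat.card_eq_fintype_card, card_quatResidueField]
  -- `γ ^ (q + 1)` is the norm of `γ`, hence lies in `k_L`.
  have hc : τ ^ (resCard L + 1) ∈ centerI1 L D := by
    have h1 : ((γ : quatResidueField L D) ^ (resCard L + 1)) ^ Nat.card (residueField L) =
        (γ : quatResidueField L D) ^ (resCard L + 1) := by
      have h2 := FiniteField.pow_card (γ : quatResidueField L D)
      rw [hcard] at h2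
      rw [← pow_mul]
      change _ ^ ((resCard L + 1) * resCard L) = _
      rw [add_mul, one_mul, ← sq, pow_add, h2, pow_succ, mul_comm]
    obtain ⟨y, hy⟩ := (FiniteField.pow_card_eq_self_iff _).mp h1
    have hy0 : y ≠ 0 := by
      rintro rfl
      rw [map_zero] at hy
      exact pow_ne_zero _ γ.ne_zero hy.symm
    rw [centerI1_eq_comap, Subgroup.mem_comap, map_pow, hτ]
    exact ⟨Units.mk0 y hy0, Units.ext hy⟩
  obtain ⟨z, ⟨a, ha⟩, hz⟩ := (mem_centerI1_iff L D).mp hc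
  obtain ⟨f, hf0, hf⟩ := exists_resCard_eq_pow L
  -- With `p ^ s = q ^ (2 n)`, raising to the power `p ^ s` fixes the residue `γ`, as `k_D` has `q ^
  -- 2` elements, while it pushes the noncentral error from `U_D ^ 1` into `U_D ^ (s + 1)`, inside
  -- `U_D ^ n`.
  obtain ⟨s, hs, hns⟩ : ∃ s, resCard L ^ (2 * n) = p ^ s ∧ n ≤ s :=
    ⟨2 * f * n, by rw [hf, ← pow_mul]; congr 1; ring, Nat.le_mul_of_pos_left n (by omega)⟩
  have hcomm : Commute z (τ ^ (resCard L + 1)) := by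
    have : ∀ g, Commute z g := fun g => Subtype.ext (Units.ext (by
      simp only [Subgroup.coe_mul, Units.val_mul, ha]; exact Algebra.commutes _ _))
    exact this _
  refine ⟨τ ^ p ^ s, z ^ p ^ s, ⟨a ^ p ^ s, by simp [ha]⟩, ?_, ?_⟩
  · rw [← pow_mul, mul_comm (p ^ s), pow_mul, ← inv_pow, ← hcomm.inv_left.mul_pow]
    exact unitFiltration_anti (by omega) (pow_pow_mem_unitFiltration s hz)
  · rw [map_pow, hτ]
    have : γ ^ p ^ s = γ := by
      apply Units.ext
      rw [Units.val_pow_eq_pow_val, ← hs, pow_mul, ← hcard, FiniteField.pow_card_pow]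
    rw [this]
    exact hγ

theorem exists_pow_inv_mul_mem_unitFiltration {τ : unitGroup L D}
    (hτ : ∀ y, y ∈ Subgroup.zpowers (unitResidue L D τ)) (g : unitGroup L D) :
    ∃ i : ℕ, (τ ^ i)⁻¹ * g ∈ unitFiltration L D 1 := by
  obtain ⟨i, hi⟩ := mem_powers_iff_mem_zpowers.mpr (hτ (unitResidue L D g))
  refine ⟨i, ?_⟩
  rw [← ker_unitResidue, MonoidHom.mem_ker, map_mul, map_inv, map_pow, inv_mul_eq_one]
  exact hi

end Quaternion

/-! ### Irreducibility in terms of stable subspaces -/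

section Irreducible

variable {k G V : Type*} [Field k] [Group G] [AddCommGroup V] [Module k V]
  {ρ : Representation k G V}

theorem eq_bot_or_eq_top_of_isIrreducible (h : ρ.IsIrreducible) (P : Submodule k V)
    (hP : ∀ g, ∀ v ∈ P, ρ g v ∈ P) : P = ⊥ ∨ P = ⊤ := by
  have := h
  rcases eq_bot_or_eq_top (⟨P, fun g v hv => hP g v hv⟩ : Subrepresentation ρ) with h' | h'
  · exact Or.inl (congrArg Subrepresentation.toSubmodule h')
  · exact Or.inr (congrArg Subrepresentation.toSubmodule h')

theorem nontrivial_of_isIrreducible (h : ρ.IsIrreducible) : Nontrivial V := by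
  have := h.toNontrivial
  by_contra hV
  rw [not_nontrivial_iff_subsingleton] at hV
  obtain ⟨P, Q, hPQ⟩ := this
  exact hPQ (Subrepresentation.toSubmodule_injective (Subsingleton.elim _ _))

theorem isIrreducible_of_forall [Nontrivial V]
    (h : ∀ P : Submodule k V, (∀ g, ∀ v ∈ P, ρ g v ∈ P) → P = ⊥ ∨ P = ⊤) : ρ.IsIrreducible where
  exists_pair_ne := ⟨⊥, ⊤, fun h => bot_ne_top (congrArg Subrepresentation.toSubmodule h)⟩
  eq_bot_or_eq_top P := by
    rcases h P.toSubmodule (fun g v hv => P.apply_mem_toSubmodule g hv) with h' | h'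
    · exact Or.inl (Subrepresentation.toSubmodule_injective h')
    · exact Or.inr (Subrepresentation.toSubmodule_injective h')

end Irreducible

/-! ### The level of a twist, read off from the local factors -/

variable {p : ℕ} [Fact p.Prime]

theorem resCard_ne_zero (L : LocalField p) [FiniteDimensional ℚ_[p] L] :
    (resCard L : PadicAlgCl p) ≠ 0 :=
  Nat.cast_ne_zero.mpr (zero_lt_one.trans (one_lt_resCard L)).ne'

/-- The kernel of `N` is stable under `r`, and it is not zero because `N` is nilpotent. -/
theorem WeilDeligneRep.N_eq_zero {L : LocalField p} (w : WeilDeligneRep L)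
    (hr : w.r.IsIrreducible) : w.N = 0 := by
  have hker := eq_bot_or_eq_top_of_isIrreducible hr (LinearMap.ker w.N) (fun g v hv => by
    obtain ⟨n, hn⟩ := g.2.2
    have h := LinearMap.congr_fun (w.comm g n hn) v
    rw [LinearMap.mem_ker] at hv ⊢
    rw [Module.End.mul_apply] at h
    rw [h, LinearMap.smul_apply, Module.End.mul_apply, hv, map_zero, smul_zero])
  rcases hker with h | h
  · exfalso
    obtain ⟨n, hn⟩ := w.nilpotent
    have h1 : Function.Injective (w.N ^ n) := by
      rw [Module.End.coe_pow]
      exact (LinearMap.ker_eq_bot.mp h).iterate n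
    rw [hn] at h1
    have h2 := h1 (a₁ := fun _ => 0) (a₂ := fun _ => 1) (by simp)
    exact zero_ne_one (congrFun h2 0)
  · exact LinearMap.ker_eq_top.mp h

theorem C_mul_T_degree_inj {k : Type*} [Field k] {a b : k} {m n : ℤ} (hb : b ≠ 0)
    (h : LaurentPolynomial.C a * LaurentPolynomial.T m =
      -(LaurentPolynomial.C b * LaurentPolynomial.T n)) : m = n := by
  rw [← neg_mul, ← map_neg] at h
  have h1 := LaurentPolynomial.degree_C_mul_T n (-b) (neg_ne_zero.mpr hb)
  rw [← h] at h1
  rcases eq_or_ne a 0 with rfl | ha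
  · simp at h1
  · rw [LaurentPolynomial.degree_C_mul_T m a ha] at h1
    exact_mod_cast h1

section Quaternion

variable {L : LocalField p}
  {D : Type*} [DivisionRing D] [Algebra L D]
  [Algebra.IsCentral L D] [hD : Fact (Module.finrank L D = 4)] [FiniteDimensional ℚ_[p] L]

/-- Equality of degrees reads: level plus `n(ψ_D)` equals conductor plus `2 n(ψ_L)`. As `n(ψ_D) = 2
n(ψ_L) + 1`, the level is one less than the conductor. -/
theorem quatLevel_add_eq {w : WeilDeligneRep L} {d : ℕ} {n : ℕ}
    {π : Representation (PadicAlgCl p) Dˣ (Fin d → PadicAlgCl p)}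
    {ψ : AddChar ℚ_[p] (PadicAlgCl p)} (hψ : ∀ x, ψ x = 1 ↔ ‖x‖ ≤ 1) {ε : ConstantSystem p}
    {χ : L →*₀ PadicAlgCl p} {η : weilGroup L →* PadicAlgCl p} {t : PadicAlgCl p}
    (h : quatEpsilon ψ χ π t = -weilEpsilon ψ ε (twist η w.r))
    (hn : n + 1 = artinConductor (twist η w.r)) : quatLevel χ π = n := by
  rw [quatEpsilon, weilEpsilon] at h
  have h1 := C_mul_T_degree_inj (mul_ne_zero (zpow_ne_zero _ (resCard_ne_zero L))
    (Units.ne_zero _)) h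
  rw [quatAddLevel_eq hψ, ← hn] at h1
  push_cast at h1
  omega

/-- The group-theoretic data extracted from the correspondence: `π` is the representation of
`D^×` attached to `w`, and its twist by `χ` is trivial on `U_D ^ n` but has no fixed vectors under
`U_D ^ (n - 1)`. -/
theorem exists_twist_level {E : LocalField p} {V : Type*} [AddCommGroup V] [Module E V]
    {ϑ : Representation E (unitGroup L D) V} {w : WeilDeligneRep L} (hϑ : IsKType ϑ w)
    (hr : w.r.IsIrreducible) {n : ℕ} (hn : 1 ≤ n)
    (hcond : n + 1 ∈ twistConductors w.r) :
    ∃ (d : ℕ) (π : Representation (PadicAlgCl p) Dˣ (Fin d → PadicAlgCl p))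
      (f : V →ₗ[E] (Fin d → PadicAlgCl p)) (ψ : AddChar ℚ_[p] (PadicAlgCl p))
      (χ : L →*₀ PadicAlgCl p), f ≠ 0 ∧
      (∀ (g : unitGroup L D) (v : V), f (ϑ g v) = π (g : Dˣ) (f v)) ∧
      (∀ x, ψ x = 1 ↔ ‖x‖ ≤ 1) ∧
      (∀ g ∈ unitFiltration L D n, χ (redNorm L ((g : Dˣ) : D)) • π g = 1) ∧
      ∀ v, (∀ g ∈ unitFiltration L D (n - 1), χ (redNorm L ((g : Dˣ) : D)) • π g v = v) →
        v = 0 := by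
  obtain ⟨d, π, ⟨hπ, -, ψ, θ, ε, hψ, hθ, -, hw⟩, f, hf, hfe⟩ :=
    (hϑ.2.2 w).mpr ⟨LinearEquiv.refl _ _, fun _ _ _ => rfl, fun _ => rfl⟩
  rcases hw with ⟨-, -, hw⟩ | ⟨hN, -⟩
  swap
  · exact absurd (w.N_eq_zero hr) hN
  obtain ⟨η, hη, hηn⟩ := hcond
  have hL := hθ L inferInstance
  obtain ⟨χ, hχ⟩ := hL.factors η hη
  obtain ⟨t, -, ht⟩ := hw χ ((hL.smooth_iff χ).mpr (by rwa [hχ]))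
  rw [hχ] at ht
  have hlev := quatLevel_add_eq hψ ht hηn
  set S := {f : ℕ | ∀ g ∈ unitGroup L D, MemIdealPow L (f : ℤ) ((g : D) - 1) →
    χ (redNorm L (g : D)) • π g = 1} with hS
  change sInf S = n at hlev
  -- The infimum `n` is attained: the infimum of the empty set is `0`, but `n ≥ 1`.
  have hmem : n ∈ S := by
    rw [← hlev]
    refine Nat.sInf_mem (Set.nonempty_iff_ne_empty.mpr fun h => ?_)
    rw [h, Nat.sInf_empty] at hlev
    omega
  have hnot : n - 1 ∉ S := Nat.notMem_of_lt_sInf (by omega)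
  refine ⟨d, π, f, ψ, χ, hf, hfe, hψ, fun g hg => hmem g g.2 hg, ?_⟩
  -- The vectors fixed by `U_D ^ (n - 1)` in the twist form a `D^×`-stable subspace, since that
  -- group is normalised by `D^×` and the reduced norm is invariant under conjugation. If it were
  -- everything, the level would be at most `n - 1`.
  let P : Submodule (PadicAlgCl p) (Fin d → PadicAlgCl p) :=
    { carrier := {v | ∀ g ∈ unitFiltration L D (n - 1),
        χ (redNorm L ((g : Dˣ) : D)) • π g v = v}
      add_mem' := fun {a b} ha hb g hg => by rw [map_add, smul_add, ha g hg, hb g hg]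
      zero_mem' := fun g _ => by rw [map_zero, smul_zero]
      smul_mem' := fun c v hv g hg => by rw [map_smul, smul_comm, hv g hg] }
  have hP := eq_bot_or_eq_top_of_isIrreducible hπ P (fun x v hv g hg => by
    have hx0 : (x : D) ≠ 0 := x.ne_zero
    have hq : ∀ y : D, qabs L ((x : D)⁻¹ * y * x) = qabs L y := fun y => by
      have := qabs_conj (L := L) (inv_ne_zero hx0) y
      rwa [inv_inv] at this
    let g' : unitGroup L D := ⟨x⁻¹ * g * x, mem_unitGroup_iff.mpr (by
      rw [Units.val_mul, Units.val_mul, Units.val_inv_eq_inv_val, hq, qabs_unit])⟩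
    have hg' : g' ∈ unitFiltration L D (n - 1) := by
      have e : ((x⁻¹ * (g : Dˣ) * x : Dˣ) : D) - 1 = (x : D)⁻¹ * ((g : Dˣ) - 1) * x := by
        simp [mul_sub, sub_mul]
      rw [mem_unitFiltration, memIdealPow_iff] at hg ⊢
      change qabs L (((x⁻¹ * (g : Dˣ) * x : Dˣ) : D) - 1) ≤ _
      rwa [e, hq]
    have hN : redNorm L (((g' : Dˣ) : D)) = redNorm L ((g : Dˣ) : D) := by
      change redNorm L (((x⁻¹ * (g : Dˣ) * x : Dˣ) : D)) = _
      rw [Units.val_mul, Units.val_mul, redNorm_mul hD.out, redNorm_mul hD.out,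
        mul_right_comm, ← redNorm_mul hD.out, ← Units.val_mul, inv_mul_cancel, Units.val_one,
        redNorm_one, one_mul]
    have h1 := hv g' hg'
    have h2 : π x (π (g' : Dˣ) v) = π (g : Dˣ) (π x v) := by
      rw [← Module.End.mul_apply, ← Module.End.mul_apply, ← map_mul, ← map_mul]
      congr 2
      change x * (x⁻¹ * (g : Dˣ) * x) = _
      group
    rw [← h2, ← hN, ← map_smul, h1])
  rcases hP with h | h
  · intro v hv
    exact (Submodule.mem_bot (PadicAlgCl p)).mp (h ▸ (show v ∈ P from hv))
  · refine absurd (fun g hg hg1 => ?_) hnot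
    have : ∀ v, v ∈ P := fun v => h ▸ Submodule.mem_top
    refine LinearMap.ext fun v => ?_
    exact this v ⟨g, hg⟩ hg1

end Quaternion

end LocalType

namespace LocalType

open Polynomial

/-! ### Common eigenvectors and charpolys of shift operators -/

section LinearAlgebra

variable {F W : Type*} [Field F] [AddCommGroup W] [Module F W]

/-- In a minimal nonzero stable subspace of `P` every operator of the family is a scalar, because
its eigenspaces there are stable under the commuting operators. -/
theorem exists_common_eigenvector [IsAlgClosed F] [FiniteDimensional F W]
    {S : Set (Module.End F W)} (hS : ∀ f ∈ S, ∀ g ∈ S, Commute f g) {P : Submodule F W}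
    (hP : P ≠ ⊥) (hPS : ∀ f ∈ S, ∀ v ∈ P, f v ∈ P) :
    ∃ v ∈ P, v ≠ 0 ∧ ∀ f ∈ S, ∃ c : F, f v = c • v := by
  obtain ⟨Q, ⟨hQ, hQS, hQP⟩, hmin⟩ := wellFounded_lt.has_min
    {Q : Submodule F W | Q ≠ ⊥ ∧ (∀ f ∈ S, ∀ v ∈ Q, f v ∈ Q) ∧ Q ≤ P} ⟨P, hP, hPS, le_rfl⟩
  obtain ⟨v, hv, hv0⟩ := Q.exists_mem_ne_zero_of_ne_bot hQ
  refine ⟨v, hQP hv, hv0, fun f hf => ?_⟩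
  have : Nontrivial Q := Submodule.nontrivial_iff_ne_bot.mpr hQ
  obtain ⟨c, hc⟩ := Module.End.exists_eigenvalue (f.restrict (hQS f hf))
  obtain ⟨w, hw⟩ := hc.exists_hasEigenvector
  have hfw : f w = c • (w : W) := congrArg Subtype.val hw.apply_eq_smul
  refine ⟨c, ?_⟩
  by_contra hne
  refine hmin (Q ⊓ LinearMap.ker (f - c • LinearMap.id)) ⟨?_, ?_, inf_le_left.trans hQP⟩ ?_
  · rw [Submodule.ne_bot_iff]
    refine ⟨w, ⟨w.2, ?_⟩, fun h => hw.2 (Subtype.ext h)⟩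
    rw [SetLike.mem_coe, LinearMap.mem_ker, LinearMap.sub_apply, hfw]
    simp
  · intro g hg x hx
    refine ⟨hQS g hg x hx.1, ?_⟩
    have hx2 : f x = c • x := by
      have := hx.2
      rw [SetLike.mem_coe, LinearMap.mem_ker, LinearMap.sub_apply, sub_eq_zero] at this
      exact this
    have h2 : f (g x) = g (f x) := LinearMap.congr_fun (hS f hf g hg).eq x
    rw [SetLike.mem_coe, LinearMap.mem_ker, LinearMap.sub_apply, h2, hx2, map_smul]
    simp
  · refine lt_of_le_of_ne inf_le_left fun h => hne ?_
    have := (h.symm ▸ hv : v ∈ Q ⊓ LinearMap.ker (f - c • LinearMap.id)).2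
    rw [SetLike.mem_coe, LinearMap.mem_ker, LinearMap.sub_apply, sub_eq_zero] at this
    exact this

/-- The usual shortening of a relation, with the operator used to cancel a term chosen according to
the pair of vectors to be separated. -/
theorem linearIndependent_of_eigenvalues {ι κ : Type*} (T : κ → Module.End F W) {w : ι → W}
    (hw : ∀ i, w i ≠ 0) {c : ι → κ → F} (h : ∀ i k, T k (w i) = c i k • w i)
    (hc : Function.Injective c) : LinearIndependent F w := by
  classical
  rw [linearIndependent_iff']
  intro s
  induction s using Finset.induction_on with
  | empty => simp
  | insert y s hy ih =>
    intro a ha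
    rw [Finset.sum_insert hy] at ha
    have hs : ∀ x ∈ s, a x = 0 := by
      intro x hx
      have hxy : c x ≠ c y := fun e => hy (hc e ▸ hx)
      obtain ⟨k, hk⟩ := Function.ne_iff.mp hxy
      have h1 := congrArg (fun v => T k v - c y k • v) ha
      simp only [map_add, map_smul, h, map_sum, smul_add, Finset.smul_sum, map_zero,
        smul_zero, sub_zero] at h1
      rw [smul_comm (a y), add_sub_add_left_eq_sub, ← Finset.sum_sub_distrib] at h1
      have h2 := ih (fun x => a x * (c x k - c y k)) (by
        rw [← h1]
        refine Finset.sum_congr rfl fun x _ => ?_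
        rw [mul_sub, sub_smul, mul_smul, mul_comm, mul_smul]) x hx
      exact (mul_eq_zero.mp h2).resolve_right (sub_ne_zero.mpr hk)
    rw [Finset.sum_eq_zero fun x hx => by rw [hs x hx, zero_smul], add_zero] at ha
    intro i hi
    rcases Finset.mem_insert.mp hi with rfl | hi
    · exact (smul_eq_zero.mp ha).resolve_right (hw i)
    · exact hs i hi

/-- The difference of the two monic polynomials has degree less than `n` and kills `v`, whose first
`n` iterates are independent. -/
theorem charpoly_eq_of_cyclic [FiniteDimensional F W] (T : Module.End F W) (v : W) {n : ℕ}
    (hn : Module.finrank F W = n) (hv : LinearIndependent F fun i : Fin n => (T ^ (i : ℕ)) v)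
    {P : F[X]} (hP : P.Monic) (hdeg : P.natDegree = n) (h : aeval T P v = 0) :
    T.charpoly = P := by
  rw [← sub_eq_zero]
  set Q := T.charpoly - P with hQ
  have hQv : aeval T Q v = 0 := by
    rw [hQ, map_sub, LinearMap.aeval_self_charpoly, zero_sub, LinearMap.neg_apply, h, neg_zero]
  have hd : Q.degree < n := by
    have h1 := degree_sub_lt_left (p := T.charpoly) (q := P)
      (by rw [degree_eq_natDegree (LinearMap.charpoly_monic T).ne_zero,
        degree_eq_natDegree hP.ne_zero, LinearMap.charpoly_natDegree, hdeg, hn])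
      (LinearMap.charpoly_monic T).ne_zero
      (by rw [(LinearMap.charpoly_monic T).leadingCoeff, hP.leadingCoeff])
    rwa [degree_eq_natDegree (LinearMap.charpoly_monic T).ne_zero,
      LinearMap.charpoly_natDegree, hn] at h1
  by_contra hQ0
  rw [aeval_eq_sum_range' ((natDegree_lt_iff_degree_lt hQ0).mpr hd)] at hQv
  rw [LinearMap.sum_apply, Finset.sum_range] at hQv
  have := Fintype.linearIndependent_iff.mp hv (fun i => Q.coeff i) hQv
  refine hQ0 (Polynomial.ext fun i => ?_)
  rw [coeff_zero]
  rcases lt_or_ge i n with hi | hi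
  · exact this ⟨i, hi⟩
  · exact (Polynomial.degree_lt_iff_coeff_zero _ _).mp hd i hi

/-- The charpoly of an operator that permutes the first `n + 1` vectors of a basis cyclically up to
the scalar `a`. -/
theorem charpoly_eq_of_shift [FiniteDimensional F W] {n : ℕ} (b : Module.Basis (Fin (n + 1)) F W)
    (T : Module.End F W) (a : F) (hlast : T (b (Fin.last n)) = a • b 0)
    (hsucc : ∀ i : Fin n, T (b i.castSucc) = b i.succ) :
    T.charpoly = X ^ (n + 1) - C a := by
  have hpow : ∀ i : Fin (n + 1), (T ^ (i : ℕ)) (b 0) = b i := by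
    intro i
    induction i using Fin.induction with
    | zero => simp
    | succ i ih =>
      rw [Fin.val_succ, pow_succ', Module.End.mul_apply, ← Fin.val_castSucc, ih, hsucc]
  have hdeg : (X ^ (n + 1) - C a).natDegree = n + 1 := natDegree_X_pow_sub_C
  refine charpoly_eq_of_cyclic T (b 0) (n := n + 1) ?_ ?_ (monic_X_pow_sub_C a (by omega)) hdeg ?_
  · rw [Module.finrank_eq_card_basis b, Fintype.card_fin]
  · simp only [hpow]
    exact b.linearIndependent
  · have h1 := hpow (Fin.last n)
    rw [Fin.val_last] at h1
    rw [map_sub, map_pow, aeval_X, aeval_C, LinearMap.sub_apply, pow_succ', Module.End.mul_apply,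
      h1, hlast, Module.algebraMap_end_apply, sub_self]

/-- For each `j` the vectors with second index `j` span a `T`-stable subspace on which `T` is the
same shift, so the matrix is block diagonal with equal blocks. -/
theorem charpoly_eq_of_block_shift [FiniteDimensional F W] {n : ℕ} {κ : Type*} [Fintype κ]
    (b : Module.Basis (Fin (n + 1) × κ) F W)
    (T : Module.End F W) (a : F) (hlast : ∀ j, T (b (Fin.last n, j)) = a • b (0, j))
    (hsucc : ∀ (i : Fin n) j, T (b (i.castSucc, j)) = b (i.succ, j)) :
    T.charpoly = (X ^ (n + 1) - C a) ^ Fintype.card κ := by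
  classical
  let b₀ := Pi.basisFun F (Fin (n + 1))
  let T₀ : Module.End F (Fin (n + 1) → F) :=
    b₀.constr F (Fin.lastCases (a • b₀ 0) fun i => b₀ i.succ)
  have hT₀ := charpoly_eq_of_shift b₀ T₀ a (by simp [T₀])
    (fun i => by simp only [T₀, Module.Basis.constr_basis, Fin.lastCases_castSucc])
  have hmat : LinearMap.toMatrix b b T =
      Matrix.blockDiagonal fun _ : κ => LinearMap.toMatrix b₀ b₀ T₀ := by
    ext ⟨i, j⟩ ⟨i', j'⟩
    rw [Matrix.blockDiagonal_apply, LinearMap.toMatrix_apply, LinearMap.toMatrix_apply]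
    induction i' using Fin.lastCases with
    | last =>
      simp only [T₀, Module.Basis.constr_basis, Fin.lastCases_last, hlast, map_smul,
        Finsupp.smul_apply, Module.Basis.repr_self, Finsupp.single_apply, Prod.mk.injEq]
      by_cases h : j = j' <;> simp [h, eq_comm]
    | cast i' =>
      simp only [T₀, Module.Basis.constr_basis, Fin.lastCases_castSucc, hsucc,
        Module.Basis.repr_self, Finsupp.single_apply, Prod.mk.injEq]
      by_cases h : j = j' <;> simp [h, eq_comm]
  have hchar : ∀ M : Matrix (Fin (n + 1)) (Fin (n + 1)) F,
      (Matrix.blockDiagonal fun _ : κ => M).charpoly = M.charpoly ^ Fintype.card κ := by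
    intro M
    have : (Matrix.blockDiagonal fun _ : κ => M).charmatrix =
        Matrix.blockDiagonal fun _ : κ => M.charmatrix := by
      ext1 ⟨i, j⟩ ⟨i', j'⟩
      rw [Matrix.blockDiagonal_apply, Matrix.charmatrix_apply, Matrix.charmatrix_apply,
        Matrix.blockDiagonal_apply, Matrix.diagonal_apply, Matrix.diagonal_apply]
      by_cases h : j = j' <;> simp [h]
    rw [Matrix.charpoly, this, Matrix.det_blockDiagonal, Finset.prod_const, Finset.card_univ,
      Matrix.charpoly]
  rw [← LinearMap.charpoly_toMatrix T b, hmat, hchar, LinearMap.charpoly_toMatrix, hT₀]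

end LinearAlgebra

/-! ### Translates of an eigenvector of a normal subgroup -/

section Clifford

variable {F G W : Type*} [Field F] [Group G] [AddCommGroup W] [Module F W]

/-- If `v` is an eigenvector of the normal subgroup `U`, the stabilizer of whose eigencharacter
is contained in a group `J` that preserves the line of `v`, then the translates of `v` by
representatives of `G / J` form a basis of the irreducible representation `W`. -/
theorem linearIndependent_translates {σ : Representation F G W}
    {U J : Subgroup G} [U.Normal] {φ : G → F} {v : W} (hv : v ≠ 0)
    (hU : ∀ u ∈ U, σ u v = φ u • v)
    (hstab : ∀ g, (∀ u ∈ U, φ (g * u * g⁻¹) = φ u) → g ∈ J)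
    {ι : Type*} {r : ι → G} (hr : ∀ i j, (r i)⁻¹ * r j ∈ J → i = j) :
    LinearIndependent F fun i => σ (r i) v := by
  refine linearIndependent_of_eigenvalues (κ := U) (fun u => σ u) (fun i h => hv ?_)
    (c := fun i u => φ ((r i)⁻¹ * u * r i)) (fun i u => ?_) (fun i j hij => ?_)
  · have := congrArg (σ (r i)⁻¹) h
    rwa [map_zero, ← Module.End.mul_apply, ← map_mul, inv_mul_cancel, map_one] at this
  · have h1 : (r i)⁻¹ * u * r i ∈ U := by
      have := ‹U.Normal›.conj_mem u u.2 (r i)⁻¹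
      rwa [inv_inv] at this
    rw [← map_smul, ← hU _ h1, ← Module.End.mul_apply, ← Module.End.mul_apply, ← map_mul,
      ← map_mul]
    congr 2
    group
  -- Translates with equal eigencharacters differ by an element stabilizing `φ`, hence lying in `J`.
  · refine (hr j i (hstab _ fun u hu => ?_)).symm
    have h1 := congrFun hij ⟨r i * u * (r i)⁻¹, ‹U.Normal›.conj_mem u hu (r i)⟩
    simp only at h1
    have e1 : (r i)⁻¹ * (r i * u * (r i)⁻¹) * r i = u := by group
    rw [e1] at h1
    rw [h1]
    congr 1
    group

/-- By stability of the line of `v`, the span contains the whole orbit of `v`; it is therefore a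
nonzero subrepresentation. -/
theorem span_translates {σ : Representation F G W} (hσ : σ.IsIrreducible)
    {J : Subgroup G} {v : W} (hv : v ≠ 0)
    (hJ : ∀ g ∈ J, ∃ c : F, σ g v = c • v)
    {ι : Type*} {r : ι → G} (hr : ∀ g, ∃ i, (r i)⁻¹ * g ∈ J) :
    Submodule.span F (Set.range fun i => σ (r i) v) = ⊤ := by
  have key : ∀ g, σ g v ∈ Submodule.span F (Set.range fun i => σ (r i) v) := by
    intro g
    obtain ⟨i, hi⟩ := hr g
    obtain ⟨c, hc⟩ := hJ _ hi
    rw [← mul_inv_cancel_left (r i) g, map_mul, Module.End.mul_apply, hc, map_smul]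
    exact Submodule.smul_mem _ _ (Submodule.subset_span ⟨i, rfl⟩)
  refine (eq_bot_or_eq_top_of_isIrreducible hσ _ fun g w hw => ?_).resolve_left fun h => hv ?_
  · induction hw using Submodule.span_induction with
    | mem x hx =>
      obtain ⟨i, rfl⟩ := hx
      change σ g (σ (r i) v) ∈ _
      rw [← Module.End.mul_apply, ← map_mul]
      exact key _
    | zero => rw [map_zero]; exact Submodule.zero_mem _
    | add x y _ _ hx hy => rw [map_add]; exact Submodule.add_mem _ hx hy
    | smul c x _ hx => rw [map_smul]; exact Submodule.smul_mem _ _ hx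
  · have := key 1
    rw [h, Submodule.mem_bot, map_one] at this
    exact this

end Clifford

/-! ### Absolute irreducibility and extension of scalars -/

section Burnside

variable {E G V : Type*} [Field E] [Group G] [AddCommGroup V] [Module E V]

/-- Burnside's theorem for an absolutely irreducible representation. -/
theorem span_range_eq_top [FiniteDimensional E V] {ϑ : Representation E G V}
    (hϑ : ϑ.IsIrreducible)
    (hE : ∀ f : ϑ.IntertwiningMap ϑ, ∃ a : E, ∀ v : V, f v = a • v) :
    Submodule.span E (Set.range ϑ) = (⊤ : Submodule E (Module.End E V)) := by
  classical
  have hadj : Subalgebra.toSubmodule (Algebra.adjoin E (Set.range ϑ)) =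
      Submodule.span E (Set.range ϑ) := by
    rw [Algebra.adjoin_eq_span, ← MonoidHom.coe_mrange, Submonoid.closure_eq]
  rw [← hadj, eq_top_iff]
  intro A _
  let R := Algebra.adjoin E (Set.range ϑ)
  have hmem : ∀ g, ϑ g ∈ R := fun g => Algebra.subset_adjoin ⟨g, rfl⟩
  have : Nontrivial V := nontrivial_of_isIrreducible hϑ
  have : IsSimpleModule R V :=
    { exists_pair_ne := ⟨⊥, ⊤, bot_ne_top⟩
      eq_bot_or_eq_top := fun P => by
        rcases eq_bot_or_eq_top_of_isIrreducible hϑ (P.restrictScalars E)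
          (fun g v hv => P.smul_mem ⟨ϑ g, hmem g⟩ hv) with h | h
        · exact Or.inl ((Submodule.restrictScalars_eq_bot_iff _ _ _).mp h)
        · exact Or.inr ((Submodule.restrictScalars_eq_top_iff _ _ _).mp h) }
  -- The `R`-linear endomorphisms are scalars by `hE`, so an arbitrary `E`-linear `A` commutes with
  -- them. The density theorem then places `A` in the image of `R`.
  let A' : Module.End (Module.End R V) V :=
    { toFun := A
      map_add' := map_add A
      map_smul' := fun f x => by
        obtain ⟨a, ha⟩ := hE
          { (f.restrictScalars E : V →ₗ[E] V) with
            isIntertwining' := fun g => LinearMap.ext fun y => map_smul f ⟨ϑ g, hmem g⟩ y }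
        have ha' : ∀ y : V, f y = a • y := ha
        change A (f x) = f (A x)
        rw [ha', ha', map_smul] }
  let b := Module.finBasis E V
  obtain ⟨r, hr⟩ := jacobson_density A' (Finset.univ.image b)
  have hA : A = r := b.ext fun i => hr (b i) (Finset.mem_image_of_mem _ (Finset.mem_univ i))
  rw [hA]
  exact r.2

end Burnside

section ScalarExtension

variable {E F G V : Type*} [CommRing E] [CommRing F] [Algebra E F] [Group G] [AddCommGroup V]
  [Module E V]

/-- The extension of scalars of a representation with a given basis. -/
def scalarExtension {ι : Type*} [Fintype ι] [DecidableEq ι] (b : Module.Basis ι E V)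
    (ϑ : Representation E G V) : Representation F G (ι → F) where
  toFun g := Matrix.toLin' ((LinearMap.toMatrix b b (ϑ g)).map (algebraMap E F))
  map_one' := by
    rw [map_one, Module.End.one_eq_id, LinearMap.toMatrix_id,
      Matrix.map_one _ (map_zero _) (map_one _), Matrix.toLin'_one]
    rfl
  map_mul' g h := by
    rw [map_mul, Module.End.mul_eq_comp, LinearMap.toMatrix_comp b b b, Matrix.map_mul,
      Matrix.toLin'_mul]
    rfl

variable {ι : Type*} [Fintype ι] [DecidableEq ι] (b : Module.Basis ι E V)

theorem scalarExtension_apply (ϑ : Representation E G V) (g : G) :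
    scalarExtension (F := F) b ϑ g =
      Matrix.toLin' ((LinearMap.toMatrix b b (ϑ g)).map (algebraMap E F)) := rfl

theorem charpoly_scalarExtension [Module.Free E V] [Module.Finite E V] (ϑ : Representation E G V) (g : G) :
    (scalarExtension (F := F) b ϑ g).charpoly = (ϑ g).charpoly.map (algebraMap E F) := by
  rw [scalarExtension_apply, Matrix.charpoly_toLin', Matrix.charpoly_map,
    LinearMap.charpoly_toMatrix]

end ScalarExtension

section Burnside

variable {E F G V : Type*} [Field E] [Field F] [Algebra E F] [Group G] [AddCommGroup V]
  [Module E V] {ι : Type*} [Fintype ι] [DecidableEq ι] (b : Module.Basis ι E V)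

/-- The matrix units are combinations over `E` of the operators `ϑ g`, so they preserve any stable
subspace, and they move a nonzero coordinate of a vector to every basis vector. -/
theorem isIrreducible_scalarExtension [Nonempty ι] {ϑ : Representation E G V}
    (h : Submodule.span E (Set.range ϑ) = ⊤) :
    (scalarExtension (F := F) b ϑ).IsIrreducible := by
  refine isIrreducible_of_forall fun P hP => ?_
  have key : ∀ A : Module.End E V, ∀ w ∈ P,
      Matrix.toLin' ((LinearMap.toMatrix b b A).map (algebraMap E F)) w ∈ P := by
    intro A
    have hA : A ∈ Submodule.span E (Set.range ϑ) := h ▸ Submodule.mem_top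
    induction hA using Submodule.span_induction with
    | mem x hx => obtain ⟨g, rfl⟩ := hx; exact hP g
    | zero => intro w _; simp
    | add x y _ _ hx hy =>
      intro w hw
      rw [map_add, Matrix.map_add _ (map_add _), map_add]
      exact P.add_mem (hx w hw) (hy w hw)
    | smul c x _ hx =>
      intro w hw
      rw [map_smul, Matrix.map_smul' _ _ _ (map_mul _), map_smul]
      exact P.smul_mem _ (hx w hw)
  by_cases hP0 : P = ⊥
  · exact Or.inl hP0
  obtain ⟨w, hw, hw0⟩ := P.exists_mem_ne_zero_of_ne_bot hP0
  obtain ⟨i, hi⟩ := Function.ne_iff.mp hw0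
  refine Or.inr (eq_top_iff.mpr ?_)
  rw [← (Pi.basisFun F ι).span_eq, Submodule.span_le]
  rintro _ ⟨j, rfl⟩
  have h1 := key (Matrix.toLin b b (Matrix.single j i 1)) w hw
  have hm : (Matrix.single j i (1 : E)).map (algebraMap E F) = Matrix.single j i 1 := by
    ext a c
    simp only [Matrix.map_apply, Matrix.single_apply]
    split_ifs <;> simp
  rw [LinearMap.toMatrix_toLin, Matrix.toLin'_apply, hm, Matrix.single_mulVec_eq, one_mul] at h1
  have h2 := P.smul_mem (w i)⁻¹ h1
  rw [smul_smul, inv_mul_cancel₀ hi, one_smul] at h2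
  rwa [Pi.basisFun_apply]

end Burnside

end LocalType

namespace LocalType

/-! ### Eigencharacters of `U_D ^ m` and their stabilizers -/

section Quaternion

variable {p : ℕ} [Fact p.Prime] {L : LocalField p}
  {D : Type*} [DivisionRing D] [Algebra L D]
  [Algebra.IsCentral L D] [hD : Fact (Module.finrank L D = 4)] [FiniteDimensional ℚ_[p] L]

/-- The element `1 + x` of `U_D ^ n`. -/
def oneAdd {n : ℕ} (hn : 1 ≤ n) (x : idealPow L D n) : unitGroup L D :=
  mkUnit (1 + (x : D)) (qabs_one_add_eq_one (MemIdealPow.mono (by exact_mod_cast hn) x.2))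

theorem coe_oneAdd {n : ℕ} (hn : 1 ≤ n) (x : idealPow L D n) :
    (((oneAdd hn x : unitGroup L D) : Dˣ) : D) = 1 + x := rfl

theorem oneAdd_mem {n i : ℕ} (hn : 1 ≤ n) (x : idealPow L D n) (hx : MemIdealPow L i (x : D)) :
    oneAdd hn x ∈ unitFiltration L D i := by
  rw [mem_unitFiltration, coe_oneAdd, add_sub_cancel_left]
  exact hx

theorem eq_oneAdd {n : ℕ} (hn : 1 ≤ n) {u : unitGroup L D} (hu : u ∈ unitFiltration L D n) :
    u = oneAdd hn ⟨((u : Dˣ) : D) - 1, hu⟩ := by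
  refine Subtype.ext (Units.ext ?_)
  rw [coe_oneAdd, add_sub_cancel]

/-- The commutator of `u` and `v` in `D` is that of `u - 1` and `v - 1`, which lies in `𝔓 ^ (2 n)`.
-/
theorem commute_apply_of_mem_unitFiltration {F W : Type*} [Field F] [AddCommGroup W] [Module F W]
    {ρ : Representation F (unitGroup L D) W} {n : ℕ}
    (h1 : ∀ g ∈ unitFiltration L D (2 * n), ρ g = 1) {u v : unitGroup L D}
    (hu : u ∈ unitFiltration L D n) (hv : v ∈ unitFiltration L D n) :
    Commute (ρ u) (ρ v) := by
  have h : (v * u)⁻¹ * (u * v) ∈ unitFiltration L D (2 * n) := by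
    rw [inv_mul_mem_unitFiltration]
    have e : (((u * v : unitGroup L D) : Dˣ) : D) - ((v * u : unitGroup L D) : Dˣ) =
        (((u : Dˣ) : D) - 1) * (((v : Dˣ) : D) - 1) -
          (((v : Dˣ) : D) - 1) * (((u : Dˣ) : D) - 1) := by
      simp only [Subgroup.coe_mul, Units.val_mul]; noncomm_ring
    rw [e, Nat.cast_mul, Nat.cast_ofNat, two_mul]
    exact (MemIdealPow.mul hu hv).sub (MemIdealPow.mul hv hu)
  have h2 := h1 _ h
  rw [Commute, SemiconjBy, ← map_mul, ← map_mul, ← mul_inv_cancel_left (v * u) (u * v), map_mul, h2,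
    mul_one]

/-- An eigencharacter of `U_D ^ n / U_D ^ (2 n)` as an additive character of `𝔓 ^ n`. -/
def eigenAddChar {F W : Type*} [Field F] [AddCommGroup W] [Module F W]
    {ρ : Representation F (unitGroup L D) W} {n : ℕ} (hn : 1 ≤ n)
    (h1 : ∀ g ∈ unitFiltration L D (2 * n), ρ g = 1) {v : W} (hv : v ≠ 0)
    {φ : unitGroup L D → F} (hφ : ∀ u ∈ unitFiltration L D n, ρ u v = φ u • v) :
    AddChar (idealPow L D n) F where
  toFun x := φ (oneAdd hn x)
  map_zero_eq_one' := by
    have h := hφ _ (oneAdd_mem hn 0 (0 : idealPow L D n).2)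
    have e : oneAdd hn (0 : idealPow L D n) = 1 := Subtype.ext (Units.ext (by simp [coe_oneAdd]))
    rw [e, map_one, Module.End.one_apply] at h
    rw [e]
    refine (smul_left_injective F hv ?_).symm
    change (1 : F) • v = _
    rw [one_smul]; exact h
  map_add_eq_mul' x y := by
    -- `(1 + x)(1 + y)` and `1 + (x + y)` differ by `x * y ∈ 𝔓 ^ (2 n)`.
    have h : (oneAdd hn (x + y))⁻¹ * (oneAdd hn x * oneAdd hn y) ∈
        unitFiltration L D (2 * n) := by
      rw [inv_mul_mem_unitFiltration]
      have e : (((oneAdd hn x * oneAdd hn y : unitGroup L D) : Dˣ) : D) -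
          ((oneAdd hn (x + y) : unitGroup L D) : Dˣ) = (x : D) * y := by
        rw [Subgroup.coe_mul, Units.val_mul, coe_oneAdd, coe_oneAdd, coe_oneAdd,
          AddSubgroup.coe_add]
        noncomm_ring
      rw [e, Nat.cast_mul, Nat.cast_ofNat, two_mul]
      exact MemIdealPow.mul x.2 y.2
    have h3 : ρ (oneAdd hn x) (ρ (oneAdd hn y) v) = ρ (oneAdd hn (x + y)) v := by
      rw [← Module.End.mul_apply, ← map_mul,
        ← mul_inv_cancel_left (oneAdd hn (x + y)) (oneAdd hn x * oneAdd hn y), map_mul, h1 _ h,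
        mul_one]
    rw [hφ _ (oneAdd_mem hn y y.2), map_smul, hφ _ (oneAdd_mem hn x x.2),
      hφ _ (oneAdd_mem hn _ (x + y).2), smul_smul] at h3
    rw [mul_comm]
    exact (smul_left_injective F hv h3).symm

theorem sub_one_conj_eq (g u : unitGroup L D) :
    (((g * u * g⁻¹ : unitGroup L D) : Dˣ) : D) - 1 =
      ((g : Dˣ) : D) * (((u : Dˣ) : D) - 1) * ((g : Dˣ) : D)⁻¹ :=
  conj_sub_one (g : Dˣ) (u : Dˣ)

/-- Duality represents the eigencharacter by some `α`. Its triviality on `U_D ^ (2 m)` and its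
nontriviality on `U_D ^ (2 m - 1)` bound the valuation of `α` from both sides and so determine it.
-/
theorem exists_eigencharacter {W : Type*} [AddCommGroup W] [Module (PadicAlgCl p) W]
    [FiniteDimensional (PadicAlgCl p) W] [Nontrivial W]
    {ρ : Representation (PadicAlgCl p) (unitGroup L D) W} {m : ℕ} (hm : 1 ≤ m)
    {ψ : AddChar ℚ_[p] (PadicAlgCl p)} (hψ : ∀ x, ψ x = 1 ↔ ‖x‖ ≤ 1)
    (h1 : ∀ g ∈ unitFiltration L D (2 * m), ρ g = 1)
    (h2 : ∀ v, (∀ g ∈ unitFiltration L D (2 * m - 1), ρ g v = v) → v = 0) :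
    ∃ v : W, v ≠ 0 ∧ ∃ φ : unitGroup L D → PadicAlgCl p,
      (∀ u ∈ unitFiltration L D m, ρ u v = φ u • v) ∧
      ∃ α : D, (∀ x : idealPow L D m, φ (oneAdd hm x) = quatAddChar (L := L) D ψ (α * x)) ∧
        qabs L α = absUnif L ^ (-quatAddLevel L D ψ - 2 * m) := by
  classical
  obtain ⟨v₀, -, hv₀, hev⟩ := exists_common_eigenvector
    (S := {f | ∃ u ∈ unitFiltration L D m, f = ρ u}) (P := (⊤ : Submodule (PadicAlgCl p) W))
    (by
      rintro _ ⟨u, hu, rfl⟩ _ ⟨v, hv, rfl⟩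
      exact commute_apply_of_mem_unitFiltration h1 hu hv) top_ne_bot (fun _ _ _ _ => trivial)
  have hev' : ∀ u : unitGroup L D, ∃ c : PadicAlgCl p, u ∈ unitFiltration L D m →
      ρ u v₀ = c • v₀ := fun u => by
    by_cases hu : u ∈ unitFiltration L D m
    · obtain ⟨c, hc⟩ := hev _ ⟨u, hu, rfl⟩
      exact ⟨c, fun _ => hc⟩
    -- Outside `U_D ^ m` the value of `φ` is never used.
    · exact ⟨0, fun h => absurd h hu⟩
  choose φ hφ using hev'
  set g := eigenAddChar hm h1 hv₀ hφ with hg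
  have hgx : ∀ x, g x = φ (oneAdd hm x) := fun _ => rfl
  have hφ1 : ∀ x, g x = 1 ↔ ρ (oneAdd hm x) v₀ = v₀ := by
    intro x
    rw [hgx, hφ _ (oneAdd_mem hm x x.2)]
    refine ⟨fun h => by rw [h, one_smul], fun h => smul_left_injective _ hv₀ ?_⟩
    change _ = (1 : PadicAlgCl p) • v₀
    rw [one_smul]; exact h
  obtain ⟨α, hα⟩ := exists_eq_quatAddChar_mul hψ (i := m) (j := ((2 * m : ℕ) : ℤ)) (by omega) g
    (fun x hx => by
      rw [hφ1, h1 _ (oneAdd_mem (i := 2 * m) hm x hx), Module.End.one_apply])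
  -- the valuation of `α`
  have hlow : MemIdealPow L (-quatAddLevel L D ψ - (2 * m : ℕ)) α := by
    rw [← quatAddChar_mul_trivial_iff hψ]
    intro x hx
    have hx' : MemIdealPow L m x := hx.mono (by omega)
    rw [← hα ⟨x, hx'⟩, hφ1, h1 _ (oneAdd_mem (i := 2 * m) hm ⟨x, hx'⟩ hx), Module.End.one_apply]
  have hup : ¬ MemIdealPow L (-quatAddLevel L D ψ - (2 * m - 1 : ℕ)) α := by
    rw [← quatAddChar_mul_trivial_iff hψ]
    intro h
    refine hv₀ (h2 v₀ fun u hu => ?_)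
    have hum : u ∈ unitFiltration L D m := unitFiltration_anti (by omega) hu
    rw [eq_oneAdd hm hum, ← hφ1, hα]
    exact h _ hu
  have hα0 : α ≠ 0 := fun h => hup (h ▸ memIdealPow_zero)
  obtain ⟨k, hk⟩ := exists_qabs_eq_zpow (L := L) hα0
  have hk1 : -quatAddLevel L D ψ - (2 * m : ℕ) ≤ k := by
    rw [memIdealPow_iff, hk] at hlow
    exact absUnif_zpow_le_iff.mp hlow
  have hk2 : ¬ -quatAddLevel L D ψ - (2 * m - 1 : ℕ) ≤ k := by
    rw [memIdealPow_iff, hk] at hup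
    exact fun h => hup (absUnif_zpow_le_iff.mpr h)
  refine ⟨v₀, hv₀, φ, hφ, α, fun x => by rw [← hgx, hα], ?_⟩
  rw [hk]
  congr 1
  omega

/-- In odd valuation, the power `j` of a uniformizer of `L` absorbs all but one unit of the
valuation. -/
theorem exists_uniformizer_mul_center {α : D} {j : ℤ} (hk : qabs L α = absUnif L ^ (2 * j + 1)) :
    ∃ β z : D, α = β * z ∧ (∀ x, z * x = x * z) ∧ qabs L z = absUnif L ^ (2 * j) ∧
      qabs L β = absUnif L := by
  obtain ⟨ϖ, hϖ0, hϖ⟩ := exists_center_qabs_eq (D := D) L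
  have hz0 : algebraMap L D ϖ ^ j ≠ 0 := zpow_ne_zero _ (by simpa using hϖ0)
  have hp0 := absUnif_pos L
  refine ⟨α * (algebraMap L D ϖ ^ j)⁻¹, algebraMap L D ϖ ^ j, ?_, fun x => ?_, hϖ j, ?_⟩
  · rw [inv_mul_cancel_right₀ hz0]
  · rw [← map_zpow₀]; exact Algebra.commutes _ x
  · rw [qabs_mul, qabs_inv, hk, hϖ, zpow_add₀ hp0.ne', zpow_one,
      mul_comm, inv_mul_cancel_left₀ (zpow_pos hp0 _).ne']

theorem not_mem_range_of_qabs_eq_absUnif {β : D} (hβ : qabs L β = absUnif L) :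
    β ∉ Set.range (algebraMap L D) := by
  rintro ⟨a, ha⟩
  have ha0 : a ≠ 0 := by
    rintro rfl
    rw [map_zero] at ha
    exact ne_zero_of_qabs_eq_absUnif hβ ha.symm
  obtain ⟨i, hi⟩ := exists_norm_eq_absUnif_zpow ha0
  rw [← ha, qabs_algebraMap, hi, ← zpow_natCast, ← zpow_mul] at hβ
  have := absUnif_zpow_inj.mp (hβ.trans (zpow_one _).symm)
  push_cast at this
  omega

/-- The centralizer of `β` fixes the eigencharacter, hence preserves its eigenspace. Being
commutative, it has an eigenvector there; together with `U_D ^ m` it generates the stabilizer. -/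
theorem exists_eigenvector {W : Type*} [AddCommGroup W] [Module (PadicAlgCl p) W]
    [FiniteDimensional (PadicAlgCl p) W] [Nontrivial W]
    {ρ : Representation (PadicAlgCl p) (unitGroup L D) W} {m : ℕ} (hm : 1 ≤ m)
    {ψ : AddChar ℚ_[p] (PadicAlgCl p)} (hψ : ∀ x, ψ x = 1 ↔ ‖x‖ ≤ 1)
    (h1 : ∀ g ∈ unitFiltration L D (2 * m), ρ g = 1)
    (h2 : ∀ v, (∀ g ∈ unitFiltration L D (2 * m - 1), ρ g v = v) → v = 0) :
    ∃ β : D, qabs L β = absUnif L ∧ ∃ v : W, v ≠ 0 ∧ ∃ φ : unitGroup L D → PadicAlgCl p,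
      (∀ u ∈ unitFiltration L D m, ρ u v = φ u • v) ∧
      (∀ g, (∀ u ∈ unitFiltration L D m, φ (g * u * g⁻¹) = φ u) → g ∈ conjStabilizer L β m) ∧
      ∀ g ∈ conjStabilizer L β m, ∃ c : PadicAlgCl p, ρ g v = c • v := by
  obtain ⟨v₀, hv₀, φ, hφ, α, hα, hk⟩ := exists_eigencharacter hm hψ h1 h2
  -- The valuation of `α` is odd because `n(ψ_D) = 2 n(ψ_L) + 1`.
  obtain ⟨j, hj⟩ : ∃ j : ℤ, -quatAddLevel L D ψ - 2 * m = 2 * j + 1 :=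
    ⟨-addLevel ψ L - 1 - m, by rw [quatAddLevel_eq hψ]; omega⟩
  rw [hj] at hk
  obtain ⟨β, z, hαβ, hzc, hzq, hβ⟩ := exists_uniformizer_mul_center hk
  have hp0 := absUnif_pos L
  have hcomm : ∀ x : D, α * x - x * α = (β * x - x * β) * z := by
    intro x
    rw [hαβ, sub_mul, mul_assoc, hzc, ← mul_assoc, ← mul_assoc]
  -- conjugation of the eigencharacter
  have hconj : ∀ (a : unitGroup L D) (x : idealPow L D m),
      φ (a * oneAdd hm x * a⁻¹) =
        quatAddChar (L := L) D ψ (((a : Dˣ) : D)⁻¹ * (α * ((a : Dˣ) : D)) * x) := by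
    intro a x
    have hmem : a * oneAdd hm x * a⁻¹ ∈ unitFiltration L D m :=
      (normal_unitFiltration m).conj_mem _ (oneAdd_mem hm x x.2) a
    rw [eq_oneAdd hm hmem, hα, quatAddChar_apply, quatAddChar_apply]
    congr 1
    change redTrace L (α * ((((a * oneAdd hm x * a⁻¹ : unitGroup L D) : Dˣ) : D) - 1)) = _
    have e : α * (((a : Dˣ) : D) * x * ((a : Dˣ) : D)⁻¹) =
        (α * ((a : Dˣ) : D) * x) * ((a : Dˣ) : D)⁻¹ := by simp only [mul_assoc]
    rw [sub_one_conj_eq, coe_oneAdd, add_sub_cancel_left, e, redTrace_mul_comm]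
    simp only [mul_assoc]
  refine ⟨β, hβ, ?_⟩
  -- the centralizer of `β` preserves the eigenspace
  set Wφ : Submodule (PadicAlgCl p) W :=
    { carrier := {w | ∀ u ∈ unitFiltration L D m, ρ u w = φ u • w}
      add_mem' := fun {a b} ha hb u hu => by rw [map_add, ha u hu, hb u hu, smul_add]
      zero_mem' := fun u _ => by rw [map_zero, smul_zero]
      smul_mem' := fun c w hw u hu => by rw [map_smul, hw u hu, smul_comm] } with hWφ
  have hC : ∀ c : unitGroup L D, Commute ((c : Dˣ) : D) β → ∀ u ∈ unitFiltration L D m,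
      φ (c * u * c⁻¹) = φ u := by
    intro c hc u hu
    have hcα : Commute ((c : Dˣ) : D) α := by
      rw [hαβ]
      exact hc.mul_right (hzc _).symm
    rw [eq_oneAdd hm hu, hconj, hα, ← hcα.eq, inv_mul_cancel_left₀ (Units.ne_zero _)]
  obtain ⟨v, hv, hv0, hvev⟩ := exists_common_eigenvector
    (S := {f | ∃ c : unitGroup L D, Commute ((c : Dˣ) : D) β ∧ f = ρ c}) (P := Wφ)
    (by
      rintro _ ⟨c, hc, rfl⟩ _ ⟨c', hc', rfl⟩
      have : c * c' = c' * c := Subtype.ext (Units.ext (commute_of_commute (not_mem_range_of_qabs_eq_absUnif hβ) hc hc').eq)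
      rw [Commute, SemiconjBy, ← map_mul, ← map_mul, this])
    ((Submodule.ne_bot_iff _).mpr ⟨v₀, hφ, hv₀⟩)
    (by
      rintro _ ⟨c, hc, rfl⟩ w hw u hu
      have hmem : c⁻¹ * u * c⁻¹⁻¹ ∈ unitFiltration L D m :=
        (normal_unitFiltration m).conj_mem _ hu c⁻¹
      have h3 := hC c hc _ hmem
      have e : c * (c⁻¹ * u * c⁻¹⁻¹) * c⁻¹ = u := by group
      rw [e] at h3
      rw [← Module.End.mul_apply, ← map_mul, h3, ← map_smul, ← hw _ hmem, ← Module.End.mul_apply,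
        ← map_mul]
      congr 2
      group)
  refine ⟨v, hv0, φ, hv, ?_, ?_⟩
  · intro a ha
    -- Conjugating the character by `a` replaces `α` by `a⁻¹ * α * a`. Equality of the two
    -- characters on `𝔓 ^ m` puts the difference in the annihilator of `𝔓 ^ m`.
    have h4 : MemIdealPow L (-quatAddLevel L D ψ - m)
        (((a : Dˣ) : D)⁻¹ * (α * ((a : Dˣ) : D)) - α) := by
      rw [← quatAddChar_mul_trivial_iff hψ]
      intro x hx
      have h5 := ha _ (oneAdd_mem hm ⟨x, hx⟩ hx)
      rw [hconj, hα] at h5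
      have h6 : quatAddChar (L := L) D ψ (α * x) ≠ 0 := (AddChar.val_isUnit _ _).ne_zero
      rw [sub_mul, AddChar.map_sub_eq_div]
      exact (div_eq_one_iff_eq h6).mpr h5
    have h5 : ((a : Dˣ) : D)⁻¹ * (α * ((a : Dˣ) : D)) - α =
        ((a⁻¹ : unitGroup L D) : Dˣ) * (-(((a : Dˣ) : D) * β - β * ((a : Dˣ) : D)) * z) := by
      rw [neg_sub, ← hcomm, coe_inv_unit, mul_sub, inv_mul_cancel_left₀ (Units.ne_zero _)]
    rw [h5, memIdealPow_unit_mul, memIdealPow_iff, qabs_mul, qabs_neg, hzq] at h4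
    rw [mem_conjStabilizer, memIdealPow_iff]
    -- From `2 j + 1 = -n(ψ_D) - 2 m`: removing the central factor `z` of valuation `2 j` leaves
    -- exactly the exponent `m + 1`.
    have h6 : absUnif L ^ (-quatAddLevel L D ψ - (m : ℤ)) =
        absUnif L ^ ((m : ℤ) + 1) * absUnif L ^ (2 * j) := by
      rw [← zpow_add₀ hp0.ne']
      congr 1
      omega
    rw [h6] at h4
    exact le_of_mul_le_mul_right h4 (zpow_pos hp0 _)
  · intro a ha
    obtain ⟨c, hc, hca⟩ := exists_commute_mem_unitFiltration hβ m ha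
    obtain ⟨t, ht⟩ := hvev _ ⟨c, hc, rfl⟩
    refine ⟨φ (c⁻¹ * a) * t, ?_⟩
    rw [← mul_inv_cancel_left c a, map_mul, Module.End.mul_apply, hv _ hca, map_smul, ht,
      smul_smul, mul_inv_cancel_left]

end Quaternion

end LocalType

namespace LocalType

open Polynomial

/-! ### Dimension of the type and charpoly of a generator -/

section Quaternion

variable {p : ℕ} [Fact p.Prime] {L : LocalField p}
  {D : Type*} [DivisionRing D] [Algebra L D]
  [Algebra.IsCentral L D] [hD : Fact (Module.finrank L D = 4)] [FiniteDimensional ℚ_[p] L]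

/-- The residue of `τ` has order `q ^ 2 - 1`, and its `k`-th power lies in `k_L^×`, so it is killed
by `q - 1`; cancel `q - 1`. -/
theorem dvd_of_zpow_mem_centerI1 {τ : unitGroup L D}
    (hτ : ∀ y, y ∈ Subgroup.zpowers (unitResidue L D τ)) {k : ℤ} (h : τ ^ k ∈ centerI1 L D) :
    ((resCard L : ℤ) + 1) ∣ k := by
  rw [centerI1_eq_comap, Subgroup.mem_comap, map_zpow] at h
  obtain ⟨y, hy⟩ := h
  have hq := one_lt_resCard L
  have h1 : (unitResidue L D τ ^ k) ^ (resCard L - 1) = 1 := by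
    rw [← hy, ← map_pow, resCard, ← Nat.card_units, pow_card_eq_one', map_one]
  rw [← zpow_natCast, ← zpow_mul, ← orderOf_dvd_iff_zpow_eq_one,
    orderOf_eq_card_of_forall_mem_zpowers hτ, Nat.card_units, card_quatResidueField,
    Nat.cast_sub (Nat.one_le_pow _ _ (by omega)), Nat.cast_sub hq.le] at h1
  push_cast at h1
  have e : (resCard L : ℤ) ^ 2 - 1 = (resCard L + 1) * (resCard L - 1) := by ring
  rw [e] at h1
  exact Int.dvd_of_mul_dvd_mul_right (by omega) h1

theorem pow_mem_centerI1 {τ z : unitGroup L D} (hz : ∃ a : L, ((z : Dˣ) : D) = algebraMap L D a)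
    {n : ℕ} (hn : 1 ≤ n) (h : z⁻¹ * τ ^ (resCard L + 1) ∈ unitFiltration L D n) :
    τ ^ (resCard L + 1) ∈ centerI1 L D :=
  (mem_centerI1_iff L D).mpr ⟨z, hz, unitFiltration_anti hn h⟩

theorem exists_pow_inv_mul_mem_centerI1 {τ : unitGroup L D}
    (hτ : ∀ y, y ∈ Subgroup.zpowers (unitResidue L D τ))
    (h : τ ^ (resCard L + 1) ∈ centerI1 L D) (g : unitGroup L D) :
    ∃ i : Fin (resCard L + 1), (τ ^ (i : ℕ))⁻¹ * g ∈ centerI1 L D := by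
  obtain ⟨i, hi⟩ := exists_pow_inv_mul_mem_unitFiltration hτ g
  refine ⟨⟨i % (resCard L + 1), Nat.mod_lt _ (by omega)⟩, ?_⟩
  have e : (τ ^ (i % (resCard L + 1)))⁻¹ * g =
      (τ ^ (resCard L + 1)) ^ (i / (resCard L + 1)) * ((τ ^ i)⁻¹ * g) := by
    rw [inv_mul_eq_iff_eq_mul, ← mul_assoc, ← mul_assoc, ← pow_mul, ← pow_add, Nat.mod_add_div,
      mul_inv_cancel, one_mul]
  rw [e]
  exact mul_mem (pow_mem h _) (unitFiltration_one_le_centerI1 L D hi)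

theorem eq_of_pow_inv_mul_mem_centerI1 {τ : unitGroup L D}
    (hτ : ∀ y, y ∈ Subgroup.zpowers (unitResidue L D τ)) {i j : Fin (resCard L + 1)}
    {g h : unitGroup L D} (hg : g ∈ centerI1 L D) (hh : h ∈ centerI1 L D)
    (hij : (τ ^ (i : ℕ) * g)⁻¹ * (τ ^ (j : ℕ) * h) ∈ centerI1 L D) : i = j := by
  have h1 : τ ^ ((j : ℤ) - (i : ℤ)) ∈ centerI1 L D := by
    have e : τ ^ ((j : ℤ) - (i : ℤ)) = g * ((τ ^ (i : ℕ) * g)⁻¹ * (τ ^ (j : ℕ) * h)) * h⁻¹ := by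
      have : τ ^ ((j : ℤ) - (i : ℤ)) = (τ ^ (i : ℕ))⁻¹ * τ ^ (j : ℕ) := by
        rw [sub_eq_neg_add, zpow_add, zpow_neg, zpow_natCast, zpow_natCast]
      rw [this]
      group
    rw [e]
    exact mul_mem (mul_mem hg hij) (inv_mem hh)
  obtain ⟨c, hc⟩ := dvd_of_zpow_mem_centerI1 hτ h1
  have hi := i.2
  have hj := j.2
  have hc0 : c = 0 := by
    by_contra hne
    rcases lt_or_gt_of_ne hne with h | h
    · nlinarith
    · nlinarith
  rw [hc0, mul_zero] at hc
  exact Fin.ext (by omega)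

/-- The structure of the restriction to `𝒪_D^×` of an irreducible representation that becomes, after
twisting, trivial on `U_D ^ (2 m)` and without fixed vectors under `U_D ^ (2 m - 1)`. -/
theorem finrank_and_charpoly_of_level {W : Type*} [AddCommGroup W] [Module (PadicAlgCl p) W]
    [FiniteDimensional (PadicAlgCl p) W]
    {σ : Representation (PadicAlgCl p) (unitGroup L D) W} (hσ : σ.IsIrreducible)
    {lam : unitGroup L D →* PadicAlgCl p} {m : ℕ} (hm : 1 ≤ m)
    {ψ : AddChar ℚ_[p] (PadicAlgCl p)} (hψ : ∀ x, ψ x = 1 ↔ ‖x‖ ≤ 1)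
    (h1 : ∀ g ∈ unitFiltration L D (2 * m), twist lam σ g = 1)
    (h2 : ∀ v, (∀ g ∈ unitFiltration L D (2 * m - 1), twist lam σ g v = v) → v = 0)
    {τ : unitGroup L D} (hτ : ∀ y, y ∈ Subgroup.zpowers (unitResidue L D τ))
    (hτ1 : τ ^ (resCard L + 1) ∈ centerI1 L D) {a : PadicAlgCl p}
    (ha : ∀ v, σ (τ ^ (resCard L + 1)) v = a • v) :
    Module.finrank (PadicAlgCl p) W = resCard L ^ (m - 1) * (resCard L + 1) ∧
      (σ τ).charpoly = (X ^ (resCard L + 1) - C a) ^ (resCard L ^ (m - 1)) := by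
  have := nontrivial_of_isIrreducible hσ
  obtain ⟨β, hβ, v, hv, φ, hφ, hstab, hJ⟩ := exists_eigenvector hm hψ h1 h2
  have hlam : ∀ g, lam g ≠ 0 := fun g => ((Group.isUnit g).map lam).ne_zero
  have hσt : ∀ g w, σ g w = (lam g)⁻¹ • twist lam σ g w := fun g w => by
    change _ = (lam g)⁻¹ • (lam g • σ g w)
    rw [smul_smul, inv_mul_cancel₀ (hlam g), one_smul]
  -- Characters are invariant under conjugation, so twisting by `lam` does not change the stabilizer
  -- of an eigencharacter.
  have hlamc : ∀ g u, lam (g * u * g⁻¹) = lam u := fun g u => by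
    rw [map_mul, map_mul, mul_comm (lam g), mul_assoc, ← map_mul, mul_inv_cancel, map_one, mul_one]
  set Z := centerI1 L D
  set J := conjStabilizer L β m
  have hJZ : J ≤ Z := conjStabilizer_le_centerI1 hβ hm
  have hcard : Nat.card (Z ⧸ J.subgroupOf Z) = resCard L ^ (m - 1) :=
    relIndex_conjStabilizer_centerI1 hβ hm
  have hq := one_lt_resCard L
  have : Finite (Z ⧸ J.subgroupOf Z) := Nat.finite_of_card_ne_zero (by
    rw [hcard]; exact pow_ne_zero _ (by omega))
  have := Fintype.ofFinite (Z ⧸ J.subgroupOf Z)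
  -- Representatives of `K / J`: powers of `τ` for `K / Z I₁`, times representatives of `Z I₁ / J`.
  let r : Fin (resCard L + 1) × (Z ⧸ J.subgroupOf Z) → unitGroup L D :=
    fun x => τ ^ (x.1 : ℕ) * (x.2.out : Z)
  have hJ' : ∀ g ∈ J, ∃ c : PadicAlgCl p, σ g v = c • v := fun g hg => by
    obtain ⟨c, hc⟩ := hJ g hg
    exact ⟨(lam g)⁻¹ * c, by rw [hσt, hc, smul_smul]⟩
  have hli : LinearIndependent (PadicAlgCl p) fun x => σ (r x) v := by
    refine linearIndependent_translates (U := unitFiltration L D m) (J := J)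
      (φ := fun u => (lam u)⁻¹ * φ u) hv (fun u hu => by rw [hσt, hφ u hu, smul_smul])
      (fun g hg => hstab g fun u hu => ?_) ?_
    · have h3 := hg u hu
      rw [hlamc] at h3
      exact mul_left_cancel₀ (inv_ne_zero (hlam u)) h3
    · rintro ⟨i, x⟩ ⟨j, y⟩ hxy
      have hij : i = j := eq_of_pow_inv_mul_mem_centerI1 hτ x.out.2 y.out.2 (hJZ hxy)
      subst hij
      congr 1
      rw [← x.out_eq, ← y.out_eq]
      refine QuotientGroup.eq.mpr ?_
      rw [Subgroup.mem_subgroupOf]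
      have e : ((r (i, x))⁻¹ * r (i, y)) = (x.out : unitGroup L D)⁻¹ * (y.out : unitGroup L D) := by
        simp only [r]; group
      rwa [e] at hxy
  have hsp := span_translates hσ (J := J) hv hJ' (r := r) (fun g => by
    obtain ⟨i, hi⟩ := exists_pow_inv_mul_mem_centerI1 hτ hτ1 g
    refine ⟨(i, QuotientGroup.mk ⟨_, hi⟩), ?_⟩
    have h3 := (QuotientGroup.eq (s := J.subgroupOf Z)).mp
      (QuotientGroup.mk ⟨_, hi⟩ : Z ⧸ J.subgroupOf Z).out_eq
    rw [Subgroup.mem_subgroupOf] at h3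
    simp only [r, mul_inv_rev, mul_assoc]
    exact h3)
  let b := Module.Basis.mk hli hsp.ge
  have hb : ∀ x, b x = σ (r x) v := fun x => Module.Basis.mk_apply _ _ _
  refine ⟨?_, ?_⟩
  · rw [Module.finrank_eq_card_basis b, Fintype.card_prod, Fintype.card_fin,
      ← Nat.card_eq_fintype_card, hcard, mul_comm]
  -- Left multiplication by `τ` raises the power of `τ` by one, and wraps around through the scalar
  -- `a` by which `τ ^ (q + 1)` acts.
  · have := charpoly_eq_of_block_shift b (σ τ) a (fun j => ?_) (fun i j => ?_)
    · rwa [← Nat.card_eq_fintype_card, hcard] at this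
    · rw [hb, hb, ← Module.End.mul_apply, ← map_mul]
      simp only [r, Fin.val_last, ← mul_assoc, ← pow_succ', Fin.val_zero, pow_zero, one_mul]
      rw [map_mul, Module.End.mul_apply, ha]
    · rw [hb, hb, ← Module.End.mul_apply, ← map_mul]
      simp only [r, ← mul_assoc, ← pow_succ', Fin.val_succ, Fin.val_castSucc]

theorem exists_unitFiltration_apply_eq_one {k V : Type*} [Field k] [AddCommGroup V] [Module k V]
    [FiniteDimensional k V] {ρ : Representation k (unitGroup L D) V}
    (h : QuatSmooth L (unitGroup L D).subtype ρ) :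
    ∃ n : ℕ, ∀ g ∈ unitFiltration L D n, ρ g = 1 := by
  let b := Module.finBasis k V
  choose n hn using fun i => h (b i)
  refine ⟨Finset.univ.sup n, fun g hg => b.ext fun i => ?_⟩
  rw [Module.End.one_apply]
  exact hn i g (unitFiltration_anti (Finset.le_sup (Finset.mem_univ i)) hg)

/-- A nonzero vector is fixed by a subgroup of finite index, so the translates by finitely many
representatives span. -/
theorem finiteDimensional_of_isIrreducible {k V : Type*} [Field k] [AddCommGroup V] [Module k V]
    {ρ : Representation k (unitGroup L D) V} (hρ : ρ.IsIrreducible)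
    (h : QuatSmooth L (unitGroup L D).subtype ρ) : FiniteDimensional k V := by
  have := nontrivial_of_isIrreducible hρ
  obtain ⟨v, hv⟩ := exists_ne (0 : V)
  obtain ⟨n, hn⟩ := h v
  have hfin := finiteIndex_unitFiltration (L := L) (D := D) n
  have hsp := span_translates hρ (J := unitFiltration L D n) hv
    (fun g hg => ⟨1, by rw [one_smul]; exact hn g hg⟩)
    (r := fun x : unitGroup L D ⧸ unitFiltration L D n => x.out)
    (fun g => ⟨QuotientGroup.mk g, QuotientGroup.eq.mp (QuotientGroup.mk g).out_eq⟩)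
  have : Finite (unitGroup L D ⧸ unitFiltration L D n) := Subgroup.finite_quotient_of_finiteIndex
  exact ⟨by rw [← hsp]; exact Submodule.fg_span (Set.finite_range _)⟩

/-- After extension of scalars `ϑ` stays irreducible, so the map `Φ` induced by `f` into the
`D^×`-representation is injective. The level conditions on the twist by `χ ∘ Nrd` then pull back to
`ϑ`. -/
theorem finrank_and_charpoly_of_isKType {E : LocalField p} {V : Type*} [AddCommGroup V] [Module E V]
    [FiniteDimensional E V]
    {ϑ : Representation E (unitGroup L D) V} {w : WeilDeligneRep L} (hϑ : IsKType ϑ w)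
    (hE : ∀ f : ϑ.IntertwiningMap ϑ, ∃ a : E, ∀ v : V, f v = a • v)
    (hr : w.r.IsIrreducible) {m : ℕ} (hm : 1 ≤ m)
    (hcond : 2 * m + 1 ∈ twistConductors w.r)
    {τ : unitGroup L D} (hτ : ∀ y, y ∈ Subgroup.zpowers (unitResidue L D τ))
    (hτ1 : τ ^ (resCard L + 1) ∈ centerI1 L D) {a : E}
    (ha : ∀ v, ϑ (τ ^ (resCard L + 1)) v = a • v) :
    Module.finrank E V = resCard L ^ (m - 1) * (resCard L + 1) ∧
      (ϑ τ).charpoly = (X ^ (resCard L + 1) - C a) ^ (resCard L ^ (m - 1)) := by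
  classical
  have := nontrivial_of_isIrreducible hϑ.1
  obtain ⟨d, π, f, ψ, χ, hf, hfe, hψ, h1, h2⟩ := exists_twist_level hϑ hr (by omega) hcond
  let b := Module.finBasis E V
  have : Nonempty (Fin (Module.finrank E V)) := b.index_nonempty
  set σ := scalarExtension (F := PadicAlgCl p) b ϑ with hσdef
  have hσ : σ.IsIrreducible := isIrreducible_scalarExtension b (span_range_eq_top hϑ.1 hE)
  let Φ : (Fin (Module.finrank E V) → PadicAlgCl p) →ₗ[PadicAlgCl p] (Fin d → PadicAlgCl p) :=
    (Pi.basisFun (PadicAlgCl p) _).constr (PadicAlgCl p) fun i => f (b i)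
  have hΦ : ∀ i, Φ (Pi.single i 1) = f (b i) := fun i => by
    rw [← Pi.basisFun_apply, Module.Basis.constr_basis]
  have hΦe : ∀ g, Φ ∘ₗ σ g = π (g : Dˣ) ∘ₗ Φ := by
    intro g
    refine (Pi.basisFun (PadicAlgCl p) _).ext fun i => ?_
    rw [Pi.basisFun_apply, LinearMap.comp_apply, LinearMap.comp_apply, hΦ, ← hfe, hσdef,
      scalarExtension_apply, Matrix.toLin'_apply, Matrix.mulVec_single_one]
    rw [← (Pi.basisFun (PadicAlgCl p) (Fin (Module.finrank E V))).sum_repr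
      (Matrix.col _ i), map_sum]
    conv_rhs => rw [← b.sum_repr (ϑ g (b i)), map_sum]
    refine Finset.sum_congr rfl fun j _ => ?_
    rw [map_smul, map_smul, Pi.basisFun_apply, hΦ, Pi.basisFun_repr, Matrix.col_apply,
      Matrix.map_apply, LinearMap.toMatrix_apply, algebraMap_smul]
  have hker : LinearMap.ker Φ = ⊥ := by
    refine (eq_bot_or_eq_top_of_isIrreducible hσ (LinearMap.ker Φ) fun g v hv => ?_).resolve_right
      fun h => hf (b.ext fun i => ?_)
    · rw [LinearMap.mem_ker] at hv ⊢
      rw [← LinearMap.comp_apply, hΦe, LinearMap.comp_apply, hv, map_zero]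
    · have : Pi.single i 1 ∈ LinearMap.ker Φ := h ▸ Submodule.mem_top
      rw [LinearMap.mem_ker, hΦ] at this
      rw [this, LinearMap.zero_apply]
  have hinj := LinearMap.ker_eq_bot.mp hker
  let lam : unitGroup L D →* PadicAlgCl p :=
    { toFun := fun g => χ (redNorm L ((g : Dˣ) : D))
      map_one' := by simp [redNorm_one]
      map_mul' := fun g h => by
        rw [← map_mul, ← redNorm_mul hD.out]; rfl }
  have htw : ∀ g v, Φ (twist lam σ g v) = (χ (redNorm L ((g : Dˣ) : D)) • π (g : Dˣ)) (Φ v) := by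
    intro g v
    change Φ (lam g • σ g v) = _
    rw [map_smul, ← LinearMap.comp_apply, hΦe]
    rfl
  have key := finrank_and_charpoly_of_level hσ (lam := lam) hm hψ
    (fun g hg => LinearMap.ext fun v => hinj (by rw [htw, h1 g hg]; rfl))
    (fun v hv => hinj (by
      rw [map_zero]
      refine h2 _ fun g hg => ?_
      conv_rhs => rw [← hv g hg, htw]
      rfl))
    hτ hτ1 (a := algebraMap E (PadicAlgCl p) a) (fun v => by
      have h3 : ϑ (τ ^ (resCard L + 1)) = a • LinearMap.id := LinearMap.ext ha
      rw [hσdef, scalarExtension_apply, h3, map_smul, LinearMap.toMatrix_id,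
        Matrix.map_smul' _ _ _ (map_mul _), Matrix.map_one _ (map_zero _) (map_one _), map_smul,
        Matrix.toLin'_one]
      rfl)
  refine ⟨by simpa using key.1, ?_⟩
  have h4 := key.2
  rw [hσdef, charpoly_scalarExtension] at h4
  refine Polynomial.map_injective _ (algebraMap E (PadicAlgCl p)).injective ?_
  rw [h4]
  simp

end Quaternion

/-! ### Operators without invariant subspaces -/

section SimpleOperator

variable {k V V' : Type*} [Field k] [AddCommGroup V] [Module k V] [FiniteDimensional k V]
  [AddCommGroup V'] [Module k V'] [FiniteDimensional k V']

theorem aeval_apply_eq_sum {n : ℕ} (T : Module.End k V) (v : V) {g : k[X]} (hg : g.degree < n) :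
    aeval T g v = ∑ i : Fin n, g.coeff i • (T ^ (i : ℕ)) v := by
  rcases eq_or_ne g 0 with rfl | h0
  · simp
  rw [aeval_eq_sum_range' ((natDegree_lt_iff_degree_lt h0).mpr hg), LinearMap.sum_apply,
    Finset.sum_range]
  rfl

/-- The operator `T` has no nontrivial invariant subspaces. -/
def IsSimpleOperator (T : Module.End k V) : Prop :=
  ∀ P : Submodule k V, (∀ v ∈ P, T v ∈ P) → P = ⊥ ∨ P = ⊤

/-- The vector `v` generates the whole space under `T`. If `g` killed it, division by `g` would
bound the dimension by the degree of `g`. -/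
theorem IsSimpleOperator.aeval_apply_ne_zero {T : Module.End k V} (hT : IsSimpleOperator T) {v : V}
    (hv : v ≠ 0) {g : k[X]} (hg : g ≠ 0) (hdeg : g.degree < Module.finrank k V) :
    aeval T g v ≠ 0 := by
  intro h
  let ev : k[X] →ₗ[k] V := (LinearMap.applyₗ v).comp (aeval T).toLinearMap
  have hev : ∀ q, ev q = aeval T q v := fun _ => rfl
  have htop : LinearMap.range ev = ⊤ := by
    refine (hT (LinearMap.range ev) ?_).resolve_left fun hb => hv ?_
    · rintro _ ⟨q, rfl⟩
      refine ⟨X * q, ?_⟩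
      rw [hev, map_mul, aeval_X, Module.End.mul_apply, hev]
    · have : ev 1 ∈ LinearMap.range ev := ⟨1, rfl⟩
      rw [hb, Submodule.mem_bot, hev, map_one, Module.End.one_apply] at this
      exact this
  have hspan : Submodule.span k (Set.range fun i : Fin g.natDegree => (T ^ (i : ℕ)) v) = ⊤ := by
    rw [eq_top_iff, ← htop]
    rintro _ ⟨q, rfl⟩
    have hq : ev q = aeval T (q % g) v := by
      conv_lhs => rw [hev, ← EuclideanDomain.mod_add_div q g, mul_comm, map_add, map_mul,
        LinearMap.add_apply, Module.End.mul_apply, h, map_zero, add_zero]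
    have hd : (q % g).degree < (g.natDegree : WithBot ℕ) := by
      rw [← degree_eq_natDegree hg]; exact degree_mod_lt q hg
    rw [hq, aeval_apply_eq_sum T v hd]
    exact Submodule.sum_mem _ fun i _ => Submodule.smul_mem _ _ (Submodule.subset_span ⟨i, rfl⟩)
  have h1 := finrank_range_le_card (R := k) fun i : Fin g.natDegree => (T ^ (i : ℕ)) v
  rw [Set.finrank, hspan, finrank_top, Fintype.card_fin] at h1
  rw [degree_eq_natDegree hg] at hdeg
  exact absurd h1 (not_le.mpr (by exact_mod_cast hdeg))

theorem IsSimpleOperator.linearIndependent {T : Module.End k V} (hT : IsSimpleOperator T) {v : V}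
    (hv : v ≠ 0) : LinearIndependent k fun i : Fin (Module.finrank k V) => (T ^ (i : ℕ)) v := by
  rw [Fintype.linearIndependent_iff]
  intro c hc i
  set g : k[X] := ∑ j : Fin (Module.finrank k V), C (c j) * X ^ (j : ℕ) with hg
  have hcoeff : ∀ j : Fin (Module.finrank k V), g.coeff j = c j := by
    intro j
    rw [hg, finsetSum_coeff]
    simp [Fin.val_inj]
  have hdeg : g.degree < (Module.finrank k V : WithBot ℕ) := by
    refine lt_of_le_of_lt (degree_sum_le _ _) ?_
    rw [Finset.sup_lt_iff (WithBot.bot_lt_coe _)]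
    exact fun j _ => (degree_C_mul_X_pow_le _ _).trans_lt (by exact_mod_cast j.2)
  by_contra hci
  refine hT.aeval_apply_ne_zero hv (g := g) (fun h => hci ?_) hdeg ?_
  · rw [← hcoeff, h, coeff_zero]
  · rw [aeval_apply_eq_sum T v hdeg, ← hc]
    exact Finset.sum_congr rfl fun j _ => by rw [hcoeff]

/-- Two proper factors of the charpoly would each keep vectors nonzero, while their product is zero
by Cayley–Hamilton. -/
theorem IsSimpleOperator.irreducible_charpoly [Nontrivial V] {T : Module.End k V}
    (hT : IsSimpleOperator T) : Irreducible T.charpoly := by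
  obtain ⟨v, hv⟩ := exists_ne (0 : V)
  have hm := LinearMap.charpoly_monic T
  have hd := LinearMap.charpoly_natDegree T
  rw [hm.irreducible_iff_natDegree']
  refine ⟨fun h => ?_, fun f g hf hg hfg hmem => ?_⟩
  · rw [h, natDegree_one] at hd
    exact (Module.finrank_pos (R := k) (M := V)).ne hd
  · rw [Finset.mem_Ioc] at hmem
    have hsum : f.natDegree + g.natDegree = Module.finrank k V := by
      rw [← hd, ← hfg, hf.natDegree_mul hg]
    have hdf : f.degree < (Module.finrank k V : WithBot ℕ) := by
      rw [degree_eq_natDegree hf.ne_zero]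
      exact_mod_cast (by omega : f.natDegree < Module.finrank k V)
    have hdg : g.degree < (Module.finrank k V : WithBot ℕ) := by
      rw [degree_eq_natDegree hg.ne_zero]
      rw [hd] at hmem
      exact_mod_cast (by omega : g.natDegree < Module.finrank k V)
    refine hT.aeval_apply_ne_zero (hT.aeval_apply_ne_zero hv hg.ne_zero hdg) hf.ne_zero hdf ?_
    rw [← Module.End.mul_apply, ← map_mul, hfg, LinearMap.aeval_self_charpoly,
      LinearMap.zero_apply]

/-- Both spaces are cyclic over `k[X]`, isomorphic to the quotient by the common charpoly; match the
iterates of two cyclic vectors. -/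
theorem IsSimpleOperator.exists_equiv [Nontrivial V] [Nontrivial V'] {T : Module.End k V}
    {T' : Module.End k V'} (hT : IsSimpleOperator T) (hT' : IsSimpleOperator T')
    (h : T.charpoly = T'.charpoly) : ∃ e : V ≃ₗ[k] V', ∀ v, e (T v) = T' (e v) := by
  obtain ⟨v, hv⟩ := exists_ne (0 : V)
  obtain ⟨v', hv'⟩ := exists_ne (0 : V')
  have hn : Module.finrank k V' = Module.finrank k V := by
    rw [← LinearMap.charpoly_natDegree T, h, LinearMap.charpoly_natDegree]
  have hli' := hT'.linearIndependent hv'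
  rw [hn] at hli'
  have : Nonempty (Fin (Module.finrank k V)) := ⟨⟨0, Module.finrank_pos⟩⟩
  let b := basisOfLinearIndependentOfCardEqFinrank (hT.linearIndependent hv) (Fintype.card_fin _)
  let b' := basisOfLinearIndependentOfCardEqFinrank hli' (by rw [Fintype.card_fin, hn])
  have hb : ∀ i, b i = (T ^ (i : ℕ)) v := fun i => by
    simp only [b, coe_basisOfLinearIndependentOfCardEqFinrank]
  have hb' : ∀ i, b' i = (T' ^ (i : ℕ)) v' := fun i => by
    simp only [b', coe_basisOfLinearIndependentOfCardEqFinrank]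
  let e := b.equiv b' (Equiv.refl _)
  have he : ∀ q : k[X], e (aeval T q v) = aeval T' q v' := by
    intro q
    have hm := LinearMap.charpoly_monic T
    have hd : (q %ₘ T.charpoly).degree < (Module.finrank k V : WithBot ℕ) := by
      rw [← LinearMap.charpoly_natDegree T, ← degree_eq_natDegree hm.ne_zero]
      exact degree_modByMonic_lt q hm
    have h1 : aeval T q v = aeval T (q %ₘ T.charpoly) v := by
      conv_lhs => rw [← modByMonic_add_div q T.charpoly, map_add, map_mul,
        LinearMap.aeval_self_charpoly, zero_mul, add_zero]
    have h2 : aeval T' q v' = aeval T' (q %ₘ T.charpoly) v' := by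
      conv_lhs => rw [← modByMonic_add_div q T.charpoly, map_add, map_mul, h,
        LinearMap.aeval_self_charpoly, zero_mul, add_zero, ← h]
    rw [h1, h2, aeval_apply_eq_sum T v hd, aeval_apply_eq_sum T' v' hd, map_sum]
    refine Finset.sum_congr rfl fun i _ => ?_
    rw [map_smul, ← hb, Module.Basis.equiv_apply, Equiv.refl_apply, hb']
  refine ⟨e, fun w => ?_⟩
  have hw : ∃ q : k[X], aeval T q v = w := by
    refine ⟨∑ i, C (b.repr w i) * X ^ (i : ℕ), ?_⟩
    conv_rhs => rw [← b.sum_repr w]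
    rw [map_sum, LinearMap.sum_apply]
    refine Finset.sum_congr rfl fun i _ => ?_
    rw [map_mul, aeval_C, map_pow, aeval_X, Module.End.mul_apply, Module.algebraMap_end_apply, hb]
  obtain ⟨q, rfl⟩ := hw
  have h3 : T (aeval T q v) = aeval T (X * q) v := by
    rw [map_mul, aeval_X, Module.End.mul_apply]
  rw [h3, he, he, map_mul, aeval_X, Module.End.mul_apply]

end SimpleOperator

section Exact

variable {k A B C : Type*} [Field k] [AddCommGroup A] [Module k A] [FiniteDimensional k A]
  [AddCommGroup B] [Module k B] [FiniteDimensional k B]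
  [AddCommGroup C] [Module k C] [FiniteDimensional k C]

/-- A linear splitting of the sequence makes the matrix of `TB` block triangular. -/
theorem charpoly_eq_mul_of_exact {i : A →ₗ[k] B} {j : B →ₗ[k] C} (hi : Function.Injective i)
    (hij : Function.Exact i j) (hj : Function.Surjective j) {TA : Module.End k A}
    {TB : Module.End k B} {TC : Module.End k C} (hA : ∀ a, i (TA a) = TB (i a))
    (hC : ∀ b, j (TB b) = TC (j b)) : TB.charpoly = TA.charpoly * TC.charpoly := by
  classical
  obtain ⟨s, hs⟩ := j.exists_rightInverse_of_surjective (LinearMap.range_eq_top.mpr hj)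
  have hs' : ∀ c, j (s c) = c := LinearMap.congr_fun hs
  have hji : ∀ a, j (i a) = 0 := fun a => (hij (i a)).mpr ⟨a, rfl⟩
  let e : (A × C) ≃ₗ[k] B := LinearEquiv.ofBijective (i.coprod s) (by
    constructor
    · rw [← LinearMap.ker_eq_bot, LinearMap.ker_eq_bot']
      rintro ⟨a, c⟩ h
      replace h : i a + s c = 0 := h
      have h1 := congrArg j h
      rw [map_add, hji, hs', zero_add, map_zero] at h1
      subst h1
      rw [map_zero, add_zero] at h
      exact Prod.ext (hi (h.trans (map_zero i).symm)) rfl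
    · intro b
      obtain ⟨a, ha⟩ := (hij (b - s (j b))).mp (by rw [map_sub, hs', sub_self])
      exact ⟨(a, j b), by rw [LinearMap.coprod_apply, ha, sub_add_cancel]⟩)
  have he : ∀ x : A × C, e x = i x.1 + s x.2 := fun x => LinearMap.coprod_apply _ _ _
  let T' : Module.End k (A × C) := e.symm.conj TB
  have hT' : ∀ x, T' x = e.symm (TB (e x)) := fun x => rfl
  have h1 : ∀ a, T' (a, 0) = (TA a, 0) := fun a => by
    have h0 : ∀ a, e (a, 0) = i a := fun a => by
      rw [he]; exact (congrArg (i a + ·) (map_zero s)).trans (add_zero _)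
    rw [hT', LinearEquiv.symm_apply_eq, h0, h0, hA]
  have h2 : ∀ x, (T' x).2 = TC x.2 := fun x => by
    have h3 : j (e (T' x)) = (T' x).2 := by rw [he, map_add, hji, hs', zero_add]
    rw [← h3, hT', LinearEquiv.apply_symm_apply, hC, he, map_add, hji, hs', zero_add]
  let bA := Module.finBasis k A
  let bC := Module.finBasis k C
  have hmat : LinearMap.toMatrix (bA.prod bC) (bA.prod bC) T' =
      Matrix.fromBlocks (LinearMap.toMatrix bA bA TA)
        (Matrix.of fun x y => bA.repr (T' (0, bC y)).1 x) 0 (LinearMap.toMatrix bC bC TC) := by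
    ext x y
    rcases x with x | x <;> rcases y with y | y <;>
      simp [LinearMap.toMatrix_apply, h1, h2]
  have h4 : T'.charpoly = TB.charpoly := LinearEquiv.charpoly_conj e.symm TB
  rw [← h4, ← LinearMap.charpoly_toMatrix T' (bA.prod bC), hmat, Matrix.charpoly_fromBlocks_zero₂₁,
    LinearMap.charpoly_toMatrix, LinearMap.charpoly_toMatrix]

end Exact

/-! ### Classes in the Grothendieck group are determined by the charpoly of `τ` -/

section Quaternion

variable {p : ℕ} [Fact p.Prime] {L : LocalField p}
  {D : Type*} [DivisionRing D] [Algebra L D]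
  [Algebra.IsCentral L D] [hD : Fact (Module.finrank L D = 4)] [FiniteDimensional ℚ_[p] L]
  {k : Type*} [Field k]

theorem quatSmooth_of_trivial {V : Type*} [AddCommGroup V] [Module k V]
    {ρ : Representation k (unitGroup L D) V} {n : ℕ} (h : ∀ g ∈ unitFiltration L D n, ρ g = 1) :
    QuatSmooth L (unitGroup L D).subtype ρ :=
  fun v => ⟨n, fun g hg => by rw [h g hg, Module.End.one_apply]⟩

theorem exists_smoothRep {V : Type*} [AddCommGroup V] [Module k V] [FiniteDimensional k V]
    {ρ : Representation k (unitGroup L D) V} (h : QuatSmooth L (unitGroup L D).subtype ρ) :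
    ∃ A : SmoothRep L D k, ∃ e : V ≃ₗ[k] (Fin A.dim → k), ∀ g v, A.ρ g (e v) = e (ρ g v) := by
  let e := (Module.finBasis k V).equivFun
  let ρ' : Representation k (unitGroup L D) (Fin (Module.finrank k V) → k) :=
    { toFun := fun g => e.conj (ρ g)
      map_one' := by rw [map_one]; exact e.conj_id
      map_mul' := fun g h => by rw [map_mul]; exact e.conj_comp _ _ }
  have he : ∀ g v, ρ' g (e v) = e (ρ g v) := fun g v => by
    change e (ρ g (e.symm (e v))) = _
    rw [e.symm_apply_apply]
  refine ⟨⟨Module.finrank k V, ρ', fun v => ?_⟩, e, he⟩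
  obtain ⟨n, hn⟩ := h (e.symm v)
  refine ⟨n, fun g hg => ?_⟩
  rw [← e.apply_symm_apply v, he, hn g hg]

theorem SmoothRep.cls_eq_add {A B C : SmoothRep L D k} (i : (Fin A.dim → k) →ₗ[k] (Fin B.dim → k))
    (j : (Fin B.dim → k) →ₗ[k] (Fin C.dim → k)) (hi : Function.Injective i)
    (hij : Function.Exact i j) (hj : Function.Surjective j)
    (hA : ∀ g v, i (A.ρ g v) = B.ρ g (i v)) (hC : ∀ g v, j (B.ρ g v) = C.ρ g (j v)) :
    B.cls = A.cls + C.cls := by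
  rw [SmoothRep.cls, SmoothRep.cls, SmoothRep.cls, ← QuotientAddGroup.mk_add]
  refine QuotientAddGroup.eq.mpr ?_
  rw [neg_add_eq_sub, ← neg_sub]
  exact AddSubgroup.neg_mem _ (AddSubgroup.subset_closure
    ⟨A, B, C, ⟨i, fun g => LinearMap.ext (hA g)⟩, ⟨j, fun g => LinearMap.ext (hC g)⟩, hi, hij, hj,
      rfl⟩)

theorem SmoothRep.cls_eq_zero {A : SmoothRep L D k} (h : A.dim = 0) : A.cls = 0 := by
  have : IsEmpty (Fin A.dim) := by rw [h]; infer_instance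
  have h1 := SmoothRep.cls_eq_add (A := A) (B := A) (C := A) LinearMap.id LinearMap.id
    (fun _ _ h => h) (fun x => iff_of_true (Subsingleton.elim _ _) ⟨x, rfl⟩) (fun x => ⟨x, rfl⟩)
    (fun _ _ => rfl) (fun _ _ => rfl)
  exact left_eq_add.mp h1

theorem SmoothRep.cls_eq_of_equiv {A B : SmoothRep L D k}
    (e : (Fin A.dim → k) ≃ₗ[k] (Fin B.dim → k)) (he : ∀ g v, e (A.ρ g v) = B.ρ g (e v)) :
    A.cls = B.cls := by
  let O : SmoothRep L D k := ⟨0, 1, fun v => ⟨0, fun _ _ => rfl⟩⟩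
  have h1 := SmoothRep.cls_eq_add (A := A) (B := B) (C := O) e.toLinearMap 0 e.injective
    (fun x => iff_of_true rfl (e.surjective x)) (fun x => ⟨0, Subsingleton.elim _ _⟩) he
    (fun _ _ => Subsingleton.elim _ _)
  rw [h1, O.cls_eq_zero rfl, add_zero]

variable [Finite k] [CharP k p]

/-- The pro-`p` group `U_D ^ 1` acts trivially on irreducible representations in
characteristic `p`. -/
theorem apply_eq_one_of_isIrreducible {V : Type*} [AddCommGroup V] [Module k V]
    [FiniteDimensional k V] {ρ : Representation k (unitGroup L D) V} (hρ : ρ.IsIrreducible)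
    (h : QuatSmooth L (unitGroup L D).subtype ρ) {u : unitGroup L D}
    (hu : u ∈ unitFiltration L D 1) : ρ u = 1 := by
  have := nontrivial_of_isIrreducible hρ
  obtain ⟨n, hn⟩ := exists_unitFiltration_apply_eq_one h
  have : Finite V := Module.finite_of_finite k
  let Φ : unitFiltration L D 1 →* (Module.End k V)ˣ :=
    (MonoidHom.toHomUnits ρ).comp (unitFiltration L D 1).subtype
  have hΦ : ∀ u v, (Φ u : Module.End k V) v = ρ u v := fun _ _ => rfl
  have hP : IsPGroup p Φ.range := by
    rintro ⟨_, u, rfl⟩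
    refine ⟨n, Subtype.ext ?_⟩
    rw [Subgroup.coe_pow, Subgroup.coe_one]
    change Φ u ^ p ^ n = 1
    rw [← map_pow]
    refine Units.ext (hn _ (unitFiltration_anti (Nat.le_succ n) ?_))
    exact pow_pow_mem_unitFiltration n u.2
  have hcard : p ∣ Nat.card V := by
    rw [Module.natCard_eq_pow_finrank (K := k)]
    refine dvd_pow ?_ (Module.finrank_pos (R := k) (M := V)).ne'
    have := Fintype.ofFinite k
    rw [Nat.card_eq_fintype_card]
    exact (CharP.cast_eq_zero_iff k p _).mp (FiniteField.cast_card_eq_zero k)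
  -- Orbit counting for a `p`-group on the finite set `V`: the fixed point `0` is accompanied by a
  -- nonzero one.
  obtain ⟨v, hv, hv0⟩ := hP.exists_fixed_point_of_prime_dvd_card_of_fixed_point V hcard
    (a := (0 : V)) (fun g => smul_zero g)
  let P : Submodule k V :=
    { carrier := {v | ∀ u ∈ unitFiltration L D 1, ρ u v = v}
      add_mem' := fun {a b} ha hb u hu => by rw [map_add, ha u hu, hb u hu]
      zero_mem' := fun u _ => map_zero _
      smul_mem' := fun c v hv u hu => by rw [map_smul, hv u hu] }
  have hPt := (eq_bot_or_eq_top_of_isIrreducible hρ P fun g w hw u hu => by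
    have h1 := hw (g⁻¹ * u * g⁻¹⁻¹) ((normal_unitFiltration 1).conj_mem _ hu g⁻¹)
    conv_rhs => rw [← h1]
    rw [← Module.End.mul_apply, ← Module.End.mul_apply, ← map_mul, ← map_mul]
    congr 2
    group).resolve_left fun hb => hv0 (by
      have : v ∈ P := fun u hu => hv ⟨Φ ⟨u, hu⟩, ⟨u, hu⟩, rfl⟩
      rw [hb, Submodule.mem_bot] at this
      exact this.symm)
  refine LinearMap.ext fun w => ?_
  have : w ∈ P := hPt ▸ Submodule.mem_top
  exact this u hu

variable {τ : unitGroup L D}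

/-- `K` acts through `K / U_D ^ 1 = k_D^×`, which the image of `τ` generates, so stability under `τ`
is stability under `K`. -/
theorem isSimpleOperator_of_isIrreducible {V : Type*} [AddCommGroup V] [Module k V]
    [FiniteDimensional k V] {ρ : Representation k (unitGroup L D) V} (hρ : ρ.IsIrreducible)
    (h : QuatSmooth L (unitGroup L D).subtype ρ)
    (hτ : ∀ y, y ∈ Subgroup.zpowers (unitResidue L D τ)) : IsSimpleOperator (ρ τ) := by
  intro P hP
  refine eq_bot_or_eq_top_of_isIrreducible hρ P fun g v hv => ?_
  obtain ⟨i, hi⟩ := exists_pow_inv_mul_mem_unitFiltration hτ g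
  rw [← mul_inv_cancel_left (τ ^ i) g, map_mul, apply_eq_one_of_isIrreducible hρ h hi, mul_one,
    map_pow]
  clear hi
  induction i with
  | zero => simpa using hv
  | succ i ih => rw [pow_succ', Module.End.mul_apply]; exact hP _ ih

theorem SmoothRep.cls_eq_of_charpoly_eq {A B : SmoothRep L D k} (hA : A.ρ.IsIrreducible)
    (hB : B.ρ.IsIrreducible) (hτ : ∀ y, y ∈ Subgroup.zpowers (unitResidue L D τ))
    (h : (A.ρ τ).charpoly = (B.ρ τ).charpoly) : A.cls = B.cls := by
  have := nontrivial_of_isIrreducible hA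
  have := nontrivial_of_isIrreducible hB
  obtain ⟨e, he⟩ := (isSimpleOperator_of_isIrreducible hA A.smooth hτ).exists_equiv
    (isSimpleOperator_of_isIrreducible hB B.smooth hτ) h
  refine SmoothRep.cls_eq_of_equiv e fun g => ?_
  obtain ⟨i, hi⟩ := exists_pow_inv_mul_mem_unitFiltration hτ g
  rw [← mul_inv_cancel_left (τ ^ i) g, map_mul A.ρ, map_mul B.ρ,
    apply_eq_one_of_isIrreducible hA A.smooth hi, apply_eq_one_of_isIrreducible hB B.smooth hi,
    mul_one, mul_one, map_pow, map_pow]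
  clear hi
  induction i with
  | zero => intro v; rfl
  | succ i ih =>
    intro v
    rw [pow_succ', pow_succ', Module.End.mul_apply, Module.End.mul_apply, he, ih]

open Classical in
/-- The class of the irreducible representations on which `τ` has the given charpoly. -/
def simpleClass (τ : unitGroup L D) (f : k[X]) : Groth L D k :=
  if h : ∃ S : SmoothRep L D k, S.ρ.IsIrreducible ∧ (S.ρ τ).charpoly = f then h.choose.cls else 0

open UniqueFactorizationMonoid in
-- Both sides are additive in short exact sequences, as charpolys are multiplicative there. An
-- irreducible representation has an irreducible charpoly, which determines it up to isomorphism.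
theorem SmoothRep.cls_eq_sum [DecidableEq k] (hτ : ∀ y, y ∈ Subgroup.zpowers (unitResidue L D τ))
    (A : SmoothRep L D k) :
    A.cls = ((normalizedFactors (A.ρ τ).charpoly).map (simpleClass τ)).sum := by
  obtain ⟨n, hn⟩ : ∃ n, A.dim = n := ⟨_, rfl⟩
  induction n using Nat.strong_induction_on generalizing A with
  | _ n ih =>
  rcases Nat.eq_zero_or_pos A.dim with h0 | hpos
  · have h1 : (A.ρ τ).charpoly = 1 :=
      (LinearMap.charpoly_monic _).natDegree_eq_zero.mp (by
        rw [LinearMap.charpoly_natDegree, Module.finrank_fin_fun, h0])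
    rw [A.cls_eq_zero h0, h1, normalizedFactors_one, Multiset.map_zero, Multiset.sum_zero]
  have : Nonempty (Fin A.dim) := ⟨⟨0, hpos⟩⟩
  by_cases hA : A.ρ.IsIrreducible
  · have hirr := (isSimpleOperator_of_isIrreducible hA A.smooth hτ).irreducible_charpoly
    have hex : ∃ S : SmoothRep L D k, S.ρ.IsIrreducible ∧
        (S.ρ τ).charpoly = (A.ρ τ).charpoly := ⟨A, hA, rfl⟩
    rw [normalizedFactors_irreducible hirr, (LinearMap.charpoly_monic _).normalize_eq_self,
      Multiset.map_singleton, Multiset.sum_singleton, simpleClass, dif_pos hex]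
    exact SmoothRep.cls_eq_of_charpoly_eq hA hex.choose_spec.1 hτ hex.choose_spec.2.symm
  · obtain ⟨P, hPs, hPb, hPt⟩ : ∃ P : Submodule k (Fin A.dim → k),
        (∀ g, ∀ v ∈ P, A.ρ g v ∈ P) ∧ P ≠ ⊥ ∧ P ≠ ⊤ := by
      by_contra hcon
      push Not at hcon
      exact hA (isIrreducible_of_forall fun P hP => or_iff_not_imp_left.mpr (hcon P hP))
    obtain ⟨m, hm⟩ := exists_unitFiltration_apply_eq_one A.smooth
    let ρ₁ := (⟨P, fun g v hv => hPs g v hv⟩ : Subrepresentation A.ρ).toRepresentation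
    let ρ₂ := A.ρ.quotient P hPs
    obtain ⟨A₁, e₁, he₁⟩ := exists_smoothRep (ρ := ρ₁)
      (quatSmooth_of_trivial (n := m) fun g hg => by
        ext1 v
        exact Subtype.ext (LinearMap.congr_fun (hm g hg) (v : Fin A.dim → k)))
    obtain ⟨A₂, e₂, he₂⟩ := exists_smoothRep (ρ := ρ₂)
      (quatSmooth_of_trivial (n := m) fun g hg => by
        refine LinearMap.ext fun v => ?_
        obtain ⟨v, rfl⟩ := P.mkQ_surjective v
        exact congrArg P.mkQ (LinearMap.congr_fun (hm g hg) v))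
    let i : (Fin A₁.dim → k) →ₗ[k] (Fin A.dim → k) := P.subtype ∘ₗ e₁.symm.toLinearMap
    let j : (Fin A.dim → k) →ₗ[k] (Fin A₂.dim → k) := e₂.toLinearMap ∘ₗ P.mkQ
    have hi : Function.Injective i := P.injective_subtype.comp e₁.symm.injective
    have hj : Function.Surjective j := e₂.surjective.comp P.mkQ_surjective
    have hij : Function.Exact i j := by
      intro v
      change e₂ (P.mkQ v) = 0 ↔ _
      rw [LinearEquiv.map_eq_zero_iff, Submodule.mkQ_apply, Submodule.Quotient.mk_eq_zero]
      refine ⟨fun hv => ⟨e₁ ⟨v, hv⟩, ?_⟩, ?_⟩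
      · change ((e₁.symm (e₁ ⟨v, hv⟩) : P) : Fin A.dim → k) = v
        rw [e₁.symm_apply_apply]
      · rintro ⟨w, rfl⟩
        exact (e₁.symm w).2
    have hiA : ∀ g v, i (A₁.ρ g v) = A.ρ g (i v) := by
      intro g v
      obtain ⟨v, rfl⟩ := e₁.surjective v
      change ((e₁.symm (A₁.ρ g (e₁ v)) : P) : Fin A.dim → k) = A.ρ g (e₁.symm (e₁ v) : P)
      rw [he₁, e₁.symm_apply_apply, e₁.symm_apply_apply]
      rfl
    have hjA : ∀ g v, j (A.ρ g v) = A₂.ρ g (j v) := by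
      intro g v
      change e₂ (P.mkQ (A.ρ g v)) = A₂.ρ g (e₂ (P.mkQ v))
      rw [he₂]
      rfl
    have hchar := charpoly_eq_mul_of_exact hi hij hj (TA := A₁.ρ τ) (TB := A.ρ τ) (TC := A₂.ρ τ)
      (hiA τ) (hjA τ)
    have hd₁ : A₁.dim = Module.finrank k P := by
      rw [e₁.finrank_eq, Module.finrank_fin_fun]
    have hd₂ : A₂.dim = Module.finrank k ((Fin A.dim → k) ⧸ P) := by
      rw [e₂.finrank_eq, Module.finrank_fin_fun]
    have hd := P.finrank_quotient_add_finrank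
    rw [Module.finrank_fin_fun] at hd
    have hp1 : 0 < Module.finrank k P :=
      Nat.pos_of_ne_zero fun h => hPb (Submodule.finrank_eq_zero.mp h)
    have hp2 : Module.finrank k P < A.dim := by
      have := Submodule.finrank_lt hPt
      rwa [Module.finrank_fin_fun] at this
    rw [SmoothRep.cls_eq_add i j hi hij hj hiA hjA, hchar, normalizedFactors_mul
      (LinearMap.charpoly_monic _).ne_zero (LinearMap.charpoly_monic _).ne_zero, Multiset.map_add,
      Multiset.sum_add, ih A₁.dim (by omega) A₁ rfl, ih A₂.dim (by omega) A₂ rfl]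

open UniqueFactorizationMonoid in
/-- Classes in `R_k(K)` are detected by the charpoly of `τ`. -/
theorem SmoothRep.cls_eq_nsmul (hτ : ∀ y, y ∈ Subgroup.zpowers (unitResidue L D τ))
    {A B : SmoothRep L D k} {n : ℕ} (h : (A.ρ τ).charpoly = (B.ρ τ).charpoly ^ n) :
    A.cls = n • B.cls := by
  classical
  rw [A.cls_eq_sum hτ, B.cls_eq_sum hτ, h, normalizedFactors_pow, Multiset.map_nsmul,
    Multiset.sum_nsmul]

end Quaternion

/-! ### Coinduction of a character along a cyclic quotient -/

section Coinduction

variable {k G : Type*} [Field k] [Group G] {H : Subgroup G} (ψ : H →* k) {τ : G} {n : ℕ}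

theorem mem_coindV_charRep {f : G → k} :
    f ∈ Representation.coindV H.subtype (charRep ψ) ↔
      ∀ (h : H) (g : G), f (h * g) = ψ h * f g := Iff.rfl

/-- An equivariant function is determined by arbitrary values on the powers `τ ^ i`, which represent
the right cosets of `H`. -/
theorem exists_coindV_equiv (hex : ∀ g, ∃! i : Fin (n + 1), g * (τ ^ (i : ℕ))⁻¹ ∈ H) :
    ∃ e : Representation.coindV H.subtype (charRep ψ) ≃ₗ[k] (Fin (n + 1) → k),
      ∀ f i, e f i = (f : G → k) (τ ^ (i : ℕ)) := by
  choose i hi huniq using hex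
  let F : (Fin (n + 1) → k) → G → k := fun c g => ψ ⟨g * (τ ^ (i g : ℕ))⁻¹, hi g⟩ * c (i g)
  have hF : ∀ (c g) (j : Fin (n + 1)) (hj : g * (τ ^ (j : ℕ))⁻¹ ∈ H), F c g = ψ ⟨_, hj⟩ * c j := by
    intro c g j hj
    obtain rfl := huniq g j hj
    rfl
  have hFmem : ∀ c, F c ∈ Representation.coindV H.subtype (charRep ψ) := by
    intro c
    rw [mem_coindV_charRep]
    intro h g
    have hj : (h : G) * g * (τ ^ (i g : ℕ))⁻¹ ∈ H := by
      rw [mul_assoc]; exact H.mul_mem h.2 (hi g)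
    rw [hF c _ _ hj, hF c g _ (hi g), ← mul_assoc, ← map_mul]
    congr 2
    exact Subtype.ext (mul_assoc _ _ _)
  let e₀ : Representation.coindV H.subtype (charRep ψ) →ₗ[k] (Fin (n + 1) → k) :=
    { toFun := fun f j => (f : G → k) (τ ^ (j : ℕ))
      map_add' := fun _ _ => rfl
      map_smul' := fun _ _ => rfl }
  refine ⟨LinearEquiv.ofBijective e₀ ⟨fun f f' h => ?_, fun c => ⟨⟨F c, hFmem c⟩, ?_⟩⟩,
    fun f j => rfl⟩
  · refine Subtype.ext (funext fun g => ?_)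
    have h1 := (mem_coindV_charRep ψ).mp f.2 ⟨_, hi g⟩ (τ ^ (i g : ℕ))
    have h2 := (mem_coindV_charRep ψ).mp f'.2 ⟨_, hi g⟩ (τ ^ (i g : ℕ))
    rw [inv_mul_cancel_right] at h1 h2
    rw [h1, h2]
    exact congrArg _ (congrFun h (i g))
  · funext j
    have hj : τ ^ (j : ℕ) * (τ ^ (j : ℕ))⁻¹ ∈ H := by rw [mul_inv_cancel]; exact H.one_mem
    change F c (τ ^ (j : ℕ)) = c j
    rw [hF c _ j hj]
    have : (⟨_, hj⟩ : H) = 1 := Subtype.ext (mul_inv_cancel _)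
    rw [this, map_one, one_mul]

theorem charpoly_coind [FiniteDimensional k (Representation.coindV H.subtype (charRep ψ))]
    (hex : ∀ g, ∃! i : Fin (n + 1), g * (τ ^ (i : ℕ))⁻¹ ∈ H) (hτ : τ ^ (n + 1) ∈ H) :
    (Representation.coind H.subtype (charRep ψ) τ).charpoly =
      X ^ (n + 1) - C (ψ ⟨τ ^ (n + 1), hτ⟩) := by
  obtain ⟨e, he⟩ := exists_coindV_equiv ψ hex
  set T := Representation.coind H.subtype (charRep ψ) τ
  -- Right translation by `τ` lowers the index of the support by one, so the basis is reversed to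
  -- obtain an ascending shift.
  let b := (Module.Basis.ofEquivFun e).reindex Fin.revPerm
  have hb : ∀ i j, e (b i) j = if j = i.rev then 1 else 0 := by
    intro i j
    have : b i = e.symm (Pi.single i.rev 1) := by
      simp [b, Module.Basis.reindex_apply]
    rw [this, e.apply_symm_apply, Pi.single_apply]
  have hT : ∀ f j, e (T f) j = (f : G → k) (τ ^ ((j : ℕ) + 1)) := by
    intro f j
    rw [he, pow_succ]
    rfl
  have hT1 : ∀ f (j : Fin n), e (T f) j.castSucc = e f j.succ := by
    intro f j
    rw [hT, he]; rfl
  have hT2 : ∀ f, e (T f) (Fin.last n) = ψ ⟨τ ^ (n + 1), hτ⟩ * e f 0 := by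
    intro f
    rw [hT, he]
    have := (mem_coindV_charRep ψ).mp f.2 ⟨_, hτ⟩ 1
    rw [mul_one] at this
    rw [Fin.val_last, this, Fin.val_zero, pow_zero]
  refine charpoly_eq_of_shift b T _ (e.injective (funext fun j => ?_))
    fun i => e.injective (funext fun j => ?_)
  · rw [map_smul, Pi.smul_apply, hb, smul_eq_mul, Fin.rev_zero]
    induction j using Fin.lastCases with
    | last => rw [hT2, hb]; simp
    | cast j => rw [hT1, hb]; simp [Fin.succ_ne_zero]
  · rw [hb, Fin.rev_succ]
    induction j using Fin.lastCases with
    | last =>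
      rw [hT2, hb]
      have h1 : (0 : Fin (n + 1)) ≠ i.castSucc.rev := by
        rw [Fin.rev_castSucc]; exact (Fin.succ_ne_zero _).symm
      have h2 : Fin.last n ≠ i.rev.castSucc := (Fin.castSucc_lt_last _).ne'
      rw [if_neg h1, if_neg h2, mul_zero]
    | cast j =>
      rw [hT1, hb, Fin.rev_castSucc]
      simp

theorem coind_charRep_eq_one {u : G} (h : ∀ x, ∃ hx : x * u * x⁻¹ ∈ H, ψ ⟨_, hx⟩ = 1) :
    Representation.coind H.subtype (charRep ψ) u = 1 := by
  refine LinearMap.ext fun f => Subtype.ext (funext fun x => ?_)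
  obtain ⟨hx, h1⟩ := h x
  have h2 := (mem_coindV_charRep ψ).mp f.2 ⟨_, hx⟩ x
  rw [h1, one_mul] at h2
  change (f : G → k) (x * u) = (f : G → k) x
  rw [← h2, inv_mul_cancel_right]

end Coinduction

/-! ### Matrices of operators on a lattice and their reduction -/

section MatrixLattice

variable {R K V ι : Type*} [CommRing R] [Field K] [Algebra R K] [IsFractionRing R K]
  [AddCommGroup V] [Module K V] [Module R V] [IsScalarTower R K V] {M : Submodule R V}
  [Submodule.IsLattice K M] [Fintype ι] [DecidableEq ι]

theorem toMatrix_extendOfIsLattice (b : Module.Basis ι R M) {f : Module.End K V}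
    {g : Module.End R M} (h : ∀ v : M, f v = g v) :
    LinearMap.toMatrix (b.extendOfIsLattice K) (b.extendOfIsLattice K) f =
      (LinearMap.toMatrix b b g).map (algebraMap R K) := by
  ext i j
  have h1 : f (b.extendOfIsLattice K j) =
      ∑ l, algebraMap R K (b.repr (g (b j)) l) • b.extendOfIsLattice K l := by
    simp only [Module.Basis.extendOfIsLattice_apply, algebraMap_smul]
    rw [h]
    conv_lhs => rw [← b.sum_repr (g (b j))]
    rw [Submodule.coe_sum]
    rfl
  rw [LinearMap.toMatrix_apply, Matrix.map_apply, LinearMap.toMatrix_apply, h1,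
    Module.Basis.repr_sum_self]

theorem charpoly_map_of_isLattice [Module.Finite R M] [Module.Free R M] [FiniteDimensional K V]
    (b : Module.Basis ι R M) {f : Module.End K V}
    {g : Module.End R M} (h : ∀ v : M, f v = g v) :
    g.charpoly.map (algebraMap R K) = f.charpoly := by
  rw [← LinearMap.charpoly_toMatrix g b, ← Matrix.charpoly_map, ← toMatrix_extendOfIsLattice b h,
    LinearMap.charpoly_toMatrix]

theorem residue_repr_eq_zero_iff {R M : Type*} [CommRing R] [IsLocalRing R] [AddCommGroup M]
    [Module R M] (b : Module.Basis ι R M) (v : M) :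
    (∀ i, IsLocalRing.residue R (b.repr v i) = 0) ↔
      v ∈ (IsLocalRing.maximalIdeal R • ⊤ : Submodule R M) := by
  simp only [IsLocalRing.residue_eq_zero_iff]
  constructor
  · intro h
    rw [← b.sum_repr v]
    exact Submodule.sum_mem _ fun i _ => Submodule.smul_mem_smul (h i) Submodule.mem_top
  · intro h
    induction h using Submodule.smul_induction_on' with
    | smul a ha w _ =>
      intro i
      rw [map_smul, Finsupp.smul_apply, smul_eq_mul]
      exact Ideal.mul_mem_right _ _ ha
    | add x _ y _ hx hy =>
      intro i
      rw [map_add, Finsupp.add_apply]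
      exact Ideal.add_mem _ (hx i) (hy i)

theorem residue_repr_apply {R M : Type*} [CommRing R] [IsLocalRing R] [AddCommGroup M]
    [Module R M] (b : Module.Basis ι R M) (f : Module.End R M) (v : M) :
    (fun i => IsLocalRing.residue R (b.repr (f v) i)) =
      Matrix.toLin' ((LinearMap.toMatrix b b f).map (algebraMap R (IsLocalRing.ResidueField R)))
        fun i => IsLocalRing.residue R (b.repr v i) := by
  funext i
  rw [← LinearMap.toMatrix_mulVec_repr b b, Matrix.toLin'_apply, Matrix.mulVec, Matrix.mulVec,
    dotProduct, dotProduct, map_sum]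
  simp only [map_mul]
  rfl

/-- The coordinates in a basis, modulo the maximal ideal. -/
def residueCoords {R M : Type*} [CommRing R] [IsLocalRing R] [AddCommGroup M]
    [Module R M] (b : Module.Basis ι R M) :
    M →ₛₗ[IsLocalRing.residue R] (ι → IsLocalRing.ResidueField R) where
  toFun v i := IsLocalRing.residue R (b.repr v i)
  map_add' v w := by ext i; simp
  map_smul' a v := by ext i; simp

theorem residueCoords_surjective {R M : Type*} [CommRing R] [IsLocalRing R] [AddCommGroup M]
    [Module R M] (b : Module.Basis ι R M) : Function.Surjective (residueCoords b) := by
  intro c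
  choose c' hc' using fun i => IsLocalRing.residue_surjective (c i)
  refine ⟨b.equivFun.symm c', funext fun i => ?_⟩
  change IsLocalRing.residue R (b.equivFun (b.equivFun.symm c') i) = c i
  rw [LinearEquiv.apply_symm_apply, hc']

theorem residueCoords_eq_zero_iff {R M : Type*} [CommRing R] [IsLocalRing R] [AddCommGroup M]
    [Module R M] (b : Module.Basis ι R M) (v : M) :
    residueCoords b v = 0 ↔ v ∈ (IsLocalRing.maximalIdeal R • ⊤ : Submodule R M) :=
  funext_iff.trans (residue_repr_eq_zero_iff b v)

theorem residueCoords_apply {R M G : Type*} [CommRing R] [IsLocalRing R] [AddCommGroup M] [Group G]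
    [Module R M] (b : Module.Basis ι R M) (ρ : Representation R G M) (g : G) (v : M) :
    residueCoords b (ρ g v) =
      scalarExtension (F := IsLocalRing.ResidueField R) b ρ g (residueCoords b v) :=
  residue_repr_apply b (ρ g) v

end MatrixLattice

/-! ### Stable lattices and their reductions -/

section Lattice

variable {p : ℕ} [Fact p.Prime] {L : LocalField p}
  {D : Type*} [DivisionRing D] [Algebra L D]
  [Algebra.IsCentral L D] [hD : Fact (Module.finrank L D = 4)] [FiniteDimensional ℚ_[p] L]
  {E : LocalField p} {V : Type*} [AddCommGroup V] [Module E V]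
  {ϑ : Representation E (unitGroup L D) V} {n : ℕ}

/-- The action factors through a finite quotient, so the translates of a basis form a finite stable
set; take its span. -/
theorem exists_isStableLattice [FiniteDimensional E V]
    (hn : ∀ g ∈ unitFiltration L D n, ϑ g = 1) : ∃ Λ, IsStableLattice ϑ Λ := by
  have hfin := finiteIndex_unitFiltration (L := L) (D := D) n
  have : Finite (unitGroup L D ⧸ unitFiltration L D n) := Subgroup.finite_quotient_of_finiteIndex
  let b := Module.finBasis E V
  let S : Set V := Set.range fun x : unitGroup L D × Fin (Module.finrank E V) => ϑ x.1 (b x.2)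
  have hS : S = Set.range fun x : (unitGroup L D ⧸ unitFiltration L D n) ×
      Fin (Module.finrank E V) => ϑ x.1.out (b x.2) := by
    refine Set.Subset.antisymm ?_ ?_
    · rintro _ ⟨⟨g, i⟩, rfl⟩
      refine ⟨(QuotientGroup.mk g, i), ?_⟩
      have h1 : (QuotientGroup.mk (s := unitFiltration L D n) g).out⁻¹ * g ∈ unitFiltration L D n :=
        QuotientGroup.eq.mp (QuotientGroup.mk g).out_eq
      have h2 : ϑ g = ϑ (QuotientGroup.mk (s := unitFiltration L D n) g).out := by
        conv_lhs => rw [← mul_inv_cancel_left (QuotientGroup.mk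
          (s := unitFiltration L D n) g).out g, map_mul, hn _ h1, mul_one]
      exact (LinearMap.congr_fun h2 _).symm
    · rintro _ ⟨⟨x, i⟩, rfl⟩
      exact ⟨(x.out, i), rfl⟩
  refine ⟨Submodule.span (integers E) S, ?_, ?_, ?_⟩
  · exact Submodule.fg_span (hS ▸ Set.finite_range _)
  · rw [eq_top_iff, ← b.span_eq, Submodule.span_le]
    rintro _ ⟨i, rfl⟩
    refine Submodule.subset_span (Submodule.subset_span ⟨(1, i), ?_⟩)
    change ϑ 1 (b i) = _
    rw [map_one]; rfl
  · intro g v hv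
    induction hv using Submodule.span_induction with
    | mem x hx =>
      obtain ⟨⟨h, i⟩, rfl⟩ := hx
      refine Submodule.subset_span ⟨(g * h, i), ?_⟩
      change ϑ (g * h) _ = _
      rw [map_mul]; rfl
    | zero => rw [map_zero]; exact Submodule.zero_mem _
    | add x y _ _ hx hy => rw [map_add]; exact Submodule.add_mem _ hx hy
    | smul a x _ hx =>
      have : ϑ g (a • x) = a • ϑ g x := (ϑ g).map_smul_of_tower a x
      rw [this]; exact Submodule.smul_mem _ _ hx

/-- The action on a stable lattice. -/
def latticeRep {Λ : Submodule (integers E) V} (h : ∀ g, ∀ v ∈ Λ, ϑ g v ∈ Λ) :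
    Representation (integers E) (unitGroup L D) Λ where
  toFun g := ((ϑ g).restrictScalars (integers E)).restrict (h g)
  map_one' := LinearMap.ext fun v => Subtype.ext (by
    change ϑ 1 (v : V) = v
    rw [map_one]; rfl)
  map_mul' a b := LinearMap.ext fun v => Subtype.ext (by
    change ϑ (a * b) (v : V) = ϑ a (ϑ b v)
    rw [map_mul]; rfl)

/-- The lattice is free, so one basis computes the action on `V`, on the lattice and on its
reduction. Hence the charpoly on the reduction is the residue of the integral charpoly, for every
stable lattice. -/
theorem exists_isLatticeReduction [FiniteDimensional ℚ_[p] E] [FiniteDimensional E V]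
    (hn : ∀ g ∈ unitFiltration L D n, ϑ g = 1)
    {Λ : Submodule (integers E) V} (hΛ : IsStableLattice ϑ Λ) :
    ∃ A, IsLatticeReduction ϑ Λ A ∧ ∀ (g : unitGroup L D) (P : (integers E)[X]),
      (ϑ g).charpoly = P.map (algebraMap (integers E) E) →
        (A.ρ g).charpoly = P.map (IsLocalRing.residue (integers E)) := by
  have : Submodule.IsLattice E Λ := ⟨hΛ.1, hΛ.2.1⟩
  have : Module.Finite (integers E) Λ := Module.Finite.iff_fg.mpr hΛ.1
  have : Module.IsTorsionFree (integers E) E :=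
    Module.isTorsionFree_iff_algebraMap_injective.mpr (IsFractionRing.injective _ _)
  have hfree : Module.Free (integers E) Λ := Submodule.IsLattice.free E Λ
  let b := Module.finBasis (integers E) Λ
  let ρ := latticeRep hΛ.2.2
  have hρ : ∀ g ∈ unitFiltration L D n, ρ g = 1 := fun g hg =>
    LinearMap.ext fun v => Subtype.ext (LinearMap.congr_fun (hn g hg) (v : V))
  let σ := scalarExtension (F := residueField E) b ρ
  have hσ : ∀ g ∈ unitFiltration L D n, σ g = 1 := fun g hg => by
    change Matrix.toLin' _ = _
    rw [hρ g hg, Module.End.one_eq_id, LinearMap.toMatrix_id,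
      Matrix.map_one _ (map_zero _) (map_one _), Matrix.toLin'_one]
    rfl
  refine ⟨⟨_, σ, quatSmooth_of_trivial hσ⟩, ⟨residueCoords b, residueCoords_surjective b,
    residueCoords_eq_zero_iff b, ?_⟩, ?_⟩
  · intro g v v' hv
    have hv' : v' = ρ g v := Subtype.ext hv
    rw [hv']
    exact residueCoords_apply b ρ g v
  · intro g P hP
    have h1 : (ρ g).charpoly = P := by
      refine Polynomial.map_injective _ (IsFractionRing.injective (integers E) E) ?_
      rw [← hP]
      exact charpoly_map_of_isLattice b fun _ => rfl
    have h2 := charpoly_scalarExtension (F := residueField E) b ρ g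
    exact h2.trans (congrArg (Polynomial.map _) h1)

end Lattice

/-! ### The central character and its reduction -/

section CentralCharacter

variable {p : ℕ} [Fact p.Prime] {L : LocalField p}
  {D : Type*} [DivisionRing D] [Algebra L D]
  [Algebra.IsCentral L D] [hD : Fact (Module.finrank L D = 4)] [FiniteDimensional ℚ_[p] L]

theorem commute_of_eq_algebraMap {z : unitGroup L D}
    (hz : ∃ a : L, ((z : Dˣ) : D) = algebraMap L D a) (g : unitGroup L D) : Commute z g := by
  obtain ⟨a, ha⟩ := hz
  refine Subtype.ext (Units.ext ?_)
  change ((z : Dˣ) : D) * ((g : Dˣ) : D) = (g : Dˣ) * (z : Dˣ)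
  rw [ha]
  exact Algebra.commutes a _

variable {E : LocalField p} {V : Type*} [AddCommGroup V] [Module E V]
  {ϑ : Representation E (unitGroup L D) V} {n : ℕ}

/-- The scalar comes from `hE`. A power of `z` lies in `U_D ^ n`, so the scalar is a root of unity,
hence integral. -/
theorem exists_central_scalar [Nontrivial V]
    (hE : ∀ f : ϑ.IntertwiningMap ϑ, ∃ a : E, ∀ v : V, f v = a • v)
    (hn : ∀ g ∈ unitFiltration L D n, ϑ g = 1) {z : unitGroup L D}
    (hz : ∃ a : L, ((z : Dˣ) : D) = algebraMap L D a) :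
    ∃ c : integers E, ∀ v, ϑ z v = (c : E) • v := by
  obtain ⟨c, hc⟩ := hE ⟨ϑ z, fun g => by
    change ϑ z * ϑ g = ϑ g * ϑ z
    rw [← map_mul, (commute_of_eq_algebraMap hz g).eq, map_mul]⟩
  have hc : ∀ v, ϑ z v = c • v := hc
  have hpow : ∀ (i : ℕ) v, ϑ (z ^ i) v = c ^ i • v := by
    intro i v
    induction i with
    | zero => simp
    | succ i ih => rw [pow_succ', map_mul, Module.End.mul_apply, ih, hc, smul_smul, pow_succ']
  have hfin := finiteIndex_unitFiltration (L := L) (D := D) n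
  obtain ⟨v, hv⟩ := exists_ne (0 : V)
  have h1 : c ^ (unitFiltration L D n).index = 1 := by
    refine smul_left_injective E hv ?_
    change c ^ (unitFiltration L D n).index • v = (1 : E) • v
    rw [← hpow, hn _ (Subgroup.pow_index_mem _ z), one_smul]
    rfl
  refine ⟨⟨c, (mem_integers E c).mpr (le_of_eq ?_)⟩, hc⟩
  have h2 := congrArg (fun x : E => ‖(x : PadicAlgCl p)‖) h1
  simp only [IntermediateField.coe_pow, norm_pow, IntermediateField.coe_one, norm_one] at h2
  exact (pow_eq_one_iff_of_nonneg (norm_nonneg _) hfin.index_ne_zero).mp h2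

/-- The quotient `z⁻¹ * z'` has `p`-power order modulo `U_D ^ n`, so the scalars agree after raising
to the power `p ^ n`, and Frobenius is injective on `k_E`. -/
theorem residue_eq_of_central_scalar [FiniteDimensional ℚ_[p] E] [Nontrivial V]
    (hn : ∀ g ∈ unitFiltration L D n, ϑ g = 1) {z z' : unitGroup L D}
    (hz : ∃ a : L, ((z : Dˣ) : D) = algebraMap L D a) (h : z⁻¹ * z' ∈ unitFiltration L D 1)
    {c c' : integers E} (hc : ∀ v, ϑ z v = (c : E) • v) (hc' : ∀ v, ϑ z' v = (c' : E) • v) :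
    IsLocalRing.residue (integers E) c = IsLocalRing.residue (integers E) c' := by
  have hpow : ∀ {y : unitGroup L D} {b : E}, (∀ v, ϑ y v = b • v) → ∀ (i : ℕ) v,
      ϑ (y ^ i) v = b ^ i • v := by
    intro y b hb i v
    induction i with
    | zero => simp
    | succ i ih => rw [pow_succ', map_mul, Module.End.mul_apply, ih, hb, smul_smul, pow_succ']
  have h1 : ϑ ((z⁻¹ * z') ^ p ^ n) = 1 :=
    hn _ (unitFiltration_anti (Nat.le_succ n) (pow_pow_mem_unitFiltration n h))
  have h2 : z' ^ p ^ n = z ^ p ^ n * (z⁻¹ * z') ^ p ^ n := by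
    rw [← (commute_of_eq_algebraMap hz _).mul_pow, mul_inv_cancel_left]
  obtain ⟨v, hv⟩ := exists_ne (0 : V)
  have h3 : (c : E) ^ p ^ n = (c' : E) ^ p ^ n := by
    refine smul_left_injective E hv ?_
    change (c : E) ^ p ^ n • v = (c' : E) ^ p ^ n • v
    rw [← hpow hc, ← hpow hc', h2, map_mul, h1, mul_one]
  have h4 : c ^ p ^ n = c' ^ p ^ n := Subtype.ext (by exact_mod_cast h3)
  have h5 := congrArg (IsLocalRing.residue (integers E)) h4
  rw [map_pow, map_pow] at h5
  exact iterateFrobenius_inj (residueField E) p n h5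

/-- An element of `Z I₁` determines its central part only modulo `U_D ^ 1`. The residue of the
scalar does not depend on that choice, so it defines a character. -/
theorem exists_reducedCentralChar [FiniteDimensional ℚ_[p] E] [Nontrivial V]
    (hE : ∀ f : ϑ.IntertwiningMap ϑ, ∃ a : E, ∀ v : V, f v = a • v)
    (hn : ∀ g ∈ unitFiltration L D n, ϑ g = 1) :
    ∃ ψ : centerI1 L D →* residueField E, ∀ (g : centerI1 L D) (z : unitGroup L D)
      (c : integers E), (∃ a : L, ((z : Dˣ) : D) = algebraMap L D a) →
      z⁻¹ * g ∈ unitFiltration L D 1 → (∀ v, ϑ z v = (c : E) • v) →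
      ψ g = IsLocalRing.residue (integers E) c := by
  choose z hz hzg using fun g : centerI1 L D => (mem_centerI1_iff L D).mp g.2
  choose c hc using fun g => exists_central_scalar hE hn (hz g)
  have key : ∀ (g : centerI1 L D) (y : unitGroup L D)
      (b : integers E), (∃ a : L, ((y : Dˣ) : D) = algebraMap L D a) →
      y⁻¹ * g ∈ unitFiltration L D 1 → (∀ v, ϑ y v = (b : E) • v) →
      IsLocalRing.residue (integers E) (c g) = IsLocalRing.residue (integers E) b := by
    intro g y b hy hyg hb
    refine residue_eq_of_central_scalar hn (hz g) ?_ (hc g) hb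
    have := Subgroup.mul_mem _ (hzg g) (Subgroup.inv_mem _ hyg)
    rwa [mul_inv_rev, inv_inv, mul_assoc, mul_inv_cancel_left] at this
  refine ⟨
    { toFun := fun g => IsLocalRing.residue (integers E) (c g)
      map_one' := by
        rw [key 1 1 1 ⟨1, by simp⟩ (by simp) (by simp), map_one]
      map_mul' := fun g h => by
        obtain ⟨a, ha⟩ := hz g
        obtain ⟨b, hb⟩ := hz h
        rw [key (g * h) (z g * z h) (c g * c h) ⟨a * b, ?_⟩ ?_ ?_, map_mul]
        · rw [map_mul, ← ha, ← hb]; rfl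
        · have h1 := (normal_unitFiltration (L := L) (D := D) 1).conj_mem _ (hzg g) (z h)⁻¹
          rw [inv_inv, ← mul_assoc] at h1
          have h2 := Subgroup.mul_mem _ h1 (hzg h)
          have h3 : ((g : unitGroup L D) * z h) = z h * g :=
            ((commute_of_eq_algebraMap (hz h) _).eq).symm
          rw [Subgroup.coe_mul, mul_inv_rev]
          convert h2 using 1
          group
        · intro v
          rw [map_mul, Module.End.mul_apply, hc h, map_smul, hc g, smul_smul, mul_comm]
          rfl }, key⟩

theorem isReducedCentralChar_of_forall {ψ : centerI1 L D →* residueField E} [Nontrivial V]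
    (hE : ∀ f : ϑ.IntertwiningMap ϑ, ∃ a : E, ∀ v : V, f v = a • v)
    (hn : ∀ g ∈ unitFiltration L D n, ϑ g = 1)
    (hψ : ∀ (g : centerI1 L D) (z : unitGroup L D)
      (c : integers E), (∃ a : L, ((z : Dˣ) : D) = algebraMap L D a) →
      z⁻¹ * g ∈ unitFiltration L D 1 → (∀ v, ϑ z v = (c : E) • v) →
      ψ g = IsLocalRing.residue (integers E) c) :
    IsReducedCentralChar ϑ ψ := by
  refine ⟨fun g hg => ?_, fun g hg => ?_⟩
  · rw [hψ g 1 1 ⟨1, by simp⟩ (by rw [inv_one, one_mul]; exact hg) (by simp), map_one]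
  · obtain ⟨c, hc⟩ := exists_central_scalar hE hn hg
    exact ⟨c, hc, hψ g g c hg (by rw [inv_mul_cancel]; exact Subgroup.one_mem _) hc⟩

theorem normal_centerI1 : (centerI1 L D).Normal := by
  rw [centerI1_eq_comap]
  infer_instance

theorem existsUnique_mul_pow_inv_mem_centerI1 {τ : unitGroup L D}
    (hτ : ∀ y, y ∈ Subgroup.zpowers (unitResidue L D τ))
    (h : τ ^ (resCard L + 1) ∈ centerI1 L D) (g : unitGroup L D) :
    ∃! i : Fin (resCard L + 1), g * (τ ^ (i : ℕ))⁻¹ ∈ centerI1 L D := by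
  have hH := normal_centerI1 (L := L) (D := D)
  obtain ⟨i, hi⟩ := exists_pow_inv_mul_mem_centerI1 hτ h g
  refine ⟨i, hH.mem_comm hi, fun j hj => ?_⟩
  have hj := hH.mem_comm hj
  refine eq_of_pow_inv_mul_mem_centerI1 hτ (Subgroup.one_mem _) (Subgroup.one_mem _) ?_
  have := Subgroup.mul_mem _ hj (Subgroup.inv_mem _ hi)
  rw [mul_inv_rev, inv_inv, mul_assoc, mul_inv_cancel_left] at this
  rwa [mul_one, mul_one]

theorem quatSmooth_coind {k : Type*} [Field k] {ψ : centerI1 L D →* k}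
    (hψ : ∀ g : centerI1 L D, (g : unitGroup L D) ∈ unitFiltration L D 1 → ψ g = 1) :
    QuatSmooth L (unitGroup L D).subtype
      (Representation.coind (centerI1 L D).subtype (charRep ψ)) := by
  have h : ∀ u ∈ unitFiltration L D 1,
      Representation.coind (centerI1 L D).subtype (charRep ψ) u = 1 := fun u hu =>
    coind_charRep_eq_one ψ fun x =>
      have h1 := (normal_unitFiltration 1).conj_mem u hu x
      ⟨unitFiltration_one_le_centerI1 L D h1, hψ _ h1⟩
  exact quatSmooth_of_trivial h

end CentralCharacter

end LocalType

end

/-! ### Comparison of the two classes -/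

open LocalType Polynomial in
theorem proposition4p7 (p : ℕ) [Fact p.Prime]
    (L : LocalType.LocalField p) [FiniteDimensional ℚ_[p] L]
    (D : Type*) [DivisionRing D] [Algebra L D] [Algebra.IsCentral L D]
    (hD : Module.finrank L D = 4)
    (E : LocalType.LocalField p) [FiniteDimensional ℚ_[p] E]
    (w : LocalType.WeilDeligneRep L) (hr : w.r.IsIrreducible)
    (m : ℕ) (hm : 1 ≤ m) (hcond : IsLeast (LocalType.twistConductors w.r) (2 * m + 1))
    {V : Type*} [AddCommGroup V] [Module E V]
    (ϑ : Representation E (LocalType.unitGroup L D) V) (hϑ : LocalType.IsKType ϑ w)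
    (hE : ∀ f : ϑ.IntertwiningMap ϑ, ∃ a : E, ∀ v : V, f v = a • v) :
    ∃ ψ : LocalType.centerI1 L D →* LocalType.residueField E,
      LocalType.IsReducedCentralChar ϑ ψ ∧
      (∃ x : LocalType.Groth L D (LocalType.residueField E),
        LocalType.HasClass
          (Representation.coind (LocalType.centerI1 L D).subtype (LocalType.charRep ψ)) x ∧
        LocalType.IsReduction ϑ (LocalType.resCard L ^ (m - 1) • x)) ∧
      Module.finrank E V = LocalType.resCard L ^ (m - 1) * (LocalType.resCard L + 1) := by
  have : Fact (Module.finrank L D = 4) := ⟨hD⟩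
  have := finiteDimensional_of_isIrreducible hϑ.1 hϑ.2.1
  have := nontrivial_of_isIrreducible hϑ.1
  obtain ⟨n, hn⟩ := exists_unitFiltration_apply_eq_one hϑ.2.1
  -- Level `n + 1` makes the noncentral part of `τ ^ (q + 1)` act trivially and also, even for `n =
  -- 0`, lie in `U_D ^ 1`, where `ψ` is trivial.
  obtain ⟨τ, z, hz, hzτ, hτ⟩ := exists_generator L D (n + 1)
  have hτ1 := pow_mem_centerI1 hz (Nat.le_add_left 1 n) hzτ
  obtain ⟨ψ, hψ⟩ := exists_reducedCentralChar hE hn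
  obtain ⟨c, hc⟩ := exists_central_scalar hE hn hz
  have hψc : ψ ⟨_, hτ1⟩ = IsLocalRing.residue (integers E) c :=
    hψ _ z c hz (unitFiltration_anti (Nat.le_add_left 1 n) hzτ) hc
  have hψ1 := isReducedCentralChar_of_forall hE hn hψ
  have hcτ : ∀ v, ϑ (τ ^ (resCard L + 1)) v = (c : E) • v := fun v => by
    rw [← mul_inv_cancel_left z (τ ^ (resCard L + 1)), map_mul,
      hn _ (unitFiltration_anti (Nat.le_succ n) hzτ), mul_one, hc]
  have hdim := finrank_and_charpoly_of_isKType hϑ hE hr hm hcond.1 hτ hτ1 hcτ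
  have hex := existsUnique_mul_pow_inv_mem_centerI1 hτ hτ1
  obtain ⟨e, -⟩ := exists_coindV_equiv ψ hex
  have : FiniteDimensional (residueField E)
      (Representation.coindV (centerI1 L D).subtype (charRep ψ)) := Module.Finite.equiv e.symm
  -- `B` is the coinduced representation in coordinates; induction and coinduction agree here, as `Z
  -- I₁` has finite index.
  obtain ⟨B, e', he'⟩ := exists_smoothRep (quatSmooth_coind hψ1.1)
  have hB : (B.ρ τ).charpoly =
      X ^ (resCard L + 1) - C (IsLocalRing.residue (integers E) c) := by
    rw [← hψc, ← charpoly_coind ψ hex hτ1, ← LinearEquiv.charpoly_conj e']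
    congr 1
    refine LinearMap.ext fun v => ?_
    obtain ⟨f, rfl⟩ := e'.surjective v
    rw [he', LinearEquiv.conj_apply_apply, LinearEquiv.symm_apply_apply]
  refine ⟨ψ, hψ1, ⟨B.cls, ⟨B, ⟨(Representation.Equiv.mk e' fun g => LinearMap.ext fun v =>
    (he' g v).symm).symm⟩, rfl⟩, exists_isStableLattice hn, fun Λ hΛ => ?_⟩, hdim.1⟩
  obtain ⟨A, hA, hAτ⟩ := exists_isLatticeReduction hn hΛ
  refine ⟨A, hA, (SmoothRep.cls_eq_nsmul hτ ?_).symm⟩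
  -- The polynomial over `𝒪_E` lifts both sides: over `E` it is the charpoly of `ϑ τ`, and its
  -- residue is the required power of the charpoly of `B.ρ τ`.
  rw [hB, hAτ τ ((X ^ (resCard L + 1) - C c) ^ (resCard L ^ (m - 1)))]
  · simp
  · rw [hdim.2]
    simp
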